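/- Let $\mathbb K=\mathbb R$ (smooth category) or $\mathbb K=\mathbb C$ (holomorphic category). A three-dimensional bi-flat $F$-manifold is a three-dimensional manifold $M$ with two $F$-manifold structures $(\circ,e)$, $(*,E)$ (smooth commutative associative products on $TM$ with units $e$, $E$ satisfying the Hertling–Manin condition) and two smooth flat torsionless affine connections $\nabla_1,\nabla_2$ such that: $\nabla_1e=0$ and $(\nabla_{1,X}c)(Y,Z)=(\nabla_{1,Y}c)(X,Z)$ for $c(X,Y)=X\circ Y$; $E$ is invertible for $\circ$, $[e,E]=e$ and $X*Y=X\circ Y\circ E^{-1}$; $\nabla_2E=0$ and $(\nabla_{2,X}c^*)(Y,Z)=(\nabla_{2,Y}c^*)(X,Z)$ for $c^*(X,Y)=X*Y$; and $(d_{\nabla_1}-d_{\nabla_2})(X\circ)=0=(d_{\nabla_1}-d_{\nabla_2})(X*)$ for all vector fields $X$. Consider those that are regular with three equal eigenvalues, i.e. at every point $L=E\circ$ has a single Jordan block of size three (call these one-block structures). For functions $F_1,\dots,F_6$ of one variable $z$ consider the system $$\begin{aligned} F_1'&=0,\\ F_2'&=2F_4F_3z+2F_2F_1z-2F_5F_1z+F_6F_1-F_2F_3+F_4-F_3,\\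 F_3'&=-F_4F_3-F_2F_1+F_5F_1-F_1,\\ F_4'&=F_4F_3+F_2F_1-F_5F_1-F_1,\\ F_5'&=F_4F_3z+F_2F_1z-F_5F_1z-F_6F_1+F_2F_3+F_1z-F_3,\\ F_6'&=-2F_4F_3z^2-2F_2F_1z^2+2F_5F_1z^2-F_6F_1z+F_2F_3z+F_4F_6-F_4z+F_2^2-F_2F_5+F_3z-F_2. \end{aligned}\tag{S}$$ Say that a bi-flat structure has the normal form $F$ in coordinates $u^1,u^2,u^3$ (with $u^1\ne0$, $u^2\neq 0$, and $z=u^3/u^2$ in the domain of $F$) if $e=\partial_1$, $E=\sum_i u^i\partial_i$, $\partial_i\circ\partial_j=\partial_{i+j-1}$ (zero if $i+j>4$), the Christoffel symbols of $\nabla_1$ are $$\Gamma^1_{23}=\Gamma^1_{32}=\Gamma^2_{33}=\tfrac{F_1(z)}{u^2},\quad \Gamma^3_{23}=\Gamma^3_{32}=\tfrac{F_2(z)}{u^2},\quad \Gamma^2_{23}=\Gamma^2_{32}=\tfrac{F_3(z)}{u^2},$$ $$\Gamma^1_{22}=\tfrac{F_4(z)}{u^2},\quad \Gamma^2_{22}=\tfrac{F_5(z)}{u^2},\quad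 \Gamma^3_{22}=\tfrac{F_6(z)}{u^2},\quad \Gamma^3_{33}=\tfrac{F_3(z)-F_4(z)}{u^2},$$ all others being zero, and $\nabla_{2,X}Y=\nabla_{1,X}Y-\nabla_{1,X*Y}E$. For $b,c\in\mathbb K$ let $\mathrm{P_{IV}}(b,c)$ be the Painlevé IV equation $$y\,y''=\tfrac32y^4+4t\,y^3+2(t^2-b)y^2+\tfrac12 y'^2+c .$$ Its solutions are understood to be smooth (holomorphic if $\mathbb K=\mathbb C$). **Theorem.** 1. Around every point of a one-block structure there are local coordinates in which it has the normal form $F$ for a solution $F$ of (S) on a connected open set $D\subset\mathbb K$. 2. Conversely, for every solution $F$ of (S) on an open set $D$, the region $\{u\in\mathbb K^3: u^1\ne0,\ u^2\neq0,\ u^3/u^2\in D\}$ carries a one-block structure with normal form $F$. 3. On a connected open set, $I_1=F_1$, $I_2=2F_1z+F_3+F_4$, $I_3=-2F_3z+F_4z-F_2-F_5$ are constant along every solution of (S). 4. Let $I_1\ne0$. There are $\alpha,\beta\in\mathbb K$ with $\alpha^2=\beta^2$ and $2\alpha\beta=I_1$. For any such $\alpha,\beta$, any $I_2,I_3$, and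 any connected nonempty open $D$, put $z(t)=t/\alpha-I_2/I_1$ and $b=(I_3-1)\beta/\alpha$. For every solution of (S) on $D$ with these values of the first integrals, the function $$y(t)=\frac{F_4(z(t))+I_1z(t)-I_2}{\beta}$$ solves $\mathrm{P_{IV}}(b,c)$ on $\{t:z(t)\in D\}$ for some constant $c$. Conversely every solution of $\mathrm{P_{IV}}(b,c)$ there, for any $c$, is obtained in this way from exactly one solution of (S) on $D$ with these values of the first integrals. In particular, the structures of part 1 with $I_1\neq0$ yield solutions of Painlevé IV equations. 5. The full family occurs: for all $b,c\in\mathbb K$, every solution $y$ of $\mathrm{P_{IV}}(b,c)$ on a connected nonempty open set $\Omega$, and all $I_1\neq0$, $I_2$, $\alpha,\beta$ as in part 4, there are an open set $D$ with $\{t: z(t)\in D\}=\Omega$, a number $I_3$ with $(I_3-1)\beta/\alpha=b$, and a one-block structure as in part 2 whose solution $F$ of (S) on $D$ has first integrals $I_1,I_2,I_3$ and corresponds to $y$. -/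

import Mathlib

open scoped Manifold ContDiff

/-- The model with corners of three-dimensional manifolds without boundary over `𝕜`: smooth
manifolds for `𝕜 = ℝ`, complex manifolds (holomorphic tangent bundle) for `𝕜 = ℂ`. -/
abbrev I3 (𝕜 : Type*) [RCLike 𝕜] : ModelWithCorners 𝕜 (Fin 3 → 𝕜) (Fin 3 → 𝕜) :=
  𝓘(𝕜, Fin 3 → 𝕜)

section Geometry

variable {𝕜 : Type*} [RCLike 𝕜] {M : Type*} [TopologicalSpace M] [ChartedSpace (Fin 3 → 𝕜) M]

variable (𝕜 M) in
/-- A (not necessarily smooth) vector field. -/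
abbrev VField : Type _ := ∀ x : M, TangentSpace (I3 𝕜) x

variable (𝕜 M) in
/-- A (not yet smooth) product on the tangent spaces. -/
abbrev TProduct : Type _ :=
  ∀ x : M, TangentSpace (I3 𝕜) x →ₗ[𝕜] TangentSpace (I3 𝕜) x →ₗ[𝕜] TangentSpace (I3 𝕜) x

variable (𝕜 M) in
/-- The type of connections on the tangent bundle: `cov Y x v` stands for `(∇_v Y)(x)`. -/
abbrev TConnection : Type _ :=
  VField 𝕜 M → ∀ x : M, TangentSpace (I3 𝕜) x →L[𝕜] TangentSpace (I3 𝕜) x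

/-- The vector field `X` is smooth (holomorphic if `𝕜 = ℂ`) on `U`. -/
def SmoothField [IsManifold (I3 𝕜) ∞ M] (X : VField 𝕜 M) (U : Set M) : Prop :=
  ContMDiffOn (I3 𝕜) (I3 𝕜).tangent ∞ (fun x => (⟨x, X x⟩ : TangentBundle (I3 𝕜) M)) U

/-- The vector field `X ∘ Y`. -/
noncomputable def TProduct.app (c : TProduct 𝕜 M) (X Y : VField 𝕜 M) : VField 𝕜 M := fun x => c x (X x) (Y x)

/-- The vector field `∇_X Y`. -/
noncomputable def TConnection.app (cov : TConnection 𝕜 M) (X Y : VField 𝕜 M) : VField 𝕜 M :=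
  fun x => cov Y x (X x)

/-- The Lie bracket of vector fields. -/
noncomputable def lieB (X Y : VField 𝕜 M) : VField 𝕜 M :=
  VectorField.mlieBracket (I3 𝕜) X Y

/-- `P_X(Z, W) = [X, Z ∘ W] - [X, Z] ∘ W - Z ∘ [X, W]`. -/
noncomputable def TProduct.P (c : TProduct 𝕜 M) (X Z W : VField 𝕜 M) : VField 𝕜 M :=
  lieB X (c.app Z W) - c.app (lieB X Z) W - c.app Z (lieB X W)

/-- `(∇_X c)(Y, Z) = ∇_X (Y ∘ Z) - (∇_X Y) ∘ Z - Y ∘ (∇_X Z)`. -/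
noncomputable def TConnection.derivProduct (cov : TConnection 𝕜 M) (c : TProduct 𝕜 M) (X Y Z : VField 𝕜 M) :
    VField 𝕜 M :=
  cov.app X (c.app Y Z) - c.app (cov.app X Y) Z - c.app Y (cov.app X Z)

/-- The curvature `R(X, Y) Z = ∇_X ∇_Y Z - ∇_Y ∇_X Z - ∇_[X,Y] Z`. -/
noncomputable def TConnection.curv (cov : TConnection 𝕜 M) (X Y Z : VField 𝕜 M) : VField 𝕜 M :=
  cov.app X (cov.app Y Z) - cov.app Y (cov.app X Z) - cov.app (lieB X Y) Z

/-- The exterior covariant derivative of the vector-valued one-form `X ∘`, evaluated on `(Y, Z)`: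
`(d_∇ (X ∘))(Y, Z) = ∇_Y (X ∘ Z) - ∇_Z (X ∘ Y) - X ∘ [Y, Z]`. -/
noncomputable def TConnection.extD (cov : TConnection 𝕜 M) (c : TProduct 𝕜 M)
    (X Y Z : VField 𝕜 M) : VField 𝕜 M :=
  cov.app Y (c.app X Z) - cov.app Z (c.app X Y) - c.app X (lieB Y Z)

variable (𝕜 M) in
/-- The data `(∘, *, e, E, ∇₁, ∇₂)` of a three-dimensional bi-flat `F`-manifold. -/
structure BiFlatData where
  mul : TProduct 𝕜 M
  dual : TProduct 𝕜 M
  e : VField 𝕜 M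
  E : VField 𝕜 M
  cov1 : TConnection 𝕜 M
  cov2 : TConnection 𝕜 M

variable [IsManifold (I3 𝕜) ∞ M]

/-- On the open set `s`, `(∘, e)` is an `F`-manifold structure with identity: a smooth commutative
associative product with smooth unit `e` that satisfies the Hertling-Manin condition. Vector
fields are taken on arbitrary open subsets of `s`, as is needed in the holomorphic case. -/
structure IsFManifoldOn (c : TProduct 𝕜 M) (e : VField 𝕜 M) (s : Set M) : Prop where
  smooth_mul : ∀ U ⊆ s, IsOpen U → ∀ X Y : VField 𝕜 M, SmoothField X U → SmoothField Y U →
    SmoothField (c.app X Y) U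
  smooth_unit : SmoothField e s
  comm : ∀ x ∈ s, ∀ v w, c x v w = c x w v
  assoc : ∀ x ∈ s, ∀ v w z, c x (c x v w) z = c x v (c x w z)
  unit : ∀ x ∈ s, ∀ v, c x v (e x) = v
  hertling_manin : ∀ U ⊆ s, IsOpen U → ∀ X Y Z W : VField 𝕜 M, SmoothField X U →
    SmoothField Y U → SmoothField Z U → SmoothField W U → ∀ x ∈ U,
    c.P (c.app X Y) Z W x = c.app X (c.P Y Z W) x + c.app Y (c.P X Z W) x

/-- On the open set `s`, `cov` is a smooth, torsionless and flat affine connection. -/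
structure IsFlatConnectionOn (cov : TConnection 𝕜 M) (s : Set M) : Prop where
  connection : IsCovariantDerivativeOn (I := I3 𝕜) (Fin 3 → 𝕜) cov s
  smooth : ∀ U ⊆ s, IsOpen U → ∀ X Y : VField 𝕜 M, SmoothField X U → SmoothField Y U →
    SmoothField (cov.app X Y) U
  torsionless : ∀ U ⊆ s, IsOpen U → ∀ X Y : VField 𝕜 M, SmoothField X U → SmoothField Y U →
    ∀ x ∈ U, cov.app X Y x - cov.app Y X x = lieB X Y x
  flat : ∀ U ⊆ s, IsOpen U → ∀ X Y Z : VField 𝕜 M, SmoothField X U → SmoothField Y U →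
    SmoothField Z U → ∀ x ∈ U, cov.curv X Y Z x = 0

/-- On the open set `s`, `(∘, ∇, e)` is a flat `F`-manifold with flat identity. -/
structure IsFlatFManifoldOn (c : TProduct 𝕜 M) (cov : TConnection 𝕜 M) (e : VField 𝕜 M)
    (s : Set M) : Prop where
  fmanifold : IsFManifoldOn c e s
  connection : IsFlatConnectionOn cov s
  compatible : ∀ U ⊆ s, IsOpen U → ∀ X Y Z : VField 𝕜 M, SmoothField X U → SmoothField Y U →
    SmoothField Z U → ∀ x ∈ U, cov.derivProduct c X Y Z x = cov.derivProduct c Y X Z x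
  flat_unit : ∀ x ∈ s, ∀ v, cov e x v = 0

/-- On the open set `s`, the data form a bi-flat `F`-manifold: `(∘, ∇₁, e)` and `(*, ∇₂, E)` are
flat `F`-manifolds, where `X * Y = X ∘ Y ∘ E⁻¹` for the invertible Euler vector field `E`
(`[e, E] = e`), and `∇₁`, `∇₂` are almost hydrodynamically equivalent. -/
structure IsBiFlatOn (S : BiFlatData 𝕜 M) (s : Set M) : Prop where
  flat1 : IsFlatFManifoldOn S.mul S.cov1 S.e s
  dual_eq : ∃ Einv : VField 𝕜 M, SmoothField Einv s ∧
    ∀ x ∈ s, S.mul x (S.E x) (Einv x) = S.e x ∧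
      ∀ v w, S.dual x v w = S.mul x (S.mul x v w) (Einv x)
  euler : ∀ x ∈ s, lieB S.e S.E x = S.e x
  flat2 : IsFlatFManifoldOn S.dual S.cov2 S.E s
  hydro_mul : ∀ U ⊆ s, IsOpen U → ∀ X Y Z : VField 𝕜 M, SmoothField X U → SmoothField Y U →
    SmoothField Z U → ∀ x ∈ U, S.cov1.extD S.mul X Y Z x = S.cov2.extD S.mul X Y Z x
  hydro_dual : ∀ U ⊆ s, IsOpen U → ∀ X Y Z : VField 𝕜 M, SmoothField X U → SmoothField Y U →
    SmoothField Z U → ∀ x ∈ U, S.cov1.extD S.dual X Y Z x = S.cov2.extD S.dual X Y Z x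

/-- The endomorphism `L` of a three-dimensional space has three equal eigenvalues and one single
Jordan block. -/
def SingleJordanBlock {V : Type*} [AddCommGroup V] [Module 𝕜 V] (L : V →ₗ[𝕜] V) : Prop :=
  ∃ (a : 𝕜) (b : Module.Basis (Fin 3) 𝕜 V),
    LinearMap.toMatrix b b L = !![a, 1, 0; 0, a, 1; 0, 0, a]

/-- On `s`, the data form a bi-flat `F`-manifold that is regular and whose operator `L = E ∘` has at
every point three equal eigenvalues, hence one single Jordan block. -/
def IsRegularBiFlatOneBlockOn (S : BiFlatData 𝕜 M) (s : Set M) : Prop :=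
  IsBiFlatOn S s ∧ ∀ x ∈ s, SingleJordanBlock (S.mul x (S.E x))

end Geometry

section System

variable {𝕜 : Type*} [RCLike 𝕜]

variable (𝕜) in
/-- The six unknown functions of one variable. -/
structure SixFunctions where
  F1 : 𝕜 → 𝕜
  F2 : 𝕜 → 𝕜
  F3 : 𝕜 → 𝕜
  F4 : 𝕜 → 𝕜
  F5 : 𝕜 → 𝕜
  F6 : 𝕜 → 𝕜

/-- The system of six first order ODEs on `D`. -/
structure SixFunctions.IsSolutionOn (F : SixFunctions 𝕜) (D : Set 𝕜) : Prop where
  eq1 : ∀ z ∈ D, HasDerivAt F.F1 0 z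
  eq2 : ∀ z ∈ D, HasDerivAt F.F2
    (2 * F.F4 z * F.F3 z * z + 2 * F.F2 z * F.F1 z * z - 2 * F.F5 z * F.F1 z * z
      + F.F6 z * F.F1 z - F.F2 z * F.F3 z + F.F4 z - F.F3 z) z
  eq3 : ∀ z ∈ D, HasDerivAt F.F3
    (-F.F4 z * F.F3 z - F.F2 z * F.F1 z + F.F5 z * F.F1 z - F.F1 z) z
  eq4 : ∀ z ∈ D, HasDerivAt F.F4
    (F.F4 z * F.F3 z + F.F2 z * F.F1 z - F.F5 z * F.F1 z - F.F1 z) z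
  eq5 : ∀ z ∈ D, HasDerivAt F.F5
    (F.F4 z * F.F3 z * z + F.F2 z * F.F1 z * z - F.F5 z * F.F1 z * z - F.F6 z * F.F1 z
      + F.F2 z * F.F3 z + F.F1 z * z - F.F3 z) z
  eq6 : ∀ z ∈ D, HasDerivAt F.F6
    (-2 * F.F4 z * F.F3 z * z ^ 2 - 2 * F.F2 z * F.F1 z * z ^ 2 + 2 * F.F5 z * F.F1 z * z ^ 2
      - F.F6 z * F.F1 z * z + F.F2 z * F.F3 z * z + F.F4 z * F.F6 z - F.F4 z * z + F.F2 z ^ 2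
      - F.F2 z * F.F5 z + F.F3 z * z - F.F2 z) z

/-- The three functions `F₁`, `2 F₁ z + F₃ + F₄`, `-2 F₃ z + F₄ z - F₂ - F₅` are constant on `D`,
with values `k₁`, `k₂`, `k₃`. -/
def SixFunctions.HasIntegralsOn (F : SixFunctions 𝕜) (k₁ k₂ k₃ : 𝕜) (D : Set 𝕜) : Prop :=
  ∀ z ∈ D, F.F1 z = k₁ ∧ 2 * F.F1 z * z + F.F3 z + F.F4 z = k₂ ∧
    -2 * F.F3 z * z + F.F4 z * z - F.F2 z - F.F5 z = k₃

/-- The six functions of `F` and `G` agree on `D`. -/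
def SixFunctions.AgreeOn (F G : SixFunctions 𝕜) (D : Set 𝕜) : Prop :=
  Set.EqOn F.F1 G.F1 D ∧ Set.EqOn F.F2 G.F2 D ∧ Set.EqOn F.F3 G.F3 D ∧
    Set.EqOn F.F4 G.F4 D ∧ Set.EqOn F.F5 G.F5 D ∧ Set.EqOn F.F6 G.F6 D

/-- `y` is a smooth (holomorphic if `𝕜 = ℂ`) solution on `D` of the Painlevé IV equation with
parameters `b`, `c`: `y y'' = (3/2) y⁴ + 4 t y³ + 2 (t² - b) y² + (1/2) y'² + c`. -/
def IsPainleveIVSolutionOn (b c : 𝕜) (y : 𝕜 → 𝕜) (D : Set 𝕜) : Prop :=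
  ContDiffOn 𝕜 ∞ y D ∧ ∀ t ∈ D,
    y t * deriv (deriv y) t = 3 / 2 * y t ^ 4 + 4 * t * y t ^ 3 + 2 * (t ^ 2 - b) * y t ^ 2
      + 1 / 2 * deriv y t ^ 2 + c

/-- The rescaled independent variable: `z = t / α - k₂ / k₁`. -/
def rescaledVar (k₁ k₂ α t : 𝕜) : 𝕜 := t / α - k₂ / k₁

/-- The rescaled dependent variable: `β y(t) = F₄(z) + k₁ z - k₂` with `z = t / α - k₂ / k₁`. -/
def SixFunctions.painleveVar (F : SixFunctions 𝕜) (k₁ k₂ α β t : 𝕜) : 𝕜 :=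
  (F.F4 (rescaledVar k₁ k₂ α t) + k₁ * rescaledVar k₁ k₂ α t - k₂) / β

/-- Admissible scaling factors for a value `k₁` of the first integral `F₁`. -/
def IsScaling (k₁ α β : 𝕜) : Prop := α ^ 2 = β ^ 2 ∧ 2 * α * β = k₁

/-- The Christoffel symbols of `∇₁` at the point `u`: `christoffel F u j k i` is the symbol with
lower indices `j`, `k` and upper index `i`. Indices run over `0, 1, 2` in place of `1, 2, 3`. -/
def SixFunctions.christoffel (F : SixFunctions 𝕜) (u : Fin 3 → 𝕜) : Fin 3 → Fin 3 → Fin 3 → 𝕜 :=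
  let z := u 2 / u 1
  ![![![0, 0, 0], ![0, 0, 0], ![0, 0, 0]],
    ![![0, 0, 0],
      ![F.F4 z / u 1, F.F5 z / u 1, F.F6 z / u 1],
      ![F.F1 z / u 1, F.F3 z / u 1, F.F2 z / u 1]],
    ![![0, 0, 0],
      ![F.F1 z / u 1, F.F3 z / u 1, F.F2 z / u 1],
      ![0, F.F1 z / u 1, (F.F3 z - F.F4 z) / u 1]]]

end System

section NormalForm

variable {𝕜 : Type*} [RCLike 𝕜] {M : Type*} [TopologicalSpace M] [ChartedSpace (Fin 3 → 𝕜) M]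

/-- The coordinate vector field `∂_i` of the local coordinates `ψ`: the vector that `dψ` maps to
the `i`-th unit vector. -/
noncomputable def coordField (ψ : OpenPartialHomeomorph M (Fin 3 → 𝕜)) (i : Fin 3) : VField 𝕜 M :=
  fun q => (mfderiv (I3 𝕜) (I3 𝕜) ψ q).inverse (Pi.single i (1 : 𝕜) : Fin 3 → 𝕜)

/-- In the local coordinates `u = ψ`, on the set `t`, the data have the normal form given by the six
functions `F` on `D`: `e = ∂₁`, `E = ∑ uⁱ ∂ᵢ`, `∂ᵢ ∘ ∂ⱼ = ∂_{i+j-1}` (zero if `i + j - 1 > 3`),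
`∇₁` has the Christoffel symbols `F.christoffel`, and `∇₂` is determined by `∇₁` through
`∇₂_X Y = ∇₁_X Y - ∇₁_{X * Y} E`; here `E` is invertible (`u¹ ≠ 0`), `u² ≠ 0` and `u³/u² ∈ D`. -/
structure HasNormalFormOn (S : BiFlatData 𝕜 M) (ψ : OpenPartialHomeomorph M (Fin 3 → 𝕜))
    (t : Set M) (F : SixFunctions 𝕜) (D : Set 𝕜) : Prop where
  ne : ∀ q ∈ t, ψ q 0 ≠ 0 ∧ ψ q 1 ≠ 0
  mem : ∀ q ∈ t, ψ q 2 / ψ q 1 ∈ D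
  unit : ∀ q ∈ t, S.e q = coordField ψ 0 q
  euler : ∀ q ∈ t, S.E q = ∑ i, ψ q i • coordField ψ i q
  mul : ∀ q ∈ t, ∀ i j : Fin 3, S.mul q (coordField ψ i q) (coordField ψ j q) =
    if h : i.val + j.val < 3 then coordField ψ ⟨i.val + j.val, h⟩ q else 0
  cov1 : ∀ q ∈ t, ∀ j k : Fin 3, S.cov1 (coordField ψ k) q (coordField ψ j q) =
    ∑ i, F.christoffel (ψ q) j k i • coordField ψ i q
  cov2 : ∀ q ∈ t, ∀ j k : Fin 3, S.cov2 (coordField ψ k) q (coordField ψ j q) =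
    S.cov1 (coordField ψ k) q (coordField ψ j q)
      - S.cov1 S.E q (S.dual q (coordField ψ j q) (coordField ψ k q))

end NormalForm

/-- The open region of `𝕜³` on which solutions of the system on `D` define a structure. -/
def modelRegion {𝕜 : Type*} [RCLike 𝕜] (D : Set 𝕜) : Set (Fin 3 → 𝕜) :=
  {u | u 0 ≠ 0 ∧ u 1 ≠ 0 ∧ u 2 / u 1 ∈ D}

/-! ### The system of six equations and Painlevé IV. -/

section PainleveReduction

variable {𝕜 : Type*} [RCLike 𝕜]

/-! The theorem has three independent parts. Indices 0, 1, 2 stand for 1, 2, 3 throughout.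

System and Painlevé IV. Fix the integrals with `k₁ ≠ 0` and put f = F₄ + k₁ z - k₂. Along a solution
f' and f'' are polynomials in the unknowns and z, and f''' is a polynomial in z, f, f' alone
(`hasDerivAt_shifted₂`). This third order equation is the z-derivative of a rescaled Painlevé IV
equation divided by f, so the constant c of Painlevé IV appears as a constant of integration.
Conversely the integrals together with f, f', f'' determine all six functions, and the third order
equation is what remains of the system (`isSolutionOn_ofShifted`, `agreeOn`). On the Painlevé side
the division by y is legitimate even at zeros of y (`IsPainleveIVSolutionOn.hasDerivAt`).

From the system to geometry. On 𝕜³ with the product of 𝕜[ε]/ε³, the system makes ∇₁ flat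
(`curvature`) and makes the operator ∇₁E parallel for ∇₁ (`nablaEuler_parallel`). Since ∇₂ differs
from ∇₁ by the tensor ∇₁E applied to X * Y, one pointwise identity, `nablaEuler_dual`, then gives
both the flatness of ∇₂ and the symmetry of ∇₂ applied to the dual product.

From geometry to the system. All structures are carried to 𝕜³ by a chart
(`IsRegularBiFlatOneBlockOn.push`). The Hertling-Manin condition for the two products gives the Lie
derivatives of ∘ along e and E. Applied to the Cayley-Hamilton relation of E, they give the
derivatives of the eigenvalue a and the brackets of the frame e, N = E - a e, N ∘ N
(`isNilpotentFrameOn`). Integrating this frame yields coordinates in which e, E and ∘ are standard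
(`exists_jordanCoordinates`). There the flat unit and the symmetry of ∇₁c leave six Christoffel
symbols; flatness of ∇₁, flatness of ∇₂, ∇₂E = 0 and the equality of the exterior derivatives make
them independent of u 0 and homogeneous of degree -1, hence of the form F(u 2 / u 1) / u 1. The
curvature of ∇₁ in the two remaining directions is then exactly the system (`system_of_curvature`),
and ∇₂ is forced (`christoffelMap₂_one`). -/

theorem ContDiffOn.succ_of_hasDerivAt {D : Set 𝕜} (hD : IsOpen D) {f f' : 𝕜 → 𝕜} {n : ℕ}
    (h : ∀ z ∈ D, HasDerivAt f (f' z) z) (hf' : ContDiffOn 𝕜 n f' D) :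
    ContDiffOn 𝕜 (n + 1 : ℕ) f D := by
  push_cast
  rw [contDiffOn_succ_iff_deriv_of_isOpen hD]
  refine ⟨fun z hz => (h z hz).differentiableAt.differentiableWithinAt, by simp, ?_⟩
  exact hf'.congr fun z hz => (h z hz).deriv

namespace SixFunctions

/-- All six functions are `n` times continuously differentiable on `D`. -/
def ContDiffOn (F : SixFunctions 𝕜) (n : ℕ∞ω) (D : Set 𝕜) : Prop :=
  _root_.ContDiffOn 𝕜 n F.F1 D ∧ _root_.ContDiffOn 𝕜 n F.F2 D ∧ _root_.ContDiffOn 𝕜 n F.F3 D ∧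
    _root_.ContDiffOn 𝕜 n F.F4 D ∧ _root_.ContDiffOn 𝕜 n F.F5 D ∧ _root_.ContDiffOn 𝕜 n F.F6 D

/-- Bootstrapping: the right-hand sides are polynomials in z and the six functions, so they are as
smooth as the functions, and the functions gain one derivative at each round. -/
theorem IsSolutionOn.contDiffOn {F : SixFunctions 𝕜} {D : Set 𝕜} (hD : IsOpen D)
    (h : F.IsSolutionOn D) : F.ContDiffOn ∞ D := by
  have key : ∀ n : ℕ, F.ContDiffOn n D := by
    intro n
    induction n with
    | zero =>
      simp only [ContDiffOn, Nat.cast_zero, contDiffOn_zero]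
      exact ⟨fun z hz => (h.eq1 z hz).continuousAt.continuousWithinAt,
        fun z hz => (h.eq2 z hz).continuousAt.continuousWithinAt,
        fun z hz => (h.eq3 z hz).continuousAt.continuousWithinAt,
        fun z hz => (h.eq4 z hz).continuousAt.continuousWithinAt,
        fun z hz => (h.eq5 z hz).continuousAt.continuousWithinAt,
        fun z hz => (h.eq6 z hz).continuousAt.continuousWithinAt⟩
    | succ n ih =>
      obtain ⟨h1, h2, h3, h4, h5, h6⟩ := ih
      have hz : _root_.ContDiffOn 𝕜 n (fun z : 𝕜 => z) D := contDiffOn_id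
      refine ⟨.succ_of_hasDerivAt hD h.eq1 contDiffOn_const, .succ_of_hasDerivAt hD h.eq2 ?_,
        .succ_of_hasDerivAt hD h.eq3 ?_, .succ_of_hasDerivAt hD h.eq4 ?_,
        .succ_of_hasDerivAt hD h.eq5 ?_, .succ_of_hasDerivAt hD h.eq6 ?_⟩ <;> fun_prop
  simp only [ContDiffOn] at key ⊢
  simp only [contDiffOn_infty, ← forall_and]
  exact key

theorem IsSolutionOn.exists_hasIntegralsOn {F : SixFunctions 𝕜} {D : Set 𝕜} (hD : IsOpen D)
    (hc : IsConnected D) (h : F.IsSolutionOn D) : ∃ k₁ k₂ k₃ : 𝕜, F.HasIntegralsOn k₁ k₂ k₃ D := by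
  have const : ∀ g : 𝕜 → 𝕜, (∀ z ∈ D, HasDerivAt g 0 z) → ∃ k, ∀ z ∈ D, g z = k := fun g hg =>
    hD.exists_is_const_of_deriv_eq_zero hc.isPreconnected
      (fun z hz => (hg z hz).differentiableAt.differentiableWithinAt) fun z hz => (hg z hz).deriv
  obtain ⟨k₁, hk₁⟩ := const F.F1 h.eq1
  obtain ⟨k₂, hk₂⟩ := const (fun z => 2 * F.F1 z * z + F.F3 z + F.F4 z) fun z hz => by
    refine HasDerivAt.congr_deriv (((((h.eq1 z hz).const_mul 2).mul (hasDerivAt_id z)).add (h.eq3 z hz)).add (h.eq4 z hz)) ?_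
    simp; ring
  obtain ⟨k₃, hk₃⟩ := const (fun z => -2 * F.F3 z * z + F.F4 z * z - F.F2 z - F.F5 z)
    fun z hz => by
      refine HasDerivAt.congr_deriv ((((((h.eq3 z hz).const_mul (-2)).mul (hasDerivAt_id z)).add
        ((h.eq4 z hz).mul (hasDerivAt_id z))).sub (h.eq2 z hz)).sub (h.eq5 z hz)) ?_
      simp; ring
  exact ⟨k₁, k₂, k₃, fun z hz => ⟨hk₁ z hz, hk₂ z hz, hk₃ z hz⟩⟩

/-- The function `F₄ + k₁ z - k₂`, a multiple of the Painlevé IV function. -/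
def shifted (F : SixFunctions 𝕜) (k₁ k₂ z : 𝕜) : 𝕜 := F.F4 z + k₁ * z - k₂

/-- The derivative of `F.shifted` along a solution. -/
def shifted₁ (F : SixFunctions 𝕜) (k₁ z : 𝕜) : 𝕜 := F.F4 z * F.F3 z + (F.F2 z - F.F5 z) * k₁

/-- The second derivative of `F.shifted` along a solution. -/
def shifted₂ (F : SixFunctions 𝕜) (k₁ z : 𝕜) : 𝕜 :=
  (F.F4 z * F.F3 z + F.F2 z * k₁ - F.F5 z * k₁ - k₁) * F.F3 z
    + F.F4 z * (-F.F4 z * F.F3 z - F.F2 z * k₁ + F.F5 z * k₁ - k₁)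
    + (z * (F.F4 z * F.F3 z + F.F2 z * k₁ - F.F5 z * k₁ - k₁)
      + 2 * F.F6 z * k₁ - 2 * F.F2 z * F.F3 z + F.F4 z) * k₁

theorem IsSolutionOn.hasDerivAt_shifted {F : SixFunctions 𝕜} {D : Set 𝕜} {k₁ k₂ k₃ : 𝕜}
    (h : F.IsSolutionOn D) (hk : F.HasIntegralsOn k₁ k₂ k₃ D) {z : 𝕜} (hz : z ∈ D) :
    HasDerivAt (F.shifted k₁ k₂) (F.shifted₁ k₁ z) z := by
  obtain ⟨h1, h2, h3⟩ := hk z hz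
  refine HasDerivAt.congr_deriv (((h.eq4 z hz).add ((hasDerivAt_id z).const_mul k₁)).sub_const k₂) ?_
  rw [shifted₁, h1]; ring

theorem IsSolutionOn.hasDerivAt_shifted₁ {F : SixFunctions 𝕜} {D : Set 𝕜} {k₁ k₂ k₃ : 𝕜}
    (h : F.IsSolutionOn D) (hk : F.HasIntegralsOn k₁ k₂ k₃ D) {z : 𝕜} (hz : z ∈ D) :
    HasDerivAt (F.shifted₁ k₁) (F.shifted₂ k₁ z) z := by
  obtain ⟨h1, h2, h3⟩ := hk z hz
  refine HasDerivAt.congr_deriv (((h.eq4 z hz).mul (h.eq3 z hz)).add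
    (((h.eq2 z hz).sub (h.eq5 z hz)).mul_const k₁)) ?_
  rw [shifted₂, h1]; ring

/-- `f'' = g` and `f' = p` satisfy the rescaled Painlevé IV equation, solved for the constant. -/
def rescaledConstant (k₁ k₂ k₃ z f p g : 𝕜) : 𝕜 :=
  f * g - 3 / 2 * f ^ 4 - 2 * (k₁ * z + k₂) * f ^ 3
    - ((k₁ * z + k₂) ^ 2 / 2 - (k₃ - 1) * k₁) * f ^ 2 - 1 / 2 * p ^ 2

/-- The system closes up on f alone at third order. The derivative found here is that of the
Painlevé polynomial after division by f; being polynomial, it makes sense at the zeros of f too. -/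
theorem IsSolutionOn.hasDerivAt_shifted₂ {F : SixFunctions 𝕜} {D : Set 𝕜} {k₁ k₂ k₃ : 𝕜}
    (h : F.IsSolutionOn D) (hk : F.HasIntegralsOn k₁ k₂ k₃ D) {z : 𝕜} (hz : z ∈ D) :
    HasDerivAt (F.shifted₂ k₁)
      (6 * F.shifted k₁ k₂ z ^ 2 * F.shifted₁ k₁ z + 2 * k₁ * F.shifted k₁ k₂ z ^ 2
        + 6 * (k₁ * z + k₂) * F.shifted k₁ k₂ z * F.shifted₁ k₁ z
        + ((k₁ * z + k₂) ^ 2 - 2 * (k₃ - 1) * k₁) * F.shifted₁ k₁ z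
        + k₁ * (k₁ * z + k₂) * F.shifted k₁ k₂ z) z := by
  obtain ⟨h1, h2, h3⟩ := hk z hz
  have e2 := h.eq2 z hz
  have e3 := h.eq3 z hz
  have e4 := h.eq4 z hz
  have e5 := h.eq5 z hz
  have e6 := h.eq6 z hz
  have ez := hasDerivAt_id z
  have d4 := (((e4.mul e3).add (e2.mul_const k₁)).sub (e5.mul_const k₁)).sub_const k₁
  have d3 := (((e4.neg.mul e3).sub (e2.mul_const k₁)).add (e5.mul_const k₁)).sub_const k₁
  refine HasDerivAt.congr_deriv (((d4.mul e3).add (e4.mul d3)).add (((((ez.mul d4).add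
    ((e6.const_mul 2).mul_const k₁)).sub ((e2.const_mul 2).mul e3)).add e4).mul_const k₁)) ?_
  simp only [Pi.mul_apply, Pi.add_apply, Pi.sub_apply, Pi.neg_apply, id, shifted, shifted₁]
  rw [h1] at h2 ⊢
  -- Eliminating k₂ and k₃ leaves a polynomial identity in z and the values of the six functions.
  subst h2 h3
  ring

/-- The derivative of the expression is f times the difference of the two sides of the third order
equation: f is an integrating factor, and the integration constant becomes the parameter c. -/
theorem IsSolutionOn.exists_rescaledConstant {F : SixFunctions 𝕜} {D : Set 𝕜} {k₁ k₂ k₃ : 𝕜}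
    (hD : IsOpen D) (hc : IsConnected D)
    (h : F.IsSolutionOn D) (hk : F.HasIntegralsOn k₁ k₂ k₃ D) : ∃ c, ∀ z ∈ D,
      rescaledConstant k₁ k₂ k₃ z (F.shifted k₁ k₂ z) (F.shifted₁ k₁ z) (F.shifted₂ k₁ z) = c := by
  have key : ∀ z ∈ D, HasDerivAt (fun z => rescaledConstant k₁ k₂ k₃ z (F.shifted k₁ k₂ z)
      (F.shifted₁ k₁ z) (F.shifted₂ k₁ z)) 0 z := fun z hz => by
    have f0 := h.hasDerivAt_shifted hk hz
    have f1 := h.hasDerivAt_shifted₁ hk hz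
    have f2 := h.hasDerivAt_shifted₂ hk hz
    have hw := ((hasDerivAt_id z).const_mul k₁).add_const k₂
    refine HasDerivAt.congr_deriv (((((f0.mul f2).sub ((f0.pow 4).const_mul (3 / 2))).sub
      ((hw.const_mul 2).mul (f0.pow 3))).sub
      ((((hw.pow 2).div_const 2).sub_const ((k₃ - 1) * k₁)).mul (f0.pow 2))).sub
      ((f1.pow 2).const_mul (1 / 2))) ?_
    simp
    ring
  exact hD.exists_is_const_of_deriv_eq_zero hc.isPreconnected
    (fun z hz => (key z hz).differentiableAt.differentiableWithinAt) fun z hz => (key z hz).deriv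

end SixFunctions

theorem hasDerivAt_rescaledVar (k₁ k₂ α t : 𝕜) : HasDerivAt (rescaledVar k₁ k₂ α) (1 / α) t :=
  ((hasDerivAt_id t).div_const α).sub_const (k₂ / k₁)

theorem IsScaling.ne_zero {k₁ α β : 𝕜} (hk : k₁ ≠ 0) (h : IsScaling k₁ α β) : α ≠ 0 ∧ β ≠ 0 := by
  constructor <;> rintro rfl <;> apply hk <;> rw [← h.2] <;> simp

/-- With f = β y and dt/dz = α one has k₁ z + k₂ = 2 β t. The terms containing derivatives carry the
factor (αβ)², the pure powers of y and t the factor β⁴; the condition α² = β² makes the two factors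
agree. -/
theorem IsScaling.rescaledConstant {k₁ α β : 𝕜} (hk : k₁ ≠ 0) (h : IsScaling k₁ α β)
    (k₂ k₃ t y p g c : 𝕜) :
    SixFunctions.rescaledConstant k₁ k₂ k₃ (rescaledVar k₁ k₂ α t) (β * y) (α * β * p)
        (α ^ 2 * β * g) = c * (α * β) ^ 2 ↔
      y * g = 3 / 2 * y ^ 4 + 4 * t * y ^ 3 + 2 * (t ^ 2 - (k₃ - 1) * β / α) * y ^ 2
        + 1 / 2 * p ^ 2 + c := by
  obtain ⟨hα, hβ⟩ := h.ne_zero hk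
  have hw : k₁ * rescaledVar k₁ k₂ α t + k₂ = 2 * β * t := by
    rw [rescaledVar, mul_sub, mul_div_cancel₀ _ hk, ← h.2]; field_simp; ring
  have h4 : β ^ 4 = (α * β) ^ 2 := by linear_combination (-β ^ 2) * h.1
  have hb : (k₃ - 1) * k₁ * β ^ 2 = 2 * (α * β) ^ 2 * ((k₃ - 1) * β / α) := by
    rw [← h.2]; field_simp
  have hz : (α * β) ^ 2 ≠ 0 := pow_ne_zero _ (mul_ne_zero hα hβ)
  have key : SixFunctions.rescaledConstant k₁ k₂ k₃ (rescaledVar k₁ k₂ α t) (β * y) (α * β * p)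
      (α ^ 2 * β * g) = (α * β) ^ 2 * (y * g - (3 / 2 * y ^ 4 + 4 * t * y ^ 3
        + 2 * (t ^ 2 - (k₃ - 1) * β / α) * y ^ 2 + 1 / 2 * p ^ 2)) := by
    rw [SixFunctions.rescaledConstant, hw]
    linear_combination (-3 / 2 * y ^ 4 - 4 * t * y ^ 3 - 2 * t ^ 2 * y ^ 2) * h4 + y ^ 2 * hb
  rw [key, mul_comm c, mul_right_inj' hz, sub_eq_iff_eq_add, add_comm c]

namespace SixFunctions

theorem painleveVar_eq (F : SixFunctions 𝕜) (k₁ k₂ α β t : 𝕜) :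
    F.painleveVar k₁ k₂ α β t = F.shifted k₁ k₂ (rescaledVar k₁ k₂ α t) / β := rfl

theorem IsSolutionOn.isPainleveIVSolutionOn {F : SixFunctions 𝕜} {D : Set 𝕜} {k₁ k₂ k₃ α β : 𝕜}
    (hD : IsOpen D) (hc : IsConnected D) (h : F.IsSolutionOn D)
    (hk : F.HasIntegralsOn k₁ k₂ k₃ D) (hk₁ : k₁ ≠ 0) (hs : IsScaling k₁ α β) :
    ∃ c : 𝕜, IsPainleveIVSolutionOn ((k₃ - 1) * β / α) c (F.painleveVar k₁ k₂ α β)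
      (rescaledVar k₁ k₂ α ⁻¹' D) := by
  obtain ⟨hα, hβ⟩ := hs.ne_zero hk₁
  obtain ⟨c, hc⟩ := h.exists_rescaledConstant hD hc hk
  have hcont : Continuous (rescaledVar k₁ k₂ α) :=
    continuous_iff_continuousAt.2 fun t => (hasDerivAt_rescaledVar k₁ k₂ α t).continuousAt
  have hΩ := hD.preimage hcont
  have d1 : ∀ t ∈ rescaledVar k₁ k₂ α ⁻¹' D, HasDerivAt (F.painleveVar k₁ k₂ α β)
      (F.shifted₁ k₁ (rescaledVar k₁ k₂ α t) * (1 / α) / β) t := fun t ht =>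
    ((h.hasDerivAt_shifted hk ht).comp t (hasDerivAt_rescaledVar k₁ k₂ α t)).div_const β
  have d2 : ∀ t ∈ rescaledVar k₁ k₂ α ⁻¹' D, HasDerivAt (deriv (F.painleveVar k₁ k₂ α β))
      (F.shifted₂ k₁ (rescaledVar k₁ k₂ α t) * (1 / α) * (1 / α) / β) t := fun t ht => by
    refine ((((h.hasDerivAt_shifted₁ hk ht).comp t
      (hasDerivAt_rescaledVar k₁ k₂ α t)).mul_const (1 / α)).div_const β).congr_of_eventuallyEq ?_
    filter_upwards [hΩ.mem_nhds ht] with s hs using (d1 s hs).deriv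
  -- The constant in the variable z is (αβ)² times the one in the variable t.
  refine ⟨c / (α * β) ^ 2, ?_, fun t ht => ?_⟩
  · have := (h.contDiffOn hD).2.2.2.1
    have hsm : _root_.ContDiff 𝕜 ∞ (rescaledVar k₁ k₂ α) := by
      unfold rescaledVar; fun_prop
    have h4 := this.comp hsm.contDiffOn (Set.mapsTo_preimage _ D)
    unfold painleveVar
    exact ((h4.add (contDiff_const.mul hsm).contDiffOn).sub contDiffOn_const).div_const β
  · rw [← hs.rescaledConstant hk₁ k₂, (d1 t ht).deriv, (d2 t ht).deriv, painleveVar_eq]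
    rw [div_mul_cancel₀ c (pow_ne_zero _ (mul_ne_zero hα hβ)), ← hc _ ht]
    congr 1 <;> field_simp

/-- F₄ determines f, hence f' and f'' on the open set. The integrals give F₁, F₃ and F₂ + F₅, the
first derivative gives F₂ - F₅ after division by k₁, and the second gives F₆. -/
theorem IsSolutionOn.agreeOn {F G : SixFunctions 𝕜} {D : Set 𝕜} {k₁ k₂ k₃ : 𝕜}
    (hD : IsOpen D) (hF : F.IsSolutionOn D) (hG : G.IsSolutionOn D)
    (hFk : F.HasIntegralsOn k₁ k₂ k₃ D) (hGk : G.HasIntegralsOn k₁ k₂ k₃ D) (hk₁ : k₁ ≠ 0)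
    (h4 : Set.EqOn G.F4 F.F4 D) : G.AgreeOn F D := by
  have h0 : Set.EqOn (G.shifted k₁ k₂) (F.shifted k₁ k₂) D := fun z hz => by
    simp only [shifted, h4 hz]
  have transfer : ∀ {f g f' g' : 𝕜 → 𝕜}, (∀ z ∈ D, HasDerivAt f (f' z) z) →
      (∀ z ∈ D, HasDerivAt g (g' z) z) → Set.EqOn g f D → Set.EqOn g' f' D := by
    intro f g f' g' hf hg hfg z hz
    refine (hg z hz).unique ((hf z hz).congr_of_eventuallyEq ?_)
    filter_upwards [hD.mem_nhds hz] with s hs using hfg hs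
  have h1 := transfer (fun z hz => hF.hasDerivAt_shifted hFk hz)
    (fun z hz => hG.hasDerivAt_shifted hGk hz) h0
  have h2 := transfer (fun z hz => hF.hasDerivAt_shifted₁ hFk hz)
    (fun z hz => hG.hasDerivAt_shifted₁ hGk hz) h1
  have key : ∀ z ∈ D, G.F1 z = F.F1 z ∧ G.F2 z = F.F2 z ∧ G.F3 z = F.F3 z ∧ G.F5 z = F.F5 z ∧
      G.F6 z = F.F6 z := by
    intro z hz
    obtain ⟨f1, f2, f3⟩ := hFk z hz
    obtain ⟨g1, g2, g3⟩ := hGk z hz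
    have e4 := h4 hz
    have e1 : G.F1 z = F.F1 z := g1.trans f1.symm
    have e3 : G.F3 z = F.F3 z := by linear_combination g2 - f2 - 2 * z * e1 - e4
    have e1' := h1 hz
    have e2' := h2 hz
    simp only [shifted₁, shifted₂, e3, e4] at e1' e2'
    have d : G.F2 z - G.F5 z = F.F2 z - F.F5 z := mul_right_cancel₀ hk₁ (add_left_cancel e1')
    have s : G.F2 z + G.F5 z = F.F2 z + F.F5 z := by
      linear_combination f3 - g3 - 2 * z * e3 + z * e4
    have h22 : (2 : 𝕜) ≠ 0 := two_ne_zero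
    have e2 : G.F2 z = F.F2 z := mul_left_cancel₀ h22 (by linear_combination d + s)
    have e5 : G.F5 z = F.F5 z := by linear_combination e2 - d
    rw [e2, e5] at e2'
    -- F₆ enters the second derivative of f with the coefficient 2 k₁².
    refine ⟨e1, e2, e3, e5, mul_left_cancel₀ (mul_ne_zero h22 (pow_ne_zero 2 hk₁)) ?_⟩
    linear_combination e2'
  exact ⟨fun z hz => (key z hz).1, fun z hz => (key z hz).2.1, fun z hz => (key z hz).2.2.1, h4,
    fun z hz => (key z hz).2.2.2.1, fun z hz => (key z hz).2.2.2.2⟩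

/-- The solution of the system that corresponds to a function `f` with first two derivatives
`p` and `g`. -/
noncomputable def ofShifted (k₁ k₂ k₃ : 𝕜) (f p g : 𝕜 → 𝕜) : SixFunctions 𝕜 :=
  let F3 : 𝕜 → 𝕜 := fun z => -f z - k₁ * z
  let F4 : 𝕜 → 𝕜 := fun z => f z - k₁ * z + k₂
  -- Here d is F₂ - F₅, read off from f', and s is F₂ + F₅, read off from the third integral; dd is
  -- the derivative of d, and F₆ is what the equations for F₂' - F₅' then require.
  let d : 𝕜 → 𝕜 := fun z => (p z - F4 z * F3 z) / k₁
  let s : 𝕜 → 𝕜 := fun z => F4 z * z - 2 * F3 z * z - k₃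
  let F2 : 𝕜 → 𝕜 := fun z => (s z + d z) / 2
  let dd : 𝕜 → 𝕜 := fun z =>
    (g z - (p z - k₁) * F3 z - F4 z * (-p z - k₁)) / k₁
  { F1 := fun _ => k₁
    F2 := F2
    F3 := F3
    F4 := F4
    F5 := fun z => (s z - d z) / 2
    F6 := fun z => (dd z - z * (p z - k₁) - F4 z + 2 * F2 z * F3 z) / (2 * k₁) }

theorem hasIntegralsOn_ofShifted (k₁ k₂ k₃ : 𝕜) (f p g : 𝕜 → 𝕜) (D : Set 𝕜) :
    (ofShifted k₁ k₂ k₃ f p g).HasIntegralsOn k₁ k₂ k₃ D := fun z _ => by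
  refine ⟨rfl, ?_, ?_⟩ <;> simp only [ofShifted] <;> ring

/-- The first five equations hold by the choice of the functions and only involve f, f', f''. The
sixth differentiates f'' and is where the third order equation enters. -/
theorem isSolutionOn_ofShifted {k₁ k₂ k₃ : 𝕜} {f p g : 𝕜 → 𝕜} {D : Set 𝕜} (hk₁ : k₁ ≠ 0)
    (hf : ∀ z ∈ D, HasDerivAt f (p z) z) (hp : ∀ z ∈ D, HasDerivAt p (g z) z)
    (hg : ∀ z ∈ D, HasDerivAt g (6 * f z ^ 2 * p z + 2 * k₁ * f z ^ 2
        + 6 * (k₁ * z + k₂) * f z * p z + ((k₁ * z + k₂) ^ 2 - 2 * (k₃ - 1) * k₁) * p z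
        + k₁ * (k₁ * z + k₂) * f z) z) :
    (ofShifted k₁ k₂ k₃ f p g).IsSolutionOn D := by
  have d3 : ∀ z ∈ D, HasDerivAt (fun z => -f z - k₁ * z) (-p z - k₁ * 1) z := fun z hz =>
    (hf z hz).neg.sub ((hasDerivAt_id z).const_mul k₁)
  have d4 : ∀ z ∈ D, HasDerivAt (fun z => f z - k₁ * z + k₂) (p z - k₁ * 1) z := fun z hz =>
    ((hf z hz).sub ((hasDerivAt_id z).const_mul k₁)).add_const k₂
  have dd : ∀ z ∈ D, HasDerivAt (fun z => (p z - (f z - k₁ * z + k₂) * (-f z - k₁ * z)) / k₁) _ z :=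
    fun z hz => ((hp z hz).sub ((d4 z hz).mul (d3 z hz))).div_const k₁
  have ds : ∀ z ∈ D, HasDerivAt
      (fun z => (f z - k₁ * z + k₂) * z - 2 * (-f z - k₁ * z) * z - k₃) _ z := fun z hz =>
    (((d4 z hz).mul (hasDerivAt_id' z)).sub
      (((d3 z hz).const_mul 2).mul (hasDerivAt_id' z))).sub_const k₃
  have d2 := fun z hz => ((ds z hz).add (dd z hz)).div_const 2
  have d5 := fun z hz => ((ds z hz).sub (dd z hz)).div_const 2
  have dpk : ∀ z ∈ D, HasDerivAt (fun z => p z - k₁) (g z) z := fun z hz => (hp z hz).sub_const k₁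
  have dnpk : ∀ z ∈ D, HasDerivAt (fun z => -p z - k₁) (-g z) z := fun z hz =>
    (hp z hz).neg.sub_const k₁
  have d6 := fun z hz => ((((((hg z hz).sub ((dpk z hz).mul (d3 z hz))).sub
    ((d4 z hz).mul (dnpk z hz))).div_const k₁).sub
      ((hasDerivAt_id' z).mul (dpk z hz))).sub (d4 z hz)).add
        (((d2 z hz).const_mul 2).mul (d3 z hz)) |>.div_const (2 * k₁)
  constructor
  · exact fun z _ => hasDerivAt_const z k₁
  · intro z hz
    refine HasDerivAt.congr_deriv (d2 z hz) ?_
    simp [ofShifted]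
    field_simp
    ring
  · intro z hz
    refine HasDerivAt.congr_deriv (d3 z hz) ?_
    simp [ofShifted]
    field_simp
    ring
  · intro z hz
    refine HasDerivAt.congr_deriv (d4 z hz) ?_
    simp [ofShifted]
    field_simp
    ring
  · intro z hz
    refine HasDerivAt.congr_deriv (d5 z hz) ?_
    simp [ofShifted]
    field_simp
    ring
  · intro z hz
    refine HasDerivAt.congr_deriv (d6 z hz) ?_
    simp [ofShifted]
    field_simp
    ring

end SixFunctions

/-- The derivative of the Painlevé IV equation, divided by `y`; this remains valid at the zeros
of `y`. -/
theorem IsPainleveIVSolutionOn.hasDerivAt {b c : 𝕜} {y : 𝕜 → 𝕜} {Ω : Set 𝕜} (hΩ : IsOpen Ω)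
    (h : IsPainleveIVSolutionOn b c y Ω) :
    (∀ t ∈ Ω, HasDerivAt y (deriv y t) t) ∧
    (∀ t ∈ Ω, HasDerivAt (deriv y) (deriv (deriv y) t) t) ∧
    ∀ t ∈ Ω, HasDerivAt (deriv (deriv y)) (6 * y t ^ 2 * deriv y t + 4 * y t ^ 2
      + 12 * t * y t * deriv y t + 4 * (t ^ 2 - b) * deriv y t + 4 * t * y t) t := by
  have c0 := h.1
  have c1 : ContDiffOn 𝕜 ∞ (deriv y) Ω := ((contDiffOn_infty_iff_deriv_of_isOpen hΩ).1 c0).2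
  have c2 : ContDiffOn 𝕜 ∞ (deriv (deriv y)) Ω :=
    ((contDiffOn_infty_iff_deriv_of_isOpen hΩ).1 c1).2
  have c3 : ContDiffOn 𝕜 ∞ (deriv (deriv (deriv y))) Ω :=
    ((contDiffOn_infty_iff_deriv_of_isOpen hΩ).1 c2).2
  have hd : ∀ {g : 𝕜 → 𝕜}, ContDiffOn 𝕜 ∞ g Ω → ∀ t ∈ Ω, HasDerivAt g (deriv g t) t :=
    fun hg t ht =>
      ((hg.differentiableOn (by simp)).differentiableAt (hΩ.mem_nhds ht)).hasDerivAt
  refine ⟨hd c0, hd c1, fun t ht => ?_⟩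
  set r : 𝕜 → 𝕜 := fun t => deriv (deriv (deriv y)) t - (6 * y t ^ 2 * deriv y t + 4 * y t ^ 2
      + 12 * t * y t * deriv y t + 4 * (t ^ 2 - b) * deriv y t + 4 * t * y t) with hr
  suffices hz : r t = 0 by
    rw [← sub_eq_zero.1 hz]
    exact hd c2 t ht
  -- Differentiating the equation, the terms y' y'' cancel and everything left is divisible by y.
  have hmul : ∀ s ∈ Ω, y s * r s = 0 := by
    intro s hs
    have l := (hd c0 s hs).mul (hd c2 s hs)
    have e := hd c0 s hs
    have e1 := hd c1 s hs
    have i := hasDerivAt_id' s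
    have q := ((((e.pow 4).const_mul (3 / 2)).add ((i.const_mul 4).mul (e.pow 3))).add
      ((((i.pow 2).sub_const b).const_mul 2).mul (e.pow 2))).add
      ((e1.pow 2).const_mul (1 / 2)) |>.add_const c
    have := l.unique (q.congr_of_eventuallyEq (by
      filter_upwards [hΩ.mem_nhds hs] with x hx
      simpa using h.2 x hx))
    simp at this
    rw [hr]
    linear_combination this
  have hrc : ContinuousOn r Ω := by
    have := c0.continuousOn
    have := c1.continuousOn
    have := c3.continuousOn
    fun_prop
  -- If r were nonzero at t, it would be nonzero nearby, so y would vanish identically near t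
  -- together with its derivatives; but then r vanishes at t.
  by_contra hne
  have hev : ∀ᶠ s in nhds t, s ∈ Ω ∧ r s ≠ 0 :=
    (hΩ.eventually_mem ht).and ((hrc.continuousAt (hΩ.mem_nhds ht)).eventually_ne hne)
  have hy : y =ᶠ[nhds t] 0 := by
    filter_upwards [hev] with s hs
    exact (mul_eq_zero.1 (hmul s hs.1)).resolve_right hs.2
  have hy1 : deriv y =ᶠ[nhds t] 0 := by simpa using hy.deriv
  have hy2 : deriv (deriv y) =ᶠ[nhds t] 0 := by simpa using hy1.deriv
  have hy3 : deriv (deriv (deriv y)) =ᶠ[nhds t] 0 := by simpa using hy2.deriv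
  apply hne
  simp [hr, hy.self_of_nhds, hy1.self_of_nhds, hy3.self_of_nhds]

/-- The differentiated equation for y, rescaled, is the third order equation for f = β y, so
`ofShifted` produces the solution. The parameter c has been differentiated away, which is why every
c occurs. -/
theorem IsPainleveIVSolutionOn.exists_isSolutionOn {c : 𝕜} {y : 𝕜 → 𝕜} {D : Set 𝕜}
    {k₁ k₂ k₃ α β : 𝕜} (hD : IsOpen D) (hk₁ : k₁ ≠ 0) (hs : IsScaling k₁ α β)
    (h : IsPainleveIVSolutionOn ((k₃ - 1) * β / α) c y (rescaledVar k₁ k₂ α ⁻¹' D)) :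
    ∃ F : SixFunctions 𝕜, F.IsSolutionOn D ∧ F.HasIntegralsOn k₁ k₂ k₃ D ∧
      Set.EqOn (F.painleveVar k₁ k₂ α β) y (rescaledVar k₁ k₂ α ⁻¹' D) ∧
      ∀ G : SixFunctions 𝕜, G.IsSolutionOn D → G.HasIntegralsOn k₁ k₂ k₃ D →
        Set.EqOn (G.painleveVar k₁ k₂ α β) y (rescaledVar k₁ k₂ α ⁻¹' D) → G.AgreeOn F D := by
  obtain ⟨hα, hβ⟩ := hs.ne_zero hk₁
  have hcont : Continuous (rescaledVar k₁ k₂ α) :=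
    continuous_iff_continuousAt.2 fun t => (hasDerivAt_rescaledVar k₁ k₂ α t).continuousAt
  obtain ⟨y0, y1, y2⟩ := h.hasDerivAt (hD.preimage hcont)
  -- The inverse of `rescaledVar`.
  set τ : 𝕜 → 𝕜 := fun z => α * (z + k₂ / k₁) with hτ
  have hζτ : ∀ z, rescaledVar k₁ k₂ α (τ z) = z := fun z => by
    simp only [rescaledVar, hτ]; field_simp; ring
  have hτζ : ∀ t, τ (rescaledVar k₁ k₂ α t) = t := fun t => by
    simp only [rescaledVar, hτ]; field_simp; ring
  have hmem : ∀ z ∈ D, τ z ∈ rescaledVar k₁ k₂ α ⁻¹' D := fun z hz => by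
    rwa [Set.mem_preimage, hζτ]
  have dτ : ∀ z, HasDerivAt τ (α * 1) z := fun z =>
    ((hasDerivAt_id' z).add_const (k₂ / k₁)).const_mul α
  have hsol : (SixFunctions.ofShifted k₁ k₂ k₃ (fun z => β * y (τ z))
      (fun z => α * β * deriv y (τ z))
      (fun z => α ^ 2 * β * deriv (deriv y) (τ z))).IsSolutionOn D := by
    refine SixFunctions.isSolutionOn_ofShifted hk₁ (fun z hz => ?_) (fun z hz => ?_) fun z hz => ?_
    · refine HasDerivAt.congr_deriv (((y0 _ (hmem z hz)).comp z (dτ z)).const_mul β) ?_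
      ring
    · refine HasDerivAt.congr_deriv (((y1 _ (hmem z hz)).comp z (dτ z)).const_mul (α * β)) ?_
      ring
    · refine HasDerivAt.congr_deriv (((y2 _ (hmem z hz)).comp z (dτ z)).const_mul (α ^ 2 * β)) ?_
      have hw : k₁ * z + k₂ = 2 * β * τ z := by
        simp only [hτ]; field_simp; rw [← hs.2]; ring
      have hb : (k₃ - 1) * k₁ = 2 * α ^ 2 * ((k₃ - 1) * β / α) := by
        rw [← hs.2]; field_simp
      rw [hw, mul_assoc 2 (k₃ - 1), hb, ← hs.2]
      generalize (k₃ - 1) * β / α = b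
      generalize τ z = t
      linear_combination (α * β) * (6 * y t ^ 2 * deriv y t + 4 * y t ^ 2
        + 12 * t * y t * deriv y t + 4 * t ^ 2 * deriv y t + 4 * t * y t) * hs.1
  have heq : ∀ z, (SixFunctions.ofShifted k₁ k₂ k₃ (fun z => β * y (τ z))
      (fun z => α * β * deriv y (τ z))
      (fun z => α ^ 2 * β * deriv (deriv y) (τ z))).shifted k₁ k₂ z = β * y (τ z) := fun z => by
    simp only [SixFunctions.shifted, SixFunctions.ofShifted]; ring
  refine ⟨_, hsol, SixFunctions.hasIntegralsOn_ofShifted _ _ _ _ _ _ _, fun t ht => ?_,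
    fun G hG hGk hGy => ?_⟩
  · rw [SixFunctions.painleveVar_eq, heq, hτζ, mul_div_cancel_left₀ _ hβ]
  · refine hsol.agreeOn hD hG (SixFunctions.hasIntegralsOn_ofShifted _ _ _ _ _ _ _) hGk hk₁
      fun z hz => ?_
    have h1 := hGy (hmem z hz)
    rw [SixFunctions.painleveVar_eq, hζτ, div_eq_iff hβ, mul_comm, ← heq z] at h1
    simpa only [SixFunctions.shifted, sub_left_inj, add_left_inj] using h1

/-- The sign is needed over the reals, where a nonzero number is a square only up to sign. -/
theorem RCLike.exists_sq_eq_or_neg (x : 𝕜) : ∃ s : 𝕜, s ^ 2 = x ∨ s ^ 2 = -x := by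
  rcases RCLike.I_eq_zero_or_im_I_eq_one (K := 𝕜) with h | h
  · set φ := RCLike.realRingEquiv h
    rcases le_total 0 (φ x) with hx | hx
    · refine ⟨φ.symm (√(φ x)), Or.inl ?_⟩
      rw [← map_pow, Real.sq_sqrt hx, φ.symm_apply_apply]
    · refine ⟨φ.symm (√(-φ x)), Or.inr ?_⟩
      rw [← map_pow, Real.sq_sqrt (by linarith), map_neg, φ.symm_apply_apply]
  · set φ := RCLike.complexRingEquiv h
    obtain ⟨s, hs⟩ := IsAlgClosed.exists_pow_nat_eq (φ x) (n := 2) (by norm_num)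
    exact ⟨φ.symm s, Or.inl (by rw [← map_pow, hs, φ.symm_apply_apply])⟩

/-- Take α = β if k₁ / 2 is a square, and β = -α if its negative is. Asking for α² = β² rather than
α = β admits both signs of a real k₁. -/
theorem exists_isScaling (k₁ : 𝕜) : ∃ α β : 𝕜, IsScaling k₁ α β := by
  obtain ⟨s, hs | hs⟩ := RCLike.exists_sq_eq_or_neg (k₁ / 2)
  · exact ⟨s, s, rfl, by linear_combination 2 * hs⟩
  · exact ⟨s, -s, by ring, by linear_combination -2 * hs⟩

end PainleveReduction

/-! ### Connections on open subsets of 𝕜³. -/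

section FlatModel

variable {𝕜 : Type*} [RCLike 𝕜]

theorem smoothField_iff_contDiffOn {X : (Fin 3 → 𝕜) → Fin 3 → 𝕜} {U : Set (Fin 3 → 𝕜)} :
    SmoothField (𝕜 := 𝕜) (M := Fin 3 → 𝕜) X U ↔ ContDiffOn 𝕜 ∞ X U :=
  contMDiffOn_vectorSpace_iff_contDiffOn

theorem lieB_apply (X Y : (Fin 3 → 𝕜) → Fin 3 → 𝕜) (x : Fin 3 → 𝕜) :
    (lieB (𝕜 := 𝕜) (M := Fin 3 → 𝕜) X Y x : Fin 3 → 𝕜) =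
      fderiv 𝕜 Y x (X x) - fderiv 𝕜 X x (Y x) := by
  have h1 := VectorField.mlieBracketWithin_univ (I := I3 𝕜) (V := X) (W := Y)
  have h2 := VectorField.mlieBracketWithin_eq_lieBracketWithin (𝕜 := 𝕜) (V := X) (W := Y)
    (s := Set.univ)
  exact congrFun ((h1.symm.trans h2).trans VectorField.lieBracketWithin_univ) x

theorem differentiableAt_of_mdifferentiableAt {X : (Fin 3 → 𝕜) → Fin 3 → 𝕜} {x : Fin 3 → 𝕜}
    (h : MDifferentiableAt (I3 𝕜) (I3 𝕜).tangent
      (fun y => (⟨y, X y⟩ : TangentBundle (I3 𝕜) (Fin 3 → 𝕜))) x) : DifferentiableAt 𝕜 X x := by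
  rw [← mdifferentiableAt_iff_differentiableAt]
  exact ((contMDiff_snd_tangentBundle_modelSpace (n := 1) (Fin 3 → 𝕜)
    (I3 𝕜)).mdifferentiableAt one_ne_zero).comp x h

theorem mvfderiv_eq_fderiv (g : (Fin 3 → 𝕜) → 𝕜) (x v : Fin 3 → 𝕜) :
    mvfderiv (I3 𝕜) g x v = fderiv 𝕜 g x v := by
  rw [mvfderiv, mfderiv_eq_fderiv]
  rfl

/-- The connection with Christoffel symbols `G`: `∇_v Y = DY(v) + G(v, Y)`. -/
noncomputable def connectionOf (G : (Fin 3 → 𝕜) → (Fin 3 → 𝕜) →L[𝕜] (Fin 3 → 𝕜) →L[𝕜] Fin 3 → 𝕜) :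
    TConnection 𝕜 (Fin 3 → 𝕜) :=
  fun Y x => (fderiv 𝕜 (F := Fin 3 → 𝕜) Y x + (G x).flip (Y x) : (Fin 3 → 𝕜) →L[𝕜] Fin 3 → 𝕜)

theorem isCovariantDerivativeOn_connectionOf
    (G : (Fin 3 → 𝕜) → (Fin 3 → 𝕜) →L[𝕜] (Fin 3 → 𝕜) →L[𝕜] Fin 3 → 𝕜) (s : Set (Fin 3 → 𝕜)) :
    IsCovariantDerivativeOn (I := I3 𝕜) (Fin 3 → 𝕜) (connectionOf G) s where
  add {σ σ' x} hσ hσ' _ := ContinuousLinearMap.ext fun v => by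
    -- Stated in 𝕜³, which is every tangent space by definition; the same device recurs below.
    have key : ∀ {σ σ' : (Fin 3 → 𝕜) → Fin 3 → 𝕜}, DifferentiableAt 𝕜 σ x →
        DifferentiableAt 𝕜 σ' x → ∀ v : Fin 3 → 𝕜, fderiv 𝕜 (σ + σ') x v + G x v (σ x + σ' x) =
          (fderiv 𝕜 σ x v + G x v (σ x)) + (fderiv 𝕜 σ' x v + G x v (σ' x)) := by
      intro σ σ' h1 h2 v
      rw [fderiv_add h1 h2, map_add, add_apply]
      abel
    exact key (differentiableAt_of_mdifferentiableAt hσ)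
      (differentiableAt_of_mdifferentiableAt hσ') v
  leibniz {σ g x} hσ hg _ := ContinuousLinearMap.ext fun v => by
    have key : ∀ {σ : (Fin 3 → 𝕜) → Fin 3 → 𝕜}, DifferentiableAt 𝕜 σ x →
        DifferentiableAt 𝕜 g x → ∀ v : Fin 3 → 𝕜, fderiv 𝕜 (g • σ) x v + G x v (g x • σ x) =
          g x • (fderiv 𝕜 σ x v + G x v (σ x)) + mvfderiv (I3 𝕜) g x v • σ x := by
      intro σ h1 h2 v
      rw [fderiv_smul h2 h1, map_smul, mvfderiv_eq_fderiv]
      simp only [add_apply, smul_apply, smul_add, ContinuousLinearMap.smulRight_apply]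
      abel
    exact key (differentiableAt_of_mdifferentiableAt hσ) (mdifferentiableAt_iff_differentiableAt.1 hg) v

theorem fderiv_connectionOf
    {G : (Fin 3 → 𝕜) → (Fin 3 → 𝕜) →L[𝕜] (Fin 3 → 𝕜) →L[𝕜] Fin 3 → 𝕜}
    {Y Z : (Fin 3 → 𝕜) → Fin 3 → 𝕜} {x : Fin 3 → 𝕜}
    (hG : DifferentiableAt 𝕜 G x) (hY : DifferentiableAt 𝕜 Y x) (hZ : DifferentiableAt 𝕜 Z x)
    (hZ' : DifferentiableAt 𝕜 (fderiv 𝕜 Z) x) (v : Fin 3 → 𝕜) :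
    fderiv 𝕜 (fun y => fderiv 𝕜 Z y (Y y) + G y (Y y) (Z y)) x v =
      fderiv 𝕜 (fderiv 𝕜 Z) x v (Y x) + fderiv 𝕜 Z x (fderiv 𝕜 Y x v)
        + (fderiv 𝕜 G x v (Y x) (Z x) + G x (fderiv 𝕜 Y x v) (Z x)
          + G x (Y x) (fderiv 𝕜 Z x v)) := by
  have := (hZ'.hasFDerivAt.clm_apply hY.hasFDerivAt).add
    ((hG.hasFDerivAt.clm_apply hY.hasFDerivAt).clm_apply hZ.hasFDerivAt)
  have e := congrArg (fun L : (Fin 3 → 𝕜) →L[𝕜] Fin 3 → 𝕜 => L v) this.fderiv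
  refine e.trans ?_
  simp only [add_apply, ContinuousLinearMap.flip_apply, ContinuousLinearMap.comp_apply]
  abel

/-- Torsion is the antisymmetric part of G. In the curvature the second derivatives of Z cancel by
symmetry and the first derivatives of X, Y, Z cancel as well, leaving the usual expression in G and
its derivative. -/
theorem isFlatConnectionOn_connectionOf
    {G : (Fin 3 → 𝕜) → (Fin 3 → 𝕜) →L[𝕜] (Fin 3 → 𝕜) →L[𝕜] Fin 3 → 𝕜} {s : Set (Fin 3 → 𝕜)}
    (hG : ContDiffOn 𝕜 ∞ G s) (symm : ∀ x ∈ s, ∀ v w, G x v w = G x w v)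
    (flat : ∀ x ∈ s, ∀ h v w, fderiv 𝕜 G x h v w - fderiv 𝕜 G x v h w + G x h (G x v w)
      - G x v (G x h w) = 0) :
    IsFlatConnectionOn (connectionOf G) s where
  connection := isCovariantDerivativeOn_connectionOf G s
  smooth := fun U hUs hU (X Y : (Fin 3 → 𝕜) → Fin 3 → 𝕜) hX hY =>
    smoothField_iff_contDiffOn.2 <| (((contDiffOn_infty_iff_fderiv_of_isOpen hU).1
      (smoothField_iff_contDiffOn.1 hY)).2.clm_apply (smoothField_iff_contDiffOn.1 hX)).add
      (((hG.mono hUs).clm_apply (smoothField_iff_contDiffOn.1 hX)).clm_apply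
        (smoothField_iff_contDiffOn.1 hY))
  torsionless := fun U hUs hU (X Y : (Fin 3 → 𝕜) → Fin 3 → 𝕜) hX hY x hx => by
    have key : (fderiv 𝕜 Y x (X x) + G x (X x) (Y x)) - (fderiv 𝕜 X x (Y x) + G x (Y x) (X x)) =
        fderiv 𝕜 Y x (X x) - fderiv 𝕜 X x (Y x) := by
      rw [symm x (hUs hx) (X x) (Y x)]
      abel
    exact key.trans (lieB_apply X Y x).symm
  flat := fun U hUs hU (X Y Z : (Fin 3 → 𝕜) → Fin 3 → 𝕜) hX hY hZ x hx => by
    replace hX := smoothField_iff_contDiffOn.1 hX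
    replace hY := smoothField_iff_contDiffOn.1 hY
    replace hZ := smoothField_iff_contDiffOn.1 hZ
    have hmem := hU.mem_nhds hx
    have dG : DifferentiableAt 𝕜 G x :=
      ((hG.mono hUs).differentiableOn (by simp)).differentiableAt hmem
    have dX := (hX.differentiableOn (by simp)).differentiableAt hmem
    have dY := (hY.differentiableOn (by simp)).differentiableAt hmem
    have dZ := (hZ.differentiableOn (by simp)).differentiableAt hmem
    have dZ' := (((contDiffOn_infty_iff_fderiv_of_isOpen hU).1 hZ).2.differentiableOn
      (by simp)).differentiableAt hmem
    have hsymm : IsSymmSndFDerivAt 𝕜 Z x := (hZ.contDiffAt hmem).isSymmSndFDerivAt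
      (by rw [minSmoothness_of_isRCLikeNormedField]; exact ENat.LEInfty.out)
    have key : ∀ W : Fin 3 → 𝕜, W = fderiv 𝕜 Y x (X x) - fderiv 𝕜 X x (Y x) →
        (fderiv 𝕜 (fun y => fderiv 𝕜 Z y (Y y) + G y (Y y) (Z y)) x (X x)
          + G x (X x) (fderiv 𝕜 Z x (Y x) + G x (Y x) (Z x)))
        - (fderiv 𝕜 (fun y => fderiv 𝕜 Z y (X y) + G y (X y) (Z y)) x (Y x)
          + G x (Y x) (fderiv 𝕜 Z x (X x) + G x (X x) (Z x)))
        - (fderiv 𝕜 Z x W + G x W (Z x)) = 0 := by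
      rintro W rfl
      rw [fderiv_connectionOf dG dY dZ dZ', fderiv_connectionOf dG dX dZ dZ',
        hsymm (X x) (Y x), ← flat x (hUs hx) (X x) (Y x) (Z x)]
      simp only [map_sub, map_add, sub_apply]
      abel
    exact key _ (lieB_apply X Y x)

end FlatModel

/-! ### The algebra of truncated polynomials and the products built from it. -/

section FlatModel

variable {𝕜 : Type*} [RCLike 𝕜]

/-- A bilinear map on `𝕜³`, as a continuous bilinear map. -/
noncomputable def bilinearCLM (f : (Fin 3 → 𝕜) →ₗ[𝕜] (Fin 3 → 𝕜) →ₗ[𝕜] Fin 3 → 𝕜) :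
    (Fin 3 → 𝕜) →L[𝕜] (Fin 3 → 𝕜) →L[𝕜] Fin 3 → 𝕜 :=
  LinearMap.toContinuousLinearMap ((LinearMap.toContinuousLinearMap
    (𝕜 := 𝕜) (E := Fin 3 → 𝕜) (F' := Fin 3 → 𝕜)).toLinearMap ∘ₗ f)

theorem bilinearCLM_apply (f : (Fin 3 → 𝕜) →ₗ[𝕜] (Fin 3 → 𝕜) →ₗ[𝕜] Fin 3 → 𝕜) (v w : Fin 3 → 𝕜) :
    bilinearCLM f v w = f v w := rfl

variable (𝕜) in
/-- Multiplication of truncated polynomials of degree less than three. -/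
def jetMul : (Fin 3 → 𝕜) →ₗ[𝕜] (Fin 3 → 𝕜) →ₗ[𝕜] Fin 3 → 𝕜 :=
  LinearMap.mk₂ 𝕜
    (fun v w => ![v 0 * w 0, v 0 * w 1 + v 1 * w 0, v 0 * w 2 + v 1 * w 1 + v 2 * w 0])
    (fun v v' w => by ext i; fin_cases i <;> simp <;> ring)
    (fun c v w => by ext i; fin_cases i <;> simp <;> ring)
    (fun v w w' => by ext i; fin_cases i <;> simp <;> ring)
    (fun c v w => by ext i; fin_cases i <;> simp <;> ring)

variable (𝕜) in
/-- Multiplication of truncated polynomials as a continuous bilinear map. -/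
noncomputable def jetMulL : (Fin 3 → 𝕜) →L[𝕜] (Fin 3 → 𝕜) →L[𝕜] Fin 3 → 𝕜 := bilinearCLM (jetMul 𝕜)

theorem jetMulL_apply (v w : Fin 3 → 𝕜) : jetMulL 𝕜 v w =
    ![v 0 * w 0, v 0 * w 1 + v 1 * w 0, v 0 * w 2 + v 1 * w 1 + v 2 * w 0] := rfl

theorem jetMulL_comm (v w : Fin 3 → 𝕜) : jetMulL 𝕜 v w = jetMulL 𝕜 w v := by
  ext i; fin_cases i <;> simp [jetMulL_apply] <;> ring

theorem jetMulL_assoc (v w x : Fin 3 → 𝕜) :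
    jetMulL 𝕜 (jetMulL 𝕜 v w) x = jetMulL 𝕜 v (jetMulL 𝕜 w x) := by
  ext i; fin_cases i <;> simp [jetMulL_apply] <;> ring

theorem jetMulL_left_comm (v w x : Fin 3 → 𝕜) :
    jetMulL 𝕜 v (jetMulL 𝕜 w x) = jetMulL 𝕜 w (jetMulL 𝕜 v x) := by
  rw [← jetMulL_assoc, jetMulL_comm v w, jetMulL_assoc]

theorem jetMulL_single_zero (v : Fin 3 → 𝕜) : jetMulL 𝕜 v (Pi.single 0 1) = v := by
  ext i; fin_cases i <;> simp [jetMulL_apply]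

variable (𝕜) in
/-- The product `X ∘ Y ∘ ρ`. -/
noncomputable def jetProduct (ρ : (Fin 3 → 𝕜) → Fin 3 → 𝕜) : TProduct 𝕜 (Fin 3 → 𝕜) :=
  fun x => ((jetMul 𝕜).compr₂ ((jetMul 𝕜).flip (ρ x)) :
    (Fin 3 → 𝕜) →ₗ[𝕜] (Fin 3 → 𝕜) →ₗ[𝕜] Fin 3 → 𝕜)

theorem fderiv_jetMulL {X Y : (Fin 3 → 𝕜) → Fin 3 → 𝕜} {x : Fin 3 → 𝕜}
    (hX : DifferentiableAt 𝕜 X x) (hY : DifferentiableAt 𝕜 Y x) (v : Fin 3 → 𝕜) :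
    fderiv 𝕜 (fun y => jetMulL 𝕜 (X y) (Y y)) x v =
      jetMulL 𝕜 (X x) (fderiv 𝕜 Y x v) + jetMulL 𝕜 (fderiv 𝕜 X x v) (Y x) := by
  have h := (jetMulL 𝕜).hasFDerivAt_of_bilinear hX.hasFDerivAt hY.hasFDerivAt
  have e := congrArg (fun L : (Fin 3 → 𝕜) →L[𝕜] Fin 3 → 𝕜 => L v) h.fderiv
  refine e.trans ?_
  simp [ContinuousLinearMap.precompR, ContinuousLinearMap.precompL]

theorem contDiffOn_jetMulL {X Y : (Fin 3 → 𝕜) → Fin 3 → 𝕜} {U : Set (Fin 3 → 𝕜)} {n : ℕ∞ω}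
    (hX : ContDiffOn 𝕜 n X U) (hY : ContDiffOn 𝕜 n Y U) :
    ContDiffOn 𝕜 n (fun y => jetMulL 𝕜 (X y) (Y y)) U :=
  (contDiffOn_const.clm_apply hX).clm_apply hY

theorem differentiableAt_jetMulL {X Y : (Fin 3 → 𝕜) → Fin 3 → 𝕜} {x : Fin 3 → 𝕜}
    (hX : DifferentiableAt 𝕜 X x) (hY : DifferentiableAt 𝕜 Y x) :
    DifferentiableAt 𝕜 (fun y => jetMulL 𝕜 (X y) (Y y)) x :=
  ((differentiableAt_const _).clm_apply hX).clm_apply hY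

/-- `[X, Z ∘ W ∘ ρ] - [X, Z] ∘ W ∘ ρ - Z ∘ [X, W] ∘ ρ` if `Dρ(v) = κ ∘ v`. -/
theorem jetProduct_P {ρ X Z W : (Fin 3 → 𝕜) → Fin 3 → 𝕜} {x κ : Fin 3 → 𝕜}
    (hρ : DifferentiableAt 𝕜 ρ x) (hκ : ∀ v, fderiv 𝕜 ρ x v = jetMulL 𝕜 κ v)
    (hZ : DifferentiableAt 𝕜 Z x) (hW : DifferentiableAt 𝕜 W x) :
    ((jetProduct 𝕜 ρ).P X Z W x : Fin 3 → 𝕜) =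
      jetMulL 𝕜 (jetMulL 𝕜 (Z x) (W x)) (jetMulL 𝕜 κ (X x))
        - fderiv 𝕜 X x (jetMulL 𝕜 (jetMulL 𝕜 (Z x) (W x)) (ρ x))
        + jetMulL 𝕜 (jetMulL 𝕜 (fderiv 𝕜 X x (Z x)) (W x)) (ρ x)
        + jetMulL 𝕜 (jetMulL 𝕜 (Z x) (fderiv 𝕜 X x (W x))) (ρ x) := by
  have key : ∀ A B C : Fin 3 → 𝕜,
      A = fderiv 𝕜 (fun y => jetMulL 𝕜 (jetMulL 𝕜 (Z y) (W y)) (ρ y)) x (X x)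
        - fderiv 𝕜 X x (jetMulL 𝕜 (jetMulL 𝕜 (Z x) (W x)) (ρ x)) →
      B = fderiv 𝕜 Z x (X x) - fderiv 𝕜 X x (Z x) →
      C = fderiv 𝕜 W x (X x) - fderiv 𝕜 X x (W x) →
      A - jetMulL 𝕜 (jetMulL 𝕜 B (W x)) (ρ x) - jetMulL 𝕜 (jetMulL 𝕜 (Z x) C) (ρ x) =
      jetMulL 𝕜 (jetMulL 𝕜 (Z x) (W x)) (jetMulL 𝕜 κ (X x))
        - fderiv 𝕜 X x (jetMulL 𝕜 (jetMulL 𝕜 (Z x) (W x)) (ρ x))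
        + jetMulL 𝕜 (jetMulL 𝕜 (fderiv 𝕜 X x (Z x)) (W x)) (ρ x)
        + jetMulL 𝕜 (jetMulL 𝕜 (Z x) (fderiv 𝕜 X x (W x))) (ρ x) := by
    rintro A B C rfl rfl rfl
    rw [fderiv_jetMulL (differentiableAt_jetMulL hZ hW) hρ, fderiv_jetMulL hZ hW, hκ]
    simp only [map_add, map_sub, add_apply, sub_apply]
    abel
  exact key _ _ _ (lieB_apply X _ x) (lieB_apply X Z x) (lieB_apply X W x)

/-- The two products are treated together: ρ = e with κ = 0 gives ∘, and ρ = E⁻¹ with κ = -ρ ∘ ρ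
gives *. Since Dρ is multiplication by κ, both sides of the Hertling-Manin identity expand into the
same products of X, Y, Z, W, ρ, κ and the derivatives of X and Y, by commutativity and
associativity. -/
theorem isFManifoldOn_jetProduct {ρ η κ : (Fin 3 → 𝕜) → Fin 3 → 𝕜} {s : Set (Fin 3 → 𝕜)}
    (hρ : ContDiffOn 𝕜 ∞ ρ s) (hη : ContDiffOn 𝕜 ∞ η s)
    (hκ : ∀ x ∈ s, ∀ v, fderiv 𝕜 ρ x v = jetMulL 𝕜 (κ x) v)
    (hu : ∀ x ∈ s, jetMulL 𝕜 (η x) (ρ x) = Pi.single 0 1) :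
    IsFManifoldOn (jetProduct 𝕜 ρ) η s where
  smooth_mul := fun U hUs hU (X Y : (Fin 3 → 𝕜) → Fin 3 → 𝕜) hX hY =>
    smoothField_iff_contDiffOn.2 <| contDiffOn_jetMulL (contDiffOn_jetMulL
      (smoothField_iff_contDiffOn.1 hX) (smoothField_iff_contDiffOn.1 hY)) (hρ.mono hUs)
  smooth_unit := smoothField_iff_contDiffOn.2 hη
  comm := fun x _ (v w : Fin 3 → 𝕜) =>
    congrArg (fun a => jetMulL 𝕜 a (ρ x)) (jetMulL_comm v w)
  assoc := fun x _ (v w z : Fin 3 → 𝕜) => by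
    have : jetMulL 𝕜 (jetMulL 𝕜 (jetMulL 𝕜 (jetMulL 𝕜 v w) (ρ x)) z) (ρ x) =
        jetMulL 𝕜 (jetMulL 𝕜 v (jetMulL 𝕜 (jetMulL 𝕜 w z) (ρ x))) (ρ x) := by
      simp only [jetMulL_comm, jetMulL_left_comm]
    exact this
  unit := fun x hx (v : Fin 3 → 𝕜) => by
    have : jetMulL 𝕜 (jetMulL 𝕜 v (η x)) (ρ x) = v := by
      rw [jetMulL_assoc, hu x hx, jetMulL_single_zero]
    exact this
  hertling_manin := fun U hUs hU (X Y Z W : (Fin 3 → 𝕜) → Fin 3 → 𝕜) hX hY hZ hW x hx => by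
    have hd : ∀ {X : (Fin 3 → 𝕜) → Fin 3 → 𝕜}, ContDiffOn 𝕜 ∞ X U → DifferentiableAt 𝕜 X x :=
      fun h => (h.differentiableOn (by simp)).differentiableAt (hU.mem_nhds hx)
    have dX := hd (smoothField_iff_contDiffOn.1 hX)
    have dY := hd (smoothField_iff_contDiffOn.1 hY)
    have dZ := hd (smoothField_iff_contDiffOn.1 hZ)
    have dW := hd (smoothField_iff_contDiffOn.1 hW)
    have dρ := hd (hρ.mono hUs)
    have hκx := hκ x (hUs hx)
    have key : ∀ A B C : Fin 3 → 𝕜,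
        A = ((jetProduct 𝕜 ρ).P ((jetProduct 𝕜 ρ).app X Y) Z W x : Fin 3 → 𝕜) →
        B = ((jetProduct 𝕜 ρ).P Y Z W x : Fin 3 → 𝕜) →
        C = ((jetProduct 𝕜 ρ).P X Z W x : Fin 3 → 𝕜) →
        A = jetMulL 𝕜 (jetMulL 𝕜 (X x) B) (ρ x) + jetMulL 𝕜 (jetMulL 𝕜 (Y x) C) (ρ x) := by
      intro A B C hA hB hC
      rw [jetProduct_P dρ hκx dZ dW] at hB hC
      replace hA := hA.trans (jetProduct_P
        (X := fun y => jetMulL 𝕜 (jetMulL 𝕜 (X y) (Y y)) (ρ y)) dρ hκx dZ dW)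
      simp only [fderiv_jetMulL (differentiableAt_jetMulL dX dY) dρ, fderiv_jetMulL dX dY,
        hκx] at hA
      rw [hA, hB, hC]
      simp only [map_add, map_sub, add_apply, sub_apply, jetMulL_comm, jetMulL_left_comm]
      abel
    exact key _ _ _ rfl rfl rfl

end FlatModel

/-! ### The Christoffel symbols of the normal form. -/

section FlatModel

variable {𝕜 : Type*} [RCLike 𝕜]

/-- The Christoffel bilinear map with the six coefficients `a`, in the order of `SixFunctions`. -/
def christoffelForm (a : Fin 6 → 𝕜) : (Fin 3 → 𝕜) →ₗ[𝕜] (Fin 3 → 𝕜) →ₗ[𝕜] Fin 3 → 𝕜 :=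
  LinearMap.mk₂ 𝕜
    (fun v w => ![a 0 * (v 1 * w 2 + v 2 * w 1) + a 3 * (v 1 * w 1),
      a 0 * (v 2 * w 2) + a 2 * (v 1 * w 2 + v 2 * w 1) + a 4 * (v 1 * w 1),
      a 5 * (v 1 * w 1) + a 1 * (v 1 * w 2 + v 2 * w 1) + (a 2 - a 3) * (v 2 * w 2)])
    (fun v v' w => by ext i; fin_cases i <;> simp <;> ring)
    (fun c v w => by ext i; fin_cases i <;> simp <;> ring)
    (fun v w w' => by ext i; fin_cases i <;> simp <;> ring)
    (fun c v w => by ext i; fin_cases i <;> simp <;> ring)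

variable (𝕜) in
/-- `christoffelForm` as a continuous trilinear map. -/
noncomputable def christoffelL :
    (Fin 6 → 𝕜) →L[𝕜] (Fin 3 → 𝕜) →L[𝕜] (Fin 3 → 𝕜) →L[𝕜] Fin 3 → 𝕜 :=
  LinearMap.toContinuousLinearMap (𝕜 := 𝕜) (E := Fin 6 → 𝕜)
    (F' := (Fin 3 → 𝕜) →L[𝕜] (Fin 3 → 𝕜) →L[𝕜] Fin 3 → 𝕜)
    { toFun := fun a => bilinearCLM (christoffelForm a)
      map_add' := fun a b => by
        ext v w i
        fin_cases i <;> simp [bilinearCLM_apply, christoffelForm] <;> ring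
      map_smul' := fun c a => by
        ext v w i
        fin_cases i <;> simp [bilinearCLM_apply, christoffelForm] <;> ring }

theorem christoffelL_apply (a : Fin 6 → 𝕜) (v w : Fin 3 → 𝕜) : christoffelL 𝕜 a v w =
    ![a 0 * (v 1 * w 2 + v 2 * w 1) + a 3 * (v 1 * w 1),
      a 0 * (v 2 * w 2) + a 2 * (v 1 * w 2 + v 2 * w 1) + a 4 * (v 1 * w 1),
      a 5 * (v 1 * w 1) + a 1 * (v 1 * w 2 + v 2 * w 1) + (a 2 - a 3) * (v 2 * w 2)] := rfl

theorem christoffelL_comm (a : Fin 6 → 𝕜) (v w : Fin 3 → 𝕜) :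
    christoffelL 𝕜 a v w = christoffelL 𝕜 a w v := by
  ext i; fin_cases i <;> simp [christoffelL_apply] <;> ring

/-- `∇ c` is symmetric for the constant product. -/
theorem christoffelL_compatible (a : Fin 6 → 𝕜) (v w x : Fin 3 → 𝕜) :
    christoffelL 𝕜 a v (jetMulL 𝕜 w x) - jetMulL 𝕜 w (christoffelL 𝕜 a v x) =
      christoffelL 𝕜 a w (jetMulL 𝕜 v x) - jetMulL 𝕜 v (christoffelL 𝕜 a w x) := by
  ext i; fin_cases i <;> simp [christoffelL_apply, jetMulL_apply] <;> ring

/-- The inverse of `u` for `jetMul`. -/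
noncomputable def jetInv (u : Fin 3 → 𝕜) : Fin 3 → 𝕜 :=
  ![1 / u 0, -u 1 / u 0 ^ 2, u 1 ^ 2 / u 0 ^ 3 - u 2 / u 0 ^ 2]

theorem jetMulL_jetInv {u : Fin 3 → 𝕜} (hu : u 0 ≠ 0) :
    jetMulL 𝕜 u (jetInv u) = Pi.single 0 1 := by
  ext i; fin_cases i <;> simp [jetMulL_apply, jetInv] <;> field_simp <;> ring

theorem contDiffOn_jetInv : ContDiffOn 𝕜 ∞ (jetInv (𝕜 := 𝕜)) {u | u 0 ≠ 0} := by
  rw [contDiffOn_pi]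
  have h : ∀ n : ℕ, ContDiffOn 𝕜 ∞ (fun u : Fin 3 → 𝕜 => (u 0 ^ n)⁻¹) {u | u 0 ≠ 0} := fun n =>
    ContDiffOn.inv (by fun_prop) fun u hu => pow_ne_zero n hu
  intro i
  fin_cases i
  · exact (h 1).congr fun u _ => by simp [jetInv]
  · have : ContDiffOn 𝕜 ∞ (fun u : Fin 3 → 𝕜 => -u 1 * (u 0 ^ 2)⁻¹) {u | u 0 ≠ 0} :=
      ContDiffOn.mul (by fun_prop) (h 2)
    exact this.congr fun u _ => by simp [jetInv, div_eq_mul_inv]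
  · have : ContDiffOn 𝕜 ∞ (fun u : Fin 3 → 𝕜 => u 1 ^ 2 * (u 0 ^ 3)⁻¹ - u 2 * (u 0 ^ 2)⁻¹)
        {u | u 0 ≠ 0} :=
      (ContDiffOn.mul (by fun_prop) (h 3)).sub (ContDiffOn.mul (by fun_prop) (h 2))
    exact this.congr fun u _ => by simp [jetInv, div_eq_mul_inv]

/-- Differentiate u ∘ u⁻¹ = e and multiply by u⁻¹. -/
theorem fderiv_jetInv {u : Fin 3 → 𝕜} (hu : u 0 ≠ 0) (v : Fin 3 → 𝕜) :
    fderiv 𝕜 jetInv u v = jetMulL 𝕜 (-jetMulL 𝕜 (jetInv u) (jetInv u)) v := by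
  have hopen : IsOpen {u : Fin 3 → 𝕜 | u 0 ≠ 0} := isOpen_ne_fun (by fun_prop) (by fun_prop)
  have hd : DifferentiableAt 𝕜 (jetInv (𝕜 := 𝕜)) u :=
    (contDiffOn_jetInv.differentiableOn (by simp)).differentiableAt (hopen.mem_nhds hu)
  have h1 : fderiv 𝕜 (fun w : Fin 3 → 𝕜 => jetMulL 𝕜 w (jetInv w)) u v = 0 := by
    have : (fun w : Fin 3 → 𝕜 => jetMulL 𝕜 w (jetInv w)) =ᶠ[nhds u] fun _ => Pi.single 0 1 := by
      filter_upwards [hopen.mem_nhds hu] with w hw using jetMulL_jetInv hw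
    rw [this.fderiv_eq]
    simp
  have h2 := fderiv_jetMulL (X := fun w => w) (x := u) differentiableAt_id hd v
  rw [h1, fderiv_fun_id, ContinuousLinearMap.id_apply] at h2
  have h3 := congrArg (jetMulL 𝕜 (jetInv u)) h2
  rw [map_zero, map_add, jetMulL_left_comm, ← jetMulL_assoc, jetMulL_jetInv hu, jetMulL_comm,
    jetMulL_single_zero] at h3
  rw [eq_neg_of_add_eq_zero_left h3.symm, map_neg, neg_apply, jetMulL_comm v, jetMulL_assoc]

theorem singleJordanBlock_jetMul {u : Fin 3 → 𝕜} (hu : u 1 ≠ 0) :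
    SingleJordanBlock (jetMul 𝕜 u) := by
  -- The Jordan chain N ∘ N, N, e, where N = (0, u 1, u 2) is the nilpotent part of u.
  set f : Fin 3 → Fin 3 → 𝕜 := ![![0, 0, u 1 ^ 2], ![0, u 1, u 2], ![1, 0, 0]] with hf
  have hli : LinearIndependent 𝕜 f := by
    rw [Fintype.linearIndependent_iff]
    intro g hg
    have h0 := congrFun hg 0
    have h1 := congrFun hg 1
    have h2 := congrFun hg 2
    simp [Fin.sum_univ_three, hf, hu] at h0 h1 h2
    have h2' : g 0 = 0 := by simpa [h0, h1, hu] using h2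
    intro i; fin_cases i <;> simp [h0, h1, h2']
  set b := basisOfLinearIndependentOfCardEqFinrank hli (by simp) with hb
  have hbf : ∀ i, b i = f i := fun i => by simp [hb]
  refine ⟨u 0, b, ?_⟩
  have hmul : ∀ j, jetMul 𝕜 u (b j) =
      ∑ i, (!![u 0, 1, 0; 0, u 0, 1; 0, 0, u 0] : Matrix (Fin 3) (Fin 3) 𝕜) i j • b i := by
    intro j
    simp only [hbf]
    ext i
    fin_cases j <;> fin_cases i <;> (simp [jetMul, Fin.sum_univ_three, hf]; try ring)
  ext i j
  rw [LinearMap.toMatrix_apply, hmul]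
  simp [Finsupp.single_apply]

/-- The coefficients `Fᵢ(u³/u²)/u²`. -/
def SixFunctions.coefficients (F : SixFunctions 𝕜) (u : Fin 3 → 𝕜) : Fin 6 → 𝕜 :=
  ![F.F1 (u 2 / u 1) / u 1, F.F2 (u 2 / u 1) / u 1, F.F3 (u 2 / u 1) / u 1,
    F.F4 (u 2 / u 1) / u 1, F.F5 (u 2 / u 1) / u 1, F.F6 (u 2 / u 1) / u 1]

theorem christoffelL_coefficients_single (F : SixFunctions 𝕜) (u : Fin 3 → 𝕜) (j k : Fin 3) :
    christoffelL 𝕜 (F.coefficients u) (Pi.single j 1) (Pi.single k 1) =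
      F.christoffel u j k := by
  ext i
  fin_cases j <;> fin_cases k <;> fin_cases i <;>
    simp [christoffelL_apply, SixFunctions.coefficients, SixFunctions.christoffel, sub_div]

theorem hasFDerivAt_div_of_hasDerivAt {f : 𝕜 → 𝕜} {f' : 𝕜} {u : Fin 3 → 𝕜} (hu : u 1 ≠ 0)
    (h : HasDerivAt f f' (u 2 / u 1)) : ∃ L : (Fin 3 → 𝕜) →L[𝕜] 𝕜,
      HasFDerivAt (fun u : Fin 3 → 𝕜 => f (u 2 / u 1) / u 1) L u ∧
        ∀ v, L v = (f' * (v 2 - u 2 / u 1 * v 1) - f (u 2 / u 1) * v 1) / u 1 ^ 2 := by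
  have p1 := (ContinuousLinearMap.proj (R := 𝕜) (φ := fun _ : Fin 3 => 𝕜) 1).hasFDerivAt (x := u)
  have p2 := (ContinuousLinearMap.proj (R := 𝕜) (φ := fun _ : Fin 3 => 𝕜) 2).hasFDerivAt (x := u)
  have hi : HasFDerivAt (fun u : Fin 3 → 𝕜 => (u 1)⁻¹) _ u := (hasDerivAt_inv hu).comp_hasFDerivAt u p1
  have hz : HasFDerivAt (fun u : Fin 3 → 𝕜 => u 2 * (u 1)⁻¹) _ u := p2.mul hi
  rw [div_eq_mul_inv] at h
  have hf := (h.comp_hasFDerivAt u hz).mul hi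
  refine ⟨_, hf.congr_of_eventuallyEq
    (.of_forall fun v => by simp [div_eq_mul_inv]), fun v => ?_⟩
  simp
  field_simp
  ring

theorem SixFunctions.IsSolutionOn.hasFDerivAt_coefficients {F : SixFunctions 𝕜} {D : Set 𝕜}
    (h : F.IsSolutionOn D) {u : Fin 3 → 𝕜} (hu : u ∈ modelRegion D) :
    DifferentiableAt 𝕜 F.coefficients u ∧ ∀ v : Fin 3 → 𝕜,
      let z := u 2 / u 1
      fderiv 𝕜 F.coefficients u v = ![
        (0 * (v 2 - z * v 1) - F.F1 z * v 1) / u 1 ^ 2,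
        ((2 * F.F4 z * F.F3 z * z + 2 * F.F2 z * F.F1 z * z - 2 * F.F5 z * F.F1 z * z
          + F.F6 z * F.F1 z - F.F2 z * F.F3 z + F.F4 z - F.F3 z) * (v 2 - z * v 1)
            - F.F2 z * v 1) / u 1 ^ 2,
        ((-F.F4 z * F.F3 z - F.F2 z * F.F1 z + F.F5 z * F.F1 z - F.F1 z) * (v 2 - z * v 1)
            - F.F3 z * v 1) / u 1 ^ 2,
        ((F.F4 z * F.F3 z + F.F2 z * F.F1 z - F.F5 z * F.F1 z - F.F1 z) * (v 2 - z * v 1)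
            - F.F4 z * v 1) / u 1 ^ 2,
        ((F.F4 z * F.F3 z * z + F.F2 z * F.F1 z * z - F.F5 z * F.F1 z * z - F.F6 z * F.F1 z
          + F.F2 z * F.F3 z + F.F1 z * z - F.F3 z) * (v 2 - z * v 1) - F.F5 z * v 1) / u 1 ^ 2,
        ((-2 * F.F4 z * F.F3 z * z ^ 2 - 2 * F.F2 z * F.F1 z * z ^ 2
          + 2 * F.F5 z * F.F1 z * z ^ 2 - F.F6 z * F.F1 z * z + F.F2 z * F.F3 z * z
          + F.F4 z * F.F6 z - F.F4 z * z + F.F2 z ^ 2 - F.F2 z * F.F5 z + F.F3 z * z - F.F2 z)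
            * (v 2 - z * v 1) - F.F6 z * v 1) / u 1 ^ 2] := by
  obtain ⟨L1, h1, e1⟩ := hasFDerivAt_div_of_hasDerivAt hu.2.1 (h.eq1 _ hu.2.2)
  obtain ⟨L2, h2, e2⟩ := hasFDerivAt_div_of_hasDerivAt hu.2.1 (h.eq2 _ hu.2.2)
  obtain ⟨L3, h3, e3⟩ := hasFDerivAt_div_of_hasDerivAt hu.2.1 (h.eq3 _ hu.2.2)
  obtain ⟨L4, h4, e4⟩ := hasFDerivAt_div_of_hasDerivAt hu.2.1 (h.eq4 _ hu.2.2)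
  obtain ⟨L5, h5, e5⟩ := hasFDerivAt_div_of_hasDerivAt hu.2.1 (h.eq5 _ hu.2.2)
  obtain ⟨L6, h6, e6⟩ := hasFDerivAt_div_of_hasDerivAt hu.2.1 (h.eq6 _ hu.2.2)
  have key : HasFDerivAt F.coefficients (ContinuousLinearMap.pi ![L1, L2, L3, L4, L5, L6]) u := by
    rw [hasFDerivAt_pi]
    intro i
    fin_cases i
    exacts [h1, h2, h3, h4, h5, h6]
  refine ⟨key.differentiableAt, fun v => ?_⟩
  rw [key.fderiv]
  ext i
  fin_cases i
  exacts [e1 v, e2 v, e3 v, e4 v, e5 v, e6 v]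

theorem SixFunctions.IsSolutionOn.contDiffOn_coefficients {F : SixFunctions 𝕜} {D : Set 𝕜}
    (hD : IsOpen D) (h : F.IsSolutionOn D) :
    _root_.ContDiffOn 𝕜 ∞ F.coefficients (modelRegion D) := by
  have hz : _root_.ContDiffOn 𝕜 ∞ (fun u : Fin 3 → 𝕜 => u 2 / u 1) (modelRegion D) :=
    ContDiffOn.div (by fun_prop) (by fun_prop) fun u hu => hu.2.1
  have key : ∀ {f : 𝕜 → 𝕜}, _root_.ContDiffOn 𝕜 ∞ f D →
      _root_.ContDiffOn 𝕜 ∞ (fun u : Fin 3 → 𝕜 => f (u 2 / u 1) / u 1) (modelRegion D) :=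
    fun hf => ContDiffOn.div (hf.comp hz fun u hu => hu.2.2) (by fun_prop) fun u hu => hu.2.1
  obtain ⟨h1, h2, h3, h4, h5, h6⟩ := h.contDiffOn hD
  rw [contDiffOn_pi]
  intro i
  fin_cases i
  exacts [key h1, key h2, key h3, key h4, key h5, key h6]

end FlatModel

/-! ### The pointwise identities behind the two flat connections. -/

section FlatModel

variable {𝕜 : Type*} [RCLike 𝕜]

/-- Once the derivatives are replaced by the right-hand sides of the system, the curvature vanishes
as a rational identity in z, u 1 and the six values. -/
theorem SixFunctions.IsSolutionOn.curvature {F : SixFunctions 𝕜} {D : Set 𝕜}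
    (h : F.IsSolutionOn D) {u : Fin 3 → 𝕜} (hu : u ∈ modelRegion D) (x v w : Fin 3 → 𝕜) :
    christoffelL 𝕜 (fderiv 𝕜 F.coefficients u x) v w
      - christoffelL 𝕜 (fderiv 𝕜 F.coefficients u v) x w
      + christoffelL 𝕜 (F.coefficients u) x (christoffelL 𝕜 (F.coefficients u) v w)
      - christoffelL 𝕜 (F.coefficients u) v (christoffelL 𝕜 (F.coefficients u) x w) = 0 := by
  have hd := (h.hasFDerivAt_coefficients hu).2
  have hu1 := hu.2.1
  simp only [hd, SixFunctions.coefficients]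
  generalize u 2 / u 1 = z
  generalize F.F1 z = F1, F.F2 z = F2, F.F3 z = F3, F.F4 z = F4, F.F5 z = F5, F.F6 z = F6
  ext i
  fin_cases i <;> simp [christoffelL_apply] <;> field_simp <;> ring

/-- The operator `∇₁E`. -/
noncomputable def nablaEuler (a : Fin 6 → 𝕜) (u v : Fin 3 → 𝕜) : Fin 3 → 𝕜 :=
  v + christoffelL 𝕜 a v u

/-- This says that ∇₁E is ∇₁-parallel, that is, E is affine in flat coordinates of ∇₁. It allows ∇₁E
to be pulled out of covariant derivatives in the curvature of ∇₂. -/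
theorem SixFunctions.IsSolutionOn.nablaEuler_parallel {F : SixFunctions 𝕜} {D : Set 𝕜}
    (h : F.IsSolutionOn D) {u : Fin 3 → 𝕜} (hu : u ∈ modelRegion D) (x v : Fin 3 → 𝕜) :
    christoffelL 𝕜 (fderiv 𝕜 F.coefficients u x) v u + christoffelL 𝕜 (F.coefficients u) v x
      + christoffelL 𝕜 (F.coefficients u) x (nablaEuler (F.coefficients u) u v)
      = nablaEuler (F.coefficients u) u (christoffelL 𝕜 (F.coefficients u) x v) := by
  have hd := (h.hasFDerivAt_coefficients hu).2
  have hu1 := hu.2.1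
  -- The last component of E is not a function of z alone and has to be rewritten as z times u 1.
  have hz : u 2 = u 2 / u 1 * u 1 := (div_mul_cancel₀ _ hu1).symm
  simp only [hd, SixFunctions.coefficients, nablaEuler]
  generalize u 2 / u 1 = z at *
  generalize F.F1 z = F1, F.F2 z = F2, F.F3 z = F3, F.F4 z = F4, F.F5 z = F5, F.F6 z = F6
  ext i
  fin_cases i <;> simp [christoffelL_apply, hz, Matrix.vecHead, Matrix.vecTail] <;> field_simp <;> ring

/-- Symmetry in x and v of ∇₁_x(v * w) + v * ∇₁E(x * w) - v * ∇₁_x w at the level of Christoffel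
symbols. It is purely algebraic and holds for any six coefficients; it is used both for the flatness
of ∇₂ and for its compatibility with the dual product. -/
theorem nablaEuler_dual (a : Fin 6 → 𝕜) {u : Fin 3 → 𝕜} (hu : u 0 ≠ 0) (x v w : Fin 3 → 𝕜) :
    christoffelL 𝕜 a x (jetMulL 𝕜 (jetMulL 𝕜 v w) (jetInv u))
      + jetMulL 𝕜 (jetMulL 𝕜 v (jetInv u))
        (nablaEuler a u (jetMulL 𝕜 (jetMulL 𝕜 x w) (jetInv u)))
      - jetMulL 𝕜 (jetMulL 𝕜 v (jetInv u)) (christoffelL 𝕜 a x w) =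
    christoffelL 𝕜 a v (jetMulL 𝕜 (jetMulL 𝕜 x w) (jetInv u))
      + jetMulL 𝕜 (jetMulL 𝕜 x (jetInv u))
        (nablaEuler a u (jetMulL 𝕜 (jetMulL 𝕜 v w) (jetInv u)))
      - jetMulL 𝕜 (jetMulL 𝕜 x (jetInv u)) (christoffelL 𝕜 a v w) := by
  ext i
  fin_cases i <;> simp [christoffelL_apply, jetMulL_apply, jetInv, nablaEuler] <;>
    field_simp <;> ring

end FlatModel

/-! ### The model structure of a solution and its flat connections. -/

section FlatModel

variable {𝕜 : Type*} [RCLike 𝕜]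

variable (𝕜) in
/-- `v ↦ (w ↦ v ∘ w ∘ ρ)` as a continuous bilinear map. -/
noncomputable def jetMul₃ (ρ : Fin 3 → 𝕜) : (Fin 3 → 𝕜) →L[𝕜] (Fin 3 → 𝕜) →L[𝕜] Fin 3 → 𝕜 :=
  (ContinuousLinearMap.compL 𝕜 (Fin 3 → 𝕜) (Fin 3 → 𝕜) (Fin 3 → 𝕜) ((jetMulL 𝕜).flip ρ)).comp
    (jetMulL 𝕜)

namespace SixFunctions

/-- The Christoffel map of `∇₁`. -/
noncomputable def christoffel₁ (F : SixFunctions 𝕜) (u : Fin 3 → 𝕜) :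
    (Fin 3 → 𝕜) →L[𝕜] (Fin 3 → 𝕜) →L[𝕜] Fin 3 → 𝕜 :=
  christoffelL 𝕜 (F.coefficients u)

/-- The operator `∇₁E` as a continuous linear map. -/
noncomputable def nablaEulerL (F : SixFunctions 𝕜) (u : Fin 3 → 𝕜) :
    (Fin 3 → 𝕜) →L[𝕜] Fin 3 → 𝕜 :=
  ContinuousLinearMap.id 𝕜 (Fin 3 → 𝕜) + (F.christoffel₁ u).flip u

theorem nablaEulerL_apply (F : SixFunctions 𝕜) (u v : Fin 3 → 𝕜) :
    F.nablaEulerL u v = nablaEuler (F.coefficients u) u v := rfl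

/-- The Christoffel map of `∇₂`. -/
noncomputable def christoffel₂ (F : SixFunctions 𝕜) (u : Fin 3 → 𝕜) :
    (Fin 3 → 𝕜) →L[𝕜] (Fin 3 → 𝕜) →L[𝕜] Fin 3 → 𝕜 :=
  F.christoffel₁ u - (ContinuousLinearMap.compL 𝕜 (Fin 3 → 𝕜) (Fin 3 → 𝕜) (Fin 3 → 𝕜)
    (F.nablaEulerL u)).comp (jetMul₃ 𝕜 (jetInv u))

theorem christoffel₂_apply (F : SixFunctions 𝕜) (u v w : Fin 3 → 𝕜) :
    F.christoffel₂ u v w =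
      F.christoffel₁ u v w - F.nablaEulerL u (jetMulL 𝕜 (jetMulL 𝕜 v w) (jetInv u)) := rfl

/-- The data of the bi-flat structure with normal form `F` on the model region. -/
noncomputable def model (F : SixFunctions 𝕜) : BiFlatData 𝕜 (Fin 3 → 𝕜) where
  mul := jetProduct 𝕜 fun _ => Pi.single 0 1
  dual := jetProduct 𝕜 jetInv
  e := fun _ => (Pi.single 0 1 : Fin 3 → 𝕜)
  E := fun u => u
  cov1 := connectionOf F.christoffel₁
  cov2 := connectionOf F.christoffel₂

variable {F : SixFunctions 𝕜} {D : Set 𝕜}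

theorem contDiffOn_christoffel₁ (hD : IsOpen D) (h : F.IsSolutionOn D) :
    _root_.ContDiffOn 𝕜 ∞ F.christoffel₁ (modelRegion D) :=
  have hL : ContDiff 𝕜 ∞ fun a => christoffelL 𝕜 a := by fun_prop
  hL.comp_contDiffOn (h.contDiffOn_coefficients hD)

theorem contDiffOn_nablaEulerL (hD : IsOpen D) (h : F.IsSolutionOn D) :
    _root_.ContDiffOn 𝕜 ∞ F.nablaEulerL (modelRegion D) :=
  contDiffOn_clm_apply.2 fun _ => contDiffOn_const.add
    (((contDiffOn_christoffel₁ hD h).clm_apply contDiffOn_const).clm_apply contDiffOn_id)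

theorem contDiffOn_jetInv_modelRegion : _root_.ContDiffOn 𝕜 ∞ jetInv (modelRegion D) :=
  contDiffOn_jetInv.mono fun _ hu => hu.1

theorem contDiffOn_christoffel₂ (hD : IsOpen D) (h : F.IsSolutionOn D) :
    _root_.ContDiffOn 𝕜 ∞ F.christoffel₂ (modelRegion D) :=
  contDiffOn_clm_apply.2 fun _ => contDiffOn_clm_apply.2 fun _ =>
    (((contDiffOn_christoffel₁ hD h).clm_apply contDiffOn_const).clm_apply
      contDiffOn_const).sub ((contDiffOn_nablaEulerL hD h).clm_apply
        (contDiffOn_jetMulL contDiffOn_const contDiffOn_jetInv_modelRegion))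

theorem _root_.isOpen_modelRegion (hD : IsOpen D) : IsOpen (modelRegion D) := by
  have h1 : IsOpen {u : Fin 3 → 𝕜 | u 0 ≠ 0} := isOpen_ne_fun (by fun_prop) (by fun_prop)
  have h2 : IsOpen {u : Fin 3 → 𝕜 | u 1 ≠ 0} := isOpen_ne_fun (by fun_prop) (by fun_prop)
  have hz : ContinuousOn (fun u : Fin 3 → 𝕜 => u 2 / u 1) {u : Fin 3 → 𝕜 | u 1 ≠ 0} :=
    ContinuousOn.div (by fun_prop) (by fun_prop) fun u hu => hu
  exact h1.inter (hz.isOpen_inter_preimage h2 hD)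

theorem fderiv_christoffel₁ (h : F.IsSolutionOn D) {u : Fin 3 → 𝕜} (hu : u ∈ modelRegion D)
    (x : Fin 3 → 𝕜) :
    fderiv 𝕜 F.christoffel₁ u x = christoffelL 𝕜 (fderiv 𝕜 F.coefficients u x) := by
  have hL : HasFDerivAt (fun a => christoffelL 𝕜 a) (christoffelL 𝕜) (F.coefficients u) := by
    apply ContinuousLinearMap.hasFDerivAt
  have := HasFDerivAt.comp (E := Fin 3 → 𝕜) (F := Fin 6 → 𝕜)
    (G := (Fin 3 → 𝕜) →L[𝕜] (Fin 3 → 𝕜) →L[𝕜] Fin 3 → 𝕜) u hL (h.hasFDerivAt_coefficients hu).1.hasFDerivAt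
  exact congrArg (fun L : (Fin 3 → 𝕜) →L[𝕜] (Fin 3 → 𝕜) →L[𝕜] (Fin 3 → 𝕜) →L[𝕜] Fin 3 → 𝕜 =>
    L x) this.fderiv

theorem fderiv_nablaEulerL (hD : IsOpen D) (h : F.IsSolutionOn D) {u : Fin 3 → 𝕜}
    (hu : u ∈ modelRegion D) (x v : Fin 3 → 𝕜) :
    fderiv 𝕜 F.nablaEulerL u x v =
      christoffelL 𝕜 (fderiv 𝕜 F.coefficients u x) v u
        + christoffelL 𝕜 (F.coefficients u) v x := by
  have hmem := (isOpen_modelRegion hD).mem_nhds hu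
  have d1 : DifferentiableAt 𝕜 F.christoffel₁ u :=
    ((contDiffOn_christoffel₁ hD h).differentiableOn (by simp)).differentiableAt hmem
  have dS : DifferentiableAt 𝕜 F.nablaEulerL u :=
    ((contDiffOn_nablaEulerL hD h).differentiableOn (by simp)).differentiableAt hmem
  have e1 := (dS.hasFDerivAt.clm_apply (hasFDerivAt_const v u)).fderiv
  have e2 := ((hasFDerivAt_const v u).add ((d1.hasFDerivAt.clm_apply
    (hasFDerivAt_const v u)).clm_apply (hasFDerivAt_id u))).fderiv
  have e3 := congrArg (fun L : (Fin 3 → 𝕜) →L[𝕜] Fin 3 → 𝕜 => L x) (e1.symm.trans e2)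
  simpa [fderiv_christoffel₁ h hu, christoffel₁, add_comm] using e3

theorem fderiv_christoffel₂ (hD : IsOpen D) (h : F.IsSolutionOn D) {u : Fin 3 → 𝕜}
    (hu : u ∈ modelRegion D) (x v w : Fin 3 → 𝕜) :
    fderiv 𝕜 F.christoffel₂ u x v w =
      christoffelL 𝕜 (fderiv 𝕜 F.coefficients u x) v w
        - (fderiv 𝕜 F.nablaEulerL u x (jetMulL 𝕜 (jetMulL 𝕜 v w) (jetInv u))
        - F.nablaEulerL u (jetMulL 𝕜 (jetMulL 𝕜 v w)
          (jetMulL 𝕜 (jetMulL 𝕜 (jetInv u) (jetInv u)) x))) := by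
  have hmem := (isOpen_modelRegion hD).mem_nhds hu
  have d1 : DifferentiableAt 𝕜 F.christoffel₁ u :=
    ((contDiffOn_christoffel₁ hD h).differentiableOn (by simp)).differentiableAt hmem
  have dS : DifferentiableAt 𝕜 F.nablaEulerL u :=
    ((contDiffOn_nablaEulerL hD h).differentiableOn (by simp)).differentiableAt hmem
  have d2 : DifferentiableAt 𝕜 F.christoffel₂ u :=
    ((contDiffOn_christoffel₂ hD h).differentiableOn (by simp)).differentiableAt hmem
  have dI : DifferentiableAt 𝕜 jetInv u :=
    (contDiffOn_jetInv_modelRegion.differentiableOn (by simp)).differentiableAt hmem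
  have e1 := ((d2.hasFDerivAt.clm_apply (hasFDerivAt_const v u)).clm_apply
    (hasFDerivAt_const w u)).fderiv
  have e2 := (((d1.hasFDerivAt.clm_apply (hasFDerivAt_const v u)).clm_apply
    (hasFDerivAt_const w u)).sub (dS.hasFDerivAt.clm_apply
      ((jetMulL 𝕜 (jetMulL 𝕜 v w)).hasFDerivAt.comp u dI.hasFDerivAt))).fderiv
  have e3 := congrArg (fun L : (Fin 3 → 𝕜) →L[𝕜] Fin 3 → 𝕜 => L x) (e1.symm.trans e2)
  simp [fderiv_christoffel₁ h hu, fderiv_jetInv hu.1] at e3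
  rw [e3]
  abel

theorem christoffel₂_comm (u v w : Fin 3 → 𝕜) : F.christoffel₂ u v w = F.christoffel₂ u w v := by
  rw [christoffel₂_apply, christoffel₂_apply, christoffel₁, christoffelL_comm, jetMulL_comm v w]

theorem IsSolutionOn.isFlatConnectionOn₁ (hD : IsOpen D) (h : F.IsSolutionOn D) :
    IsFlatConnectionOn (connectionOf F.christoffel₁) (modelRegion D) := by
  refine isFlatConnectionOn_connectionOf (contDiffOn_christoffel₁ hD h)
    (fun _ _ _ _ => christoffelL_comm _ _ _) fun u hu x v w => ?_
  rw [fderiv_christoffel₁ h hu, fderiv_christoffel₁ h hu]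
  exact h.curvature hu x v w

/-- Let S = ∇₁E, so that ∇₂ = ∇₁ - S(X * Y). As S is parallel, the curvature of ∇₂ is that of ∇₁
minus S applied to the difference of the two sides of `nablaEuler_dual`; the remaining terms, from
the derivative of E⁻¹ and from Christoffel symbols in x and v, are symmetric in x and v. -/
theorem IsSolutionOn.isFlatConnectionOn₂ (hD : IsOpen D) (h : F.IsSolutionOn D) :
    IsFlatConnectionOn (connectionOf F.christoffel₂) (modelRegion D) := by
  refine isFlatConnectionOn_connectionOf (contDiffOn_christoffel₂ hD h)
    (fun _ _ _ _ => christoffel₂_comm _ _ _) fun u hu x v w => ?_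
  have hR := h.curvature hu x v w
  have hP : ∀ x v, _ := fun x v => h.nablaEuler_parallel hu x v
  have hT := congrArg (F.nablaEulerL u) (nablaEuler_dual (F.coefficients u) hu.1 x v w)
  rw [fderiv_christoffel₂ hD h hu, fderiv_christoffel₂ hD h hu, fderiv_nablaEulerL hD h hu,
    fderiv_nablaEulerL hD h hu]
  simp only [christoffel₂_apply, christoffel₁, ← nablaEulerL_apply] at hP hT ⊢
  have hPx := hP x (jetMulL 𝕜 (jetMulL 𝕜 v w) (jetInv u))
  have hPv := hP v (jetMulL 𝕜 (jetMulL 𝕜 x w) (jetInv u))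
  rw [← eq_sub_iff_add_eq] at hPx hPv
  rw [hPx, hPv]
  have hc : jetMulL 𝕜 (jetMulL 𝕜 v w) (jetMulL 𝕜 (jetMulL 𝕜 (jetInv u) (jetInv u)) x) =
      jetMulL 𝕜 (jetMulL 𝕜 x w) (jetMulL 𝕜 (jetMulL 𝕜 (jetInv u) (jetInv u)) v) := by
    simp only [jetMulL_comm, jetMulL_left_comm]
  have hm : ∀ a b, jetMulL 𝕜 (jetMulL 𝕜 a b) (jetInv u) = jetMulL 𝕜 (jetMulL 𝕜 a (jetInv u)) b :=
    fun a b => by simp only [jetMulL_comm, jetMulL_left_comm]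
  rw [hc]
  simp only [map_sub, map_add, sub_apply] at hR hP hT ⊢
  rw [hm x (christoffelL 𝕜 (F.coefficients u) v w), hm v (christoffelL 𝕜 (F.coefficients u) x w),
    hm x (F.nablaEulerL u _), hm v (F.nablaEulerL u _)]
  rw [← sub_eq_zero] at hT
  have hsum := congrArg₂ (· - ·) hR hT
  simp only [sub_zero] at hsum
  rw [← hsum]
  abel

end SixFunctions

end FlatModel

/-! ### The model is a bi-flat structure in normal form. -/

section FlatModel

variable {𝕜 : Type*} [RCLike 𝕜]

/-- ∇c is a tensor: by the Leibniz rule the derivatives of Y and Z drop out. -/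
theorem connectionOf_derivProduct
    {G : (Fin 3 → 𝕜) → (Fin 3 → 𝕜) →L[𝕜] (Fin 3 → 𝕜) →L[𝕜] Fin 3 → 𝕜}
    {ρ X Y Z : (Fin 3 → 𝕜) → Fin 3 → 𝕜} {x κ : Fin 3 → 𝕜}
    (hρ : DifferentiableAt 𝕜 ρ x) (hκ : ∀ v, fderiv 𝕜 ρ x v = jetMulL 𝕜 κ v)
    (hY : DifferentiableAt 𝕜 Y x) (hZ : DifferentiableAt 𝕜 Z x) :
    ((connectionOf G).derivProduct (jetProduct 𝕜 ρ) X Y Z x : Fin 3 → 𝕜) =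
      jetMulL 𝕜 (jetMulL 𝕜 (Y x) (Z x)) (jetMulL 𝕜 κ (X x))
        + G x (X x) (jetMulL 𝕜 (jetMulL 𝕜 (Y x) (Z x)) (ρ x))
        - jetMulL 𝕜 (jetMulL 𝕜 (G x (X x) (Y x)) (Z x)) (ρ x)
        - jetMulL 𝕜 (jetMulL 𝕜 (Y x) (G x (X x) (Z x))) (ρ x) := by
  have key : fderiv 𝕜 (fun y => jetMulL 𝕜 (jetMulL 𝕜 (Y y) (Z y)) (ρ y)) x (X x)
        + G x (X x) (jetMulL 𝕜 (jetMulL 𝕜 (Y x) (Z x)) (ρ x))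
        - jetMulL 𝕜 (jetMulL 𝕜 (fderiv 𝕜 Y x (X x) + G x (X x) (Y x)) (Z x)) (ρ x)
        - jetMulL 𝕜 (jetMulL 𝕜 (Y x) (fderiv 𝕜 Z x (X x) + G x (X x) (Z x))) (ρ x) =
      jetMulL 𝕜 (jetMulL 𝕜 (Y x) (Z x)) (jetMulL 𝕜 κ (X x))
        + G x (X x) (jetMulL 𝕜 (jetMulL 𝕜 (Y x) (Z x)) (ρ x))
        - jetMulL 𝕜 (jetMulL 𝕜 (G x (X x) (Y x)) (Z x)) (ρ x)
        - jetMulL 𝕜 (jetMulL 𝕜 (Y x) (G x (X x) (Z x))) (ρ x) := by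
    rw [fderiv_jetMulL (differentiableAt_jetMulL hY hZ) hρ, fderiv_jetMulL hY hZ, hκ]
    simp only [map_add, add_apply]
    abel
  exact key

namespace SixFunctions

variable {F : SixFunctions 𝕜} {D : Set 𝕜}

theorem IsSolutionOn.isFlatFManifoldOn₁ (hD : IsOpen D) (h : F.IsSolutionOn D) :
    IsFlatFManifoldOn F.model.mul F.model.cov1 F.model.e (modelRegion D) where
  fmanifold := isFManifoldOn_jetProduct (κ := 0) contDiffOn_const contDiffOn_const (by simp)
    fun _ _ => jetMulL_single_zero _
  connection := h.isFlatConnectionOn₁ hD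
  compatible := fun U hUs hU (X Y Z : (Fin 3 → 𝕜) → Fin 3 → 𝕜) hX hY hZ x hx => by
    have hd : ∀ {X : (Fin 3 → 𝕜) → Fin 3 → 𝕜}, _root_.ContDiffOn 𝕜 ∞ X U → DifferentiableAt 𝕜 X x :=
      fun h => (h.differentiableOn (by simp)).differentiableAt (hU.mem_nhds hx)
    have dX := hd (smoothField_iff_contDiffOn.1 hX)
    have dY := hd (smoothField_iff_contDiffOn.1 hY)
    have dZ := hd (smoothField_iff_contDiffOn.1 hZ)
    refine (connectionOf_derivProduct (κ := 0) (differentiableAt_const _) (by simp) dY dZ).trans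
      (Eq.trans ?_ (connectionOf_derivProduct (κ := 0) (differentiableAt_const _) (by simp)
        dX dZ).symm)
    have h1 := christoffelL_compatible (F.coefficients x) (X x) (Y x) (Z x)
    simp only [jetMulL_single_zero, map_zero, zero_apply, zero_add, christoffel₁]
    rw [christoffelL_comm _ (X x) (Y x), sub_right_comm, h1, sub_right_comm]
  flat_unit := fun x _ (v : Fin 3 → 𝕜) => by
    have : fderiv 𝕜 (fun _ : Fin 3 → 𝕜 => (Pi.single 0 1 : Fin 3 → 𝕜)) x v
        + christoffelL 𝕜 (F.coefficients x) v (Pi.single 0 1) = 0 := by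
      ext i; fin_cases i <;> simp [christoffelL_apply]
    exact this

/-- `∇₂ c*` is symmetric. -/
theorem christoffel₂_compatible (F : SixFunctions 𝕜) {x : Fin 3 → 𝕜} (hx : x 0 ≠ 0)
    (X Y Z : Fin 3 → 𝕜) :
    jetMulL 𝕜 (jetMulL 𝕜 Y Z) (jetMulL 𝕜 (-jetMulL 𝕜 (jetInv x) (jetInv x)) X)
        + F.christoffel₂ x X (jetMulL 𝕜 (jetMulL 𝕜 Y Z) (jetInv x))
        - jetMulL 𝕜 (jetMulL 𝕜 (F.christoffel₂ x X Y) Z) (jetInv x)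
        - jetMulL 𝕜 (jetMulL 𝕜 Y (F.christoffel₂ x X Z)) (jetInv x) =
      jetMulL 𝕜 (jetMulL 𝕜 X Z) (jetMulL 𝕜 (-jetMulL 𝕜 (jetInv x) (jetInv x)) Y)
        + F.christoffel₂ x Y (jetMulL 𝕜 (jetMulL 𝕜 X Z) (jetInv x))
        - jetMulL 𝕜 (jetMulL 𝕜 (F.christoffel₂ x Y X) Z) (jetInv x)
        - jetMulL 𝕜 (jetMulL 𝕜 X (F.christoffel₂ x Y Z)) (jetInv x) := by
  have hT := nablaEuler_dual (F.coefficients x) hx X Y Z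
  rw [christoffel₂_comm x Y X]
  simp only [christoffel₂_apply, christoffel₁, ← nablaEulerL_apply] at hT ⊢
  have hm : ∀ a b, jetMulL 𝕜 (jetMulL 𝕜 a b) (jetInv x) = jetMulL 𝕜 (jetMulL 𝕜 a (jetInv x)) b :=
    fun a b => by simp only [jetMulL_comm, jetMulL_left_comm]
  have e1 : ∀ κ, jetMulL 𝕜 (jetMulL 𝕜 Y Z) (jetMulL 𝕜 κ X) =
      jetMulL 𝕜 (jetMulL 𝕜 X Z) (jetMulL 𝕜 κ Y) := fun κ => by
    simp only [jetMulL_comm, jetMulL_left_comm]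
  have e2 : jetMulL 𝕜 X (jetMulL 𝕜 (jetMulL 𝕜 Y Z) (jetInv x)) =
      jetMulL 𝕜 Y (jetMulL 𝕜 (jetMulL 𝕜 X Z) (jetInv x)) := by
    simp only [jetMulL_comm, jetMulL_left_comm]
  rw [e1, e2, ← sub_eq_zero]
  rw [← sub_eq_zero] at hT
  rw [← hT]
  simp only [map_sub, sub_apply]
  rw [hm Y (christoffelL 𝕜 _ X Z), hm X (christoffelL 𝕜 _ Y Z), hm Y (F.nablaEulerL x _),
    hm X (F.nablaEulerL x _)]
  abel

theorem IsSolutionOn.isFlatFManifoldOn₂ (hD : IsOpen D) (h : F.IsSolutionOn D) :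
    IsFlatFManifoldOn F.model.dual F.model.cov2 F.model.E (modelRegion D) where
  fmanifold := isFManifoldOn_jetProduct (κ := fun x => -jetMulL 𝕜 (jetInv x) (jetInv x))
    contDiffOn_jetInv_modelRegion contDiffOn_id (fun x hx v => fderiv_jetInv hx.1 v)
    fun _ hx => jetMulL_jetInv hx.1
  connection := h.isFlatConnectionOn₂ hD
  compatible := fun U hUs hU (X Y Z : (Fin 3 → 𝕜) → Fin 3 → 𝕜) hX hY hZ x hx => by
    have hd : ∀ {X : (Fin 3 → 𝕜) → Fin 3 → 𝕜}, _root_.ContDiffOn 𝕜 ∞ X U → DifferentiableAt 𝕜 X x :=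
      fun h => (h.differentiableOn (by simp)).differentiableAt (hU.mem_nhds hx)
    have dX := hd (smoothField_iff_contDiffOn.1 hX)
    have dY := hd (smoothField_iff_contDiffOn.1 hY)
    have dZ := hd (smoothField_iff_contDiffOn.1 hZ)
    have dI := hd ((contDiffOn_jetInv_modelRegion (D := D)).mono hUs)
    have hx0 := (hUs hx).1
    refine (connectionOf_derivProduct dI (fderiv_jetInv hx0) dY dZ).trans
      (Eq.trans ?_ (connectionOf_derivProduct dI (fderiv_jetInv hx0) dX dZ).symm)
    exact christoffel₂_compatible F hx0 (X x) (Y x) (Z x)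
  -- E is the unit of *, so ∇₂_v E = ∇₁_v E - ∇₁_{v * E} E vanishes.
  flat_unit := fun x hx (v : Fin 3 → 𝕜) => by
    have : fderiv 𝕜 (fun u : Fin 3 → 𝕜 => u) x v + F.christoffel₂ x v x = 0 := by
      rw [christoffel₂_apply, jetMulL_assoc, jetMulL_jetInv hx.1, jetMulL_single_zero,
        nablaEulerL_apply, nablaEuler, fderiv_fun_id]
      simp [christoffel₁]
    exact this

theorem cov1_eq_cov2_add (F : SixFunctions 𝕜) (Y : (Fin 3 → 𝕜) → Fin 3 → 𝕜) (x v : Fin 3 → 𝕜) :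
    fderiv 𝕜 Y x v + F.christoffel₁ x v (Y x) = (fderiv 𝕜 Y x v + F.christoffel₂ x v (Y x))
      + F.nablaEulerL x (jetMulL 𝕜 (jetMulL 𝕜 v (Y x)) (jetInv x)) := by
  rw [christoffel₂_apply]; abel

/-- ∇₁ - ∇₂ is ∇₁E applied to the dual product, so the difference of the exterior derivatives on (Y,
Z) is ∇₁E of Y * (X · Z) - Z * (X · Y), which is zero by commutativity whatever factor ρ the product
X · Z = X ∘ Z ∘ ρ has. -/
theorem extD_eq (F : SixFunctions 𝕜) (ρ X Y Z : (Fin 3 → 𝕜) → Fin 3 → 𝕜) (x : Fin 3 → 𝕜) :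
    ((connectionOf F.christoffel₁).extD (jetProduct 𝕜 ρ) X Y Z x : Fin 3 → 𝕜) =
      (connectionOf F.christoffel₂).extD (jetProduct 𝕜 ρ) X Y Z x := by
  have key : ∀ a b a' b' c : Fin 3 → 𝕜,
      a = a' + F.nablaEulerL x (jetMulL 𝕜 (jetMulL 𝕜 (Y x)
        (jetMulL 𝕜 (jetMulL 𝕜 (X x) (Z x)) (ρ x))) (jetInv x)) →
      b = b' + F.nablaEulerL x (jetMulL 𝕜 (jetMulL 𝕜 (Z x)
        (jetMulL 𝕜 (jetMulL 𝕜 (X x) (Y x)) (ρ x))) (jetInv x)) → a - b - c = a' - b' - c := by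
    rintro a b a' b' c rfl rfl
    have : jetMulL 𝕜 (jetMulL 𝕜 (Y x) (jetMulL 𝕜 (jetMulL 𝕜 (X x) (Z x)) (ρ x))) (jetInv x) =
        jetMulL 𝕜 (jetMulL 𝕜 (Z x) (jetMulL 𝕜 (jetMulL 𝕜 (X x) (Y x)) (ρ x))) (jetInv x) := by
      simp only [jetMulL_comm, jetMulL_left_comm]
    rw [this]
    abel
  exact key _ _ _ _ _ (F.cov1_eq_cov2_add (fun y => jetMulL 𝕜 (jetMulL 𝕜 (X y) (Z y)) (ρ y)) x (Y x))
    (F.cov1_eq_cov2_add (fun y => jetMulL 𝕜 (jetMulL 𝕜 (X y) (Y y)) (ρ y)) x (Z x))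

theorem IsSolutionOn.isBiFlatOn_model (hD : IsOpen D) (h : F.IsSolutionOn D) :
    IsBiFlatOn F.model (modelRegion D) where
  flat1 := h.isFlatFManifoldOn₁ hD
  dual_eq := by
    refine ⟨(jetInv : (Fin 3 → 𝕜) → Fin 3 → 𝕜),
      smoothField_iff_contDiffOn.2 contDiffOn_jetInv_modelRegion, fun x hx => ⟨?_, ?_⟩⟩
    · have : jetMulL 𝕜 (jetMulL 𝕜 x (jetInv x)) (Pi.single 0 1) = Pi.single 0 1 := by
        rw [jetMulL_jetInv hx.1, jetMulL_single_zero]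
      exact this
    · intro (v : Fin 3 → 𝕜) (w : Fin 3 → 𝕜)
      have : jetMulL 𝕜 (jetMulL 𝕜 v w) (jetInv x) = jetMulL 𝕜 (jetMulL 𝕜
          (jetMulL 𝕜 (jetMulL 𝕜 v w) (Pi.single 0 1)) (jetInv x)) (Pi.single 0 1) := by
        rw [jetMulL_single_zero, jetMulL_single_zero]
      exact this
  euler := fun x _ => by
    refine (lieB_apply (fun _ => (Pi.single 0 1 : Fin 3 → 𝕜)) (fun u => u) x).trans ?_
    rw [fderiv_fun_id, fderiv_fun_const]
    exact sub_zero _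
  flat2 := h.isFlatFManifoldOn₂ hD
  hydro_mul := fun _ _ _ X Y Z _ _ _ x _ => F.extD_eq _ X Y Z x
  hydro_dual := fun _ _ _ X Y Z _ _ _ x _ => F.extD_eq _ X Y Z x

theorem IsSolutionOn.isRegularBiFlatOneBlockOn_model (hD : IsOpen D) (h : F.IsSolutionOn D) :
    IsRegularBiFlatOneBlockOn F.model (modelRegion D) := by
  refine ⟨h.isBiFlatOn_model hD, fun x hx => ?_⟩
  have e : ((jetMul 𝕜).compr₂ ((jetMul 𝕜).flip (Pi.single 0 1))) x = jetMul 𝕜 x :=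
    LinearMap.ext fun v => jetMulL_single_zero _
  have := singleJordanBlock_jetMul hx.2.1
  rw [← e] at this
  exact this

theorem _root_.coordField_refl (i : Fin 3) (q : Fin 3 → 𝕜) :
    (coordField (𝕜 := 𝕜) (OpenPartialHomeomorph.refl (Fin 3 → 𝕜)) i q : Fin 3 → 𝕜) =
      Pi.single i 1 := by
  have h1 : mfderiv (I3 𝕜) (I3 𝕜) (OpenPartialHomeomorph.refl (Fin 3 → 𝕜)) q =
      ContinuousLinearMap.id 𝕜 (TangentSpace (I3 𝕜) q) := mfderiv_id
  refine (congrArg (fun L : (Fin 3 → 𝕜) →L[𝕜] Fin 3 → 𝕜 => L.inverse (Pi.single i 1)) h1).trans ?_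
  have h2 : (ContinuousLinearMap.id 𝕜 (Fin 3 → 𝕜)).inverse (Pi.single i 1) = Pi.single i 1 := by
    rw [ContinuousLinearMap.inverse_id]; rfl
  exact h2

theorem hasNormalFormOn_model (F : SixFunctions 𝕜) (D : Set 𝕜) :
    HasNormalFormOn F.model (OpenPartialHomeomorph.refl (Fin 3 → 𝕜)) (modelRegion D) F D := by
  have hc : ∀ i, coordField (𝕜 := 𝕜) (OpenPartialHomeomorph.refl (Fin 3 → 𝕜)) i =
      fun _ => (Pi.single i 1 : Fin 3 → 𝕜) := fun i => funext fun q => coordField_refl i q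
  have hcov : ∀ (G : (Fin 3 → 𝕜) → (Fin 3 → 𝕜) →L[𝕜] (Fin 3 → 𝕜) →L[𝕜] Fin 3 → 𝕜)
      (q : Fin 3 → 𝕜) (j k : Fin 3),
      (connectionOf G (fun _ => (Pi.single k 1 : Fin 3 → 𝕜)) q (Pi.single j 1 : Fin 3 → 𝕜) :
        Fin 3 → 𝕜) = G q (Pi.single j 1) (Pi.single k 1) := fun G q j k => by
    have : fderiv 𝕜 (fun _ : Fin 3 → 𝕜 => (Pi.single k 1 : Fin 3 → 𝕜)) q (Pi.single j 1)
        + G q (Pi.single j 1) (Pi.single k 1) = G q (Pi.single j 1) (Pi.single k 1) := by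
      simp
    exact this
  have hsum : ∀ v : Fin 3 → 𝕜, ∑ i, v i • (Pi.single i 1 : Fin 3 → 𝕜) = v := fun v => by
    ext i
    simp [Finset.sum_apply, Pi.single_apply]
  constructor
  · exact fun q hq => ⟨hq.1, hq.2.1⟩
  · exact fun q hq => hq.2.2
  · intro q _
    rw [hc]
    rfl
  · intro q _
    simp only [hc]
    exact (hsum q).symm
  · intro q _ i j
    simp only [hc]
    have : jetMulL 𝕜 (jetMulL 𝕜 (Pi.single i 1) (Pi.single j 1)) (Pi.single 0 1) =
        if h : i.val + j.val < 3 then (Pi.single ⟨i.val + j.val, h⟩ 1 : Fin 3 → 𝕜) else 0 := by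
      rw [jetMulL_single_zero]
      ext m
      fin_cases i <;> fin_cases j <;> fin_cases m <;> simp [jetMulL_apply]
    exact this
  · intro q _ j k
    simp only [hc]
    refine (hcov F.christoffel₁ q j k).trans ?_
    exact (christoffelL_coefficients_single F q j k).trans (hsum _).symm
  · intro q _ j k
    simp only [hc]
    refine (hcov F.christoffel₂ q j k).trans ?_
    have e1 : (connectionOf F.christoffel₁ (fun u => u) q (jetMulL 𝕜 (jetMulL 𝕜 (Pi.single j 1)
        (Pi.single k 1)) (jetInv q)) : Fin 3 → 𝕜) = F.nablaEulerL q (jetMulL 𝕜 (jetMulL 𝕜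
          (Pi.single j 1) (Pi.single k 1)) (jetInv q)) := by
      have : ∀ v, fderiv 𝕜 (fun u : Fin 3 → 𝕜 => u) q v + F.christoffel₁ q v q =
          F.nablaEulerL q v := fun v => by rw [fderiv_fun_id]; rfl
      exact this _
    exact (christoffel₂_apply F q _ _).trans (congrArg₂ (fun a b : Fin 3 → 𝕜 => a - b)
      (hcov F.christoffel₁ q j k).symm e1.symm)

end SixFunctions

end FlatModel

/-! ### Vector fields in local coordinates. -/

section Transfer

variable {𝕜 : Type*} [RCLike 𝕜] {M : Type*} [TopologicalSpace M] [ChartedSpace (Fin 3 → 𝕜) M]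

/-- The differential of local coordinates. -/
noncomputable def chartD (ψ : OpenPartialHomeomorph M (Fin 3 → 𝕜)) (q : M) :
    TangentSpace (I3 𝕜) q →L[𝕜] (Fin 3 → 𝕜) :=
  mfderiv (I3 𝕜) (I3 𝕜) ψ q

/-- The inverse of the differential of local coordinates. -/
noncomputable def chartDInv (ψ : OpenPartialHomeomorph M (Fin 3 → 𝕜)) (q : M) :
    (Fin 3 → 𝕜) →L[𝕜] TangentSpace (I3 𝕜) q :=
  (mfderiv (I3 𝕜) (I3 𝕜) ψ q).inverse

/-- The vector field on a manifold with given components in local coordinates. -/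
noncomputable def pullField (ψ : OpenPartialHomeomorph M (Fin 3 → 𝕜))
    (X : (Fin 3 → 𝕜) → Fin 3 → 𝕜) : VField 𝕜 M :=
  fun q => chartDInv ψ q (X (ψ q))

/-- The components in local coordinates of a vector field on a manifold. -/
noncomputable def pushField (ψ : OpenPartialHomeomorph M (Fin 3 → 𝕜)) (X : VField 𝕜 M) :
    (Fin 3 → 𝕜) → Fin 3 → 𝕜 :=
  fun y => chartD ψ (ψ.symm y) (X (ψ.symm y))

variable [IsManifold (I3 𝕜) ∞ M] {ψ : OpenPartialHomeomorph M (Fin 3 → 𝕜)}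

theorem isInvertible_mfderiv_of_mem_maximalAtlas (hψ : ψ ∈ IsManifold.maximalAtlas (I3 𝕜) ∞ M)
    {q : M} (hq : q ∈ ψ.source) : (mfderiv (I3 𝕜) (I3 𝕜) ψ q).IsInvertible := by
  have h : ψ.MDifferentiable (I3 𝕜) (I3 𝕜) :=
    ⟨(contMDiffOn_of_mem_maximalAtlas hψ).mdifferentiableOn (by simp),
      (contMDiffOn_symm_of_mem_maximalAtlas hψ).mdifferentiableOn (by simp)⟩
  exact ⟨h.mfderiv hq, rfl⟩

theorem chartD_chartDInv (hψ : ψ ∈ IsManifold.maximalAtlas (I3 𝕜) ∞ M) {q : M}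
    (hq : q ∈ ψ.source) (v : Fin 3 → 𝕜) : chartD ψ q (chartDInv ψ q v) = v := by
  obtain ⟨f, hf⟩ := isInvertible_mfderiv_of_mem_maximalAtlas hψ hq
  rw [chartD, chartDInv, ← hf, ContinuousLinearMap.inverse_equiv]
  exact f.apply_symm_apply v

theorem chartDInv_chartD (hψ : ψ ∈ IsManifold.maximalAtlas (I3 𝕜) ∞ M) {q : M}
    (hq : q ∈ ψ.source) (v : TangentSpace (I3 𝕜) q) : chartDInv ψ q (chartD ψ q v) = v := by
  obtain ⟨f, hf⟩ := isInvertible_mfderiv_of_mem_maximalAtlas hψ hq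
  rw [chartD, chartDInv, ← hf, ContinuousLinearMap.inverse_equiv]
  exact f.symm_apply_apply v

theorem smoothField_pullField (hψ : ψ ∈ IsManifold.maximalAtlas (I3 𝕜) ∞ M)
    {X : (Fin 3 → 𝕜) → Fin 3 → 𝕜} {U : Set (Fin 3 → 𝕜)} (hU : IsOpen U)
    (hX : ContDiffOn 𝕜 ∞ X U) : SmoothField (pullField ψ X) (ψ.source ∩ ψ ⁻¹' U) := fun q hq =>
  (ContMDiffAt.mpullback_vectorField_preimage
    ((smoothField_iff_contDiffOn.2 hX).contMDiffAt (hU.mem_nhds hq.2))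
    (contMDiffAt_of_mem_maximalAtlas hψ hq.1)
    (isInvertible_mfderiv_of_mem_maximalAtlas hψ hq.1) (by simp)).contMDiffWithinAt

theorem mdifferentiableAt_pullField (hψ : ψ ∈ IsManifold.maximalAtlas (I3 𝕜) ∞ M)
    {X : (Fin 3 → 𝕜) → Fin 3 → 𝕜} {q : M} (hq : q ∈ ψ.source)
    (hX : MDifferentiableAt (I3 𝕜) (I3 𝕜).tangent
      (fun y => (⟨y, X y⟩ : TangentBundle (I3 𝕜) (Fin 3 → 𝕜))) (ψ q)) :
    MDifferentiableAt (I3 𝕜) (I3 𝕜).tangent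
      (fun x => (⟨x, pullField ψ X x⟩ : TangentBundle (I3 𝕜) M)) q :=
  MDifferentiableAt.mpullback_vectorField hX (contMDiffAt_of_mem_maximalAtlas hψ hq)
    (isInvertible_mfderiv_of_mem_maximalAtlas hψ hq) ENat.LEInfty.out

theorem mfderiv_symm_inverse (hψ : ψ ∈ IsManifold.maximalAtlas (I3 𝕜) ∞ M) {y : Fin 3 → 𝕜}
    (hy : y ∈ ψ.target) : (mfderiv (I3 𝕜) (I3 𝕜) ψ.symm y).IsInvertible ∧
      (mfderiv (I3 𝕜) (I3 𝕜) ψ.symm y).inverse = chartD ψ (ψ.symm y) := by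
  have h : ψ.MDifferentiable (I3 𝕜) (I3 𝕜) :=
    ⟨(contMDiffOn_of_mem_maximalAtlas hψ).mdifferentiableOn (by simp),
      (contMDiffOn_symm_of_mem_maximalAtlas hψ).mdifferentiableOn (by simp)⟩
  have h1 := h.comp_symm_deriv hy
  have h2 := h.symm_comp_deriv (ψ.map_target hy)
  rw [ψ.right_inv hy] at h2
  exact ⟨.of_inverse h2 h1, ContinuousLinearMap.inverse_eq h2 h1⟩

theorem contDiffOn_pushField (hψ : ψ ∈ IsManifold.maximalAtlas (I3 𝕜) ∞ M) {X : VField 𝕜 M}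
    {U : Set M} (hU : IsOpen U) (hX : SmoothField X U) :
    ContDiffOn 𝕜 ∞ (pushField ψ X) (ψ.target ∩ ψ.symm ⁻¹' U) := by
  refine smoothField_iff_contDiffOn.1 fun y hy => ?_
  have h := ContMDiffAt.mpullback_vectorField_preimage (f := ψ.symm) (m := ∞) (n := ∞)
    (hX.contMDiffAt (hU.mem_nhds hy.2))
    ((contMDiffOn_symm_of_mem_maximalAtlas hψ).contMDiffAt (ψ.open_target.mem_nhds hy.1))
    (mfderiv_symm_inverse hψ hy.1).1 (by simp)
  refine (h.congr_of_eventuallyEq ?_).contMDiffWithinAt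
  filter_upwards [ψ.open_target.mem_nhds hy.1] with z hz
  have := congrArg (fun L : TangentSpace (I3 𝕜) (ψ.symm z) →L[𝕜] (Fin 3 → 𝕜) => L (X (ψ.symm z)))
    (mfderiv_symm_inverse hψ hz).2
  exact congrArg (fun v => (⟨z, v⟩ : TangentBundle (I3 𝕜) (Fin 3 → 𝕜))) this.symm

end Transfer

/-! ### Components of brackets, products and covariant derivatives. -/

section Transfer

variable {𝕜 : Type*} [RCLike 𝕜] {M : Type*} [TopologicalSpace M] [ChartedSpace (Fin 3 → 𝕜) M]

/-- On `U`, the smooth functions `X'` are the components of the vector field `X`. -/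
def Represents (ψ : OpenPartialHomeomorph M (Fin 3 → 𝕜)) (U : Set (Fin 3 → 𝕜)) (X : VField 𝕜 M)
    (X' : (Fin 3 → 𝕜) → Fin 3 → 𝕜) : Prop :=
  ContDiffOn 𝕜 ∞ X' U ∧ ∀ y ∈ U, X (ψ.symm y) = chartDInv ψ (ψ.symm y) (X' y)

/-- A product in local coordinates. -/
noncomputable def pushProduct (ψ : OpenPartialHomeomorph M (Fin 3 → 𝕜)) (c : TProduct 𝕜 M) :
    TProduct 𝕜 (Fin 3 → 𝕜) := fun y =>
  (((c (ψ.symm y)).compl₁₂ (chartDInv ψ (ψ.symm y)).toLinearMap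
    (chartDInv ψ (ψ.symm y)).toLinearMap).compr₂ (chartD ψ (ψ.symm y)).toLinearMap :
      (Fin 3 → 𝕜) →ₗ[𝕜] (Fin 3 → 𝕜) →ₗ[𝕜] Fin 3 → 𝕜)

theorem pushProduct_apply (ψ : OpenPartialHomeomorph M (Fin 3 → 𝕜)) (c : TProduct 𝕜 M)
    (y v w : Fin 3 → 𝕜) : (pushProduct ψ c y v w : Fin 3 → 𝕜) =
      chartD ψ (ψ.symm y) (c (ψ.symm y) (chartDInv ψ (ψ.symm y) v) (chartDInv ψ (ψ.symm y) w)) :=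
  rfl

/-- A connection in local coordinates. -/
noncomputable def pushConnection (ψ : OpenPartialHomeomorph M (Fin 3 → 𝕜))
    (cov : TConnection 𝕜 M) : TConnection 𝕜 (Fin 3 → 𝕜) := fun Y y =>
  ((chartD ψ (ψ.symm y)).comp ((cov (pullField ψ Y) (ψ.symm y)).comp (chartDInv ψ (ψ.symm y))) :
    (Fin 3 → 𝕜) →L[𝕜] Fin 3 → 𝕜)

variable {ψ : OpenPartialHomeomorph M (Fin 3 → 𝕜)} {U : Set (Fin 3 → 𝕜)}
  {X Y Z : VField 𝕜 M} {X' Y' Z' : (Fin 3 → 𝕜) → Fin 3 → 𝕜}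

theorem Represents.add (hX : Represents ψ U X X') (hY : Represents ψ U Y Y') :
    Represents ψ U (X + Y) (X' + Y') :=
  ⟨hX.1.add hY.1, fun y hy => by
    rw [Pi.add_apply, hX.2 y hy, hY.2 y hy, Pi.add_apply, map_add]⟩

theorem Represents.sub (hX : Represents ψ U X X') (hY : Represents ψ U Y Y') :
    Represents ψ U (X - Y) (X' - Y') :=
  ⟨hX.1.sub hY.1, fun y hy => by
    rw [Pi.sub_apply, hX.2 y hy, hY.2 y hy, Pi.sub_apply, map_sub]⟩

theorem represents_pullField (hU : U ⊆ ψ.target) (hX : ContDiffOn 𝕜 ∞ X' U) :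
    Represents ψ U (pullField ψ X') X' :=
  ⟨hX, fun y hy => by rw [pullField, ψ.right_inv (hU hy)]⟩

theorem Represents.eqOn (hX : Represents ψ U X X') {q : M} (hq : q ∈ ψ.source ∩ ψ ⁻¹' U) :
    X q = pullField ψ X' q := by
  obtain ⟨y, hy, rfl⟩ : ∃ y ∈ ψ.target, ψ.symm y = q :=
    ⟨ψ q, ψ.map_source hq.1, ψ.left_inv hq.1⟩
  have hyU : y ∈ U := by have := hq.2; rwa [Set.mem_preimage, ψ.right_inv hy] at this
  rw [hX.2 y hyU, pullField, ψ.right_inv hy]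

variable [IsManifold (I3 𝕜) ∞ M]

/-- The bridge for every axiom: an identity between fields on M and the identity between their
components are equivalent, point by point. -/
theorem Represents.eq_iff (hψ : ψ ∈ IsManifold.maximalAtlas (I3 𝕜) ∞ M) (hU : U ⊆ ψ.target)
    (hX : Represents ψ U X X') (hY : Represents ψ U Y Y') {y : Fin 3 → 𝕜} (hy : y ∈ U) :
    X (ψ.symm y) = Y (ψ.symm y) ↔ X' y = Y' y := by
  rw [hX.2 y hy, hY.2 y hy]
  refine ⟨fun h => ?_, fun h => by rw [h]⟩
  have := congrArg (chartD ψ (ψ.symm y)) h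
  rwa [chartD_chartDInv hψ (ψ.map_target (hU hy)), chartD_chartDInv hψ (ψ.map_target (hU hy))]
    at this

theorem Represents.smoothField (hψ : ψ ∈ IsManifold.maximalAtlas (I3 𝕜) ∞ M) (hU : IsOpen U)
    (hX : Represents ψ U X X') : SmoothField X (ψ.source ∩ ψ ⁻¹' U) :=
  (smoothField_pullField hψ hU hX.1).congr fun q hq => by rw [hX.eqOn hq]

theorem represents_of_smoothField (hψ : ψ ∈ IsManifold.maximalAtlas (I3 𝕜) ∞ M)
    (hU : IsOpen U) (hU' : U ⊆ ψ.target) (hX : SmoothField X (ψ.source ∩ ψ ⁻¹' U))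
    (h : ∀ y ∈ U, X' y = chartD ψ (ψ.symm y) (X (ψ.symm y))) : Represents ψ U X X' := by
  refine ⟨((contDiffOn_pushField hψ (ψ.isOpen_inter_preimage hU) hX).mono fun y hy =>
    ⟨hU' hy, ψ.map_target (hU' hy), ?_⟩).congr h, fun y hy => ?_⟩
  · rwa [Set.mem_preimage, ψ.right_inv (hU' hy)]
  · rw [h y hy, chartDInv_chartD hψ (ψ.map_target (hU' hy))]

theorem represents_pushField (hψ : ψ ∈ IsManifold.maximalAtlas (I3 𝕜) ∞ M)
    (hU : IsOpen U) (hU' : U ⊆ ψ.target) (hX : SmoothField X (ψ.source ∩ ψ ⁻¹' U)) :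
    Represents ψ U X (pushField ψ X) :=
  represents_of_smoothField hψ hU hU' hX fun _ _ => rfl

/-- The bracket depends only on germs, so both fields may be replaced by pullbacks near the point;
pullbacks commute with the bracket. -/
theorem Represents.lie (hψ : ψ ∈ IsManifold.maximalAtlas (I3 𝕜) ∞ M)
    (hU : IsOpen U) (hU' : U ⊆ ψ.target) (hX : Represents ψ U X X') (hY : Represents ψ U Y Y') :
    Represents ψ U (lieB X Y) (lieB (𝕜 := 𝕜) (M := Fin 3 → 𝕜) X' Y') := by
  have hF : ∀ {Z : (Fin 3 → 𝕜) → Fin 3 → 𝕜}, ContDiffOn 𝕜 ∞ Z U → ContDiffOn 𝕜 ∞ (fderiv 𝕜 Z) U :=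
    fun h => ((contDiffOn_infty_iff_fderiv_of_isOpen hU).1 h).2
  refine ⟨(((hF hY.1).clm_apply hX.1).sub ((hF hX.1).clm_apply hY.1)).congr
    fun y _ => lieB_apply X' Y' y, fun y hy => ?_⟩
  have hq := ψ.map_target (hU' hy)
  have hmem : ψ.source ∩ ψ ⁻¹' U ∈ nhds (ψ.symm y) := (ψ.isOpen_inter_preimage hU).mem_nhds
    ⟨hq, by rwa [Set.mem_preimage, ψ.right_inv (hU' hy)]⟩
  have e1 : lieB X Y (ψ.symm y) = lieB (pullField ψ X') (pullField ψ Y') (ψ.symm y) :=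
    Filter.EventuallyEq.mlieBracket_vectorField_eq
      (Filter.mem_of_superset hmem fun q hq => hX.eqOn hq)
      (Filter.mem_of_superset hmem fun q hq => hY.eqOn hq)
  have hm : ∀ {Z : (Fin 3 → 𝕜) → Fin 3 → 𝕜}, ContDiffOn 𝕜 ∞ Z U → MDifferentiableAt (I3 𝕜)
      (I3 𝕜).tangent (fun y => (⟨y, Z y⟩ : TangentBundle (I3 𝕜) (Fin 3 → 𝕜))) (ψ (ψ.symm y)) :=
    fun h => ((smoothField_iff_contDiffOn.2 h).contMDiffAt (hU.mem_nhds (by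
      rwa [ψ.right_inv (hU' hy)]))).mdifferentiableAt (by simp)
  have hs : minSmoothness 𝕜 2 ≤ (∞ : ℕ∞ω) := by
    rw [minSmoothness_of_isRCLikeNormedField]; exact ENat.LEInfty.out
  have : IsManifold (I3 𝕜) (minSmoothness 𝕜 2) M := IsManifold.of_le hs
  have e2 := VectorField.mpullback_mlieBracket (I := I3 𝕜) (f := ψ) (x₀ := ψ.symm y) (hm hX.1)
    (hm hY.1) (contMDiffAt_of_mem_maximalAtlas hψ hq) hs
  have e3 : chartDInv ψ (ψ.symm y) (lieB (𝕜 := 𝕜) (M := Fin 3 → 𝕜) X' Y' (ψ (ψ.symm y))) =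
    lieB (pullField ψ X') (pullField ψ Y') (ψ.symm y) := e2
  rw [e1, ← e3, ψ.right_inv (hU' hy)]

theorem Represents.mul (hψ : ψ ∈ IsManifold.maximalAtlas (I3 𝕜) ∞ M) {c : TProduct 𝕜 M}
    (hc : ∀ X Y : VField 𝕜 M, SmoothField X (ψ.source ∩ ψ ⁻¹' U) →
      SmoothField Y (ψ.source ∩ ψ ⁻¹' U) → SmoothField (c.app X Y) (ψ.source ∩ ψ ⁻¹' U))
    (hU : IsOpen U) (hU' : U ⊆ ψ.target) (hX : Represents ψ U X X') (hY : Represents ψ U Y Y') :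
    Represents ψ U (c.app X Y) ((pushProduct ψ c).app X' Y') :=
  represents_of_smoothField hψ hU hU' (hc X Y (hX.smoothField hψ hU) (hY.smoothField hψ hU))
    fun y hy => by
      have e : c.app X Y (ψ.symm y) = c (ψ.symm y) (chartDInv ψ (ψ.symm y) (X' y))
          (chartDInv ψ (ψ.symm y) (Y' y)) := by rw [TProduct.app, hX.2 y hy, hY.2 y hy]
      exact (congrArg (chartD ψ (ψ.symm y)) e).symm

/-- A covariant derivative depends only on the germ of the differentiated field, so Y may be
replaced by the pullback of its components even though they agree only on the chart. -/
theorem Represents.cov (hψ : ψ ∈ IsManifold.maximalAtlas (I3 𝕜) ∞ M) {cov : TConnection 𝕜 M}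
    (hcov : IsCovariantDerivativeOn (I := I3 𝕜) (Fin 3 → 𝕜) cov (ψ.source ∩ ψ ⁻¹' U))
    (hc : ∀ X Y : VField 𝕜 M, SmoothField X (ψ.source ∩ ψ ⁻¹' U) →
      SmoothField Y (ψ.source ∩ ψ ⁻¹' U) → SmoothField (cov.app X Y) (ψ.source ∩ ψ ⁻¹' U))
    (hU : IsOpen U) (hU' : U ⊆ ψ.target) (hX : Represents ψ U X X') (hY : Represents ψ U Y Y') :
    Represents ψ U (cov.app X Y) ((pushConnection ψ cov).app X' Y') :=
  represents_of_smoothField hψ hU hU' (hc X Y (hX.smoothField hψ hU) (hY.smoothField hψ hU))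
    fun y hy => by
      have hmem : ψ.source ∩ ψ ⁻¹' U ∈ nhds (ψ.symm y) := (ψ.isOpen_inter_preimage hU).mem_nhds
        ⟨ψ.map_target (hU' hy), by rwa [Set.mem_preimage, ψ.right_inv (hU' hy)]⟩
      have e : cov Y (ψ.symm y) = cov (pullField ψ Y') (ψ.symm y) :=
        hcov.congr_of_eqOn (((hY.smoothField hψ hU).contMDiffAt hmem).mdifferentiableAt (by simp))
          (((smoothField_pullField hψ hU hY.1).contMDiffAt hmem).mdifferentiableAt (by simp))
          hmem fun q hq => hY.eqOn hq
      have e' : cov.app X Y (ψ.symm y) = cov (pullField ψ Y') (ψ.symm y)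
          (chartDInv ψ (ψ.symm y) (X' y)) := by rw [TConnection.app, hX.2 y hy, e]
      exact (congrArg (chartD ψ (ψ.symm y)) e').symm

end Transfer

/-! ### Bi-flat structures in local coordinates. -/

section Transfer

variable {𝕜 : Type*} [RCLike 𝕜] {M : Type*} [TopologicalSpace M] [ChartedSpace (Fin 3 → 𝕜) M]

/-- A bi-flat structure in local coordinates. -/
noncomputable def BiFlatData.push (ψ : OpenPartialHomeomorph M (Fin 3 → 𝕜)) (S : BiFlatData 𝕜 M) :
    BiFlatData 𝕜 (Fin 3 → 𝕜) where
  mul := pushProduct ψ S.mul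
  dual := pushProduct ψ S.dual
  e := pushField ψ S.e
  E := pushField ψ S.E
  cov1 := pushConnection ψ S.cov1
  cov2 := pushConnection ψ S.cov2

variable [IsManifold (I3 𝕜) ∞ M]

/-- The product maps smooth fields to smooth fields. -/
def TProduct.IsSmoothOn (c : TProduct 𝕜 M) (s : Set M) : Prop :=
  ∀ U ⊆ s, IsOpen U → ∀ X Y : VField 𝕜 M, SmoothField X U → SmoothField Y U →
    SmoothField (c.app X Y) U

/-- The connection is a covariant derivative that maps smooth fields to smooth fields. -/
def TConnection.IsSmoothOn (cov : TConnection 𝕜 M) (s : Set M) : Prop :=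
  IsCovariantDerivativeOn (I := I3 𝕜) (Fin 3 → 𝕜) cov s ∧
  ∀ U ⊆ s, IsOpen U → ∀ X Y : VField 𝕜 M, SmoothField X U → SmoothField Y U →
    SmoothField (cov.app X Y) U

variable {ψ : OpenPartialHomeomorph M (Fin 3 → 𝕜)} {U : Set (Fin 3 → 𝕜)} {s : Set M}
  {X Y Z : VField 𝕜 M} {X' Y' Z' : (Fin 3 → 𝕜) → Fin 3 → 𝕜} {c : TProduct 𝕜 M}
  {cov : TConnection 𝕜 M}

theorem source_inter_preimage_subset (hs : ψ.source ⊆ s) : ψ.source ∩ ψ ⁻¹' U ⊆ s :=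
  Set.inter_subset_left.trans hs

theorem Represents.app (hψ : ψ ∈ IsManifold.maximalAtlas (I3 𝕜) ∞ M) (hs : ψ.source ⊆ s)
    (hc : c.IsSmoothOn s) (hU : IsOpen U) (hU' : U ⊆ ψ.target) (hX : Represents ψ U X X')
    (hY : Represents ψ U Y Y') : Represents ψ U (c.app X Y) ((pushProduct ψ c).app X' Y') :=
  hX.mul hψ (hc _ (source_inter_preimage_subset hs) (ψ.isOpen_inter_preimage hU)) hU hU' hY

theorem Represents.nabla (hψ : ψ ∈ IsManifold.maximalAtlas (I3 𝕜) ∞ M) (hs : ψ.source ⊆ s)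
    (hc : cov.IsSmoothOn s) (hU : IsOpen U) (hU' : U ⊆ ψ.target) (hX : Represents ψ U X X')
    (hY : Represents ψ U Y Y') : Represents ψ U (cov.app X Y) ((pushConnection ψ cov).app X' Y') :=
  hX.cov hψ (hc.1.mono (source_inter_preimage_subset hs))
    (hc.2 _ (source_inter_preimage_subset hs) (ψ.isOpen_inter_preimage hU)) hU hU' hY

/-- Like the three expressions after it, this one is composed of brackets, products and covariant
derivatives, and is represented because these are. -/
theorem Represents.P (hψ : ψ ∈ IsManifold.maximalAtlas (I3 𝕜) ∞ M) (hs : ψ.source ⊆ s)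
    (hc : c.IsSmoothOn s) (hU : IsOpen U) (hU' : U ⊆ ψ.target) (hX : Represents ψ U X X')
    (hY : Represents ψ U Y Y') (hZ : Represents ψ U Z Z') :
    Represents ψ U (c.P X Y Z) ((pushProduct ψ c).P X' Y' Z') :=
  ((hX.lie hψ hU hU' (hY.app hψ hs hc hU hU' hZ)).sub
    ((hX.lie hψ hU hU' hY).app hψ hs hc hU hU' hZ)).sub
    (hY.app hψ hs hc hU hU' (hX.lie hψ hU hU' hZ))

theorem Represents.derivProduct (hψ : ψ ∈ IsManifold.maximalAtlas (I3 𝕜) ∞ M)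
    (hs : ψ.source ⊆ s) (hc : c.IsSmoothOn s) (hcov : cov.IsSmoothOn s) (hU : IsOpen U)
    (hU' : U ⊆ ψ.target) (hX : Represents ψ U X X') (hY : Represents ψ U Y Y')
    (hZ : Represents ψ U Z Z') : Represents ψ U (cov.derivProduct c X Y Z)
      ((pushConnection ψ cov).derivProduct (pushProduct ψ c) X' Y' Z') :=
  ((hX.nabla hψ hs hcov hU hU' (hY.app hψ hs hc hU hU' hZ)).sub
    ((hX.nabla hψ hs hcov hU hU' hY).app hψ hs hc hU hU' hZ)).sub
    (hY.app hψ hs hc hU hU' (hX.nabla hψ hs hcov hU hU' hZ))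

theorem Represents.curv (hψ : ψ ∈ IsManifold.maximalAtlas (I3 𝕜) ∞ M)
    (hs : ψ.source ⊆ s) (hcov : cov.IsSmoothOn s) (hU : IsOpen U)
    (hU' : U ⊆ ψ.target) (hX : Represents ψ U X X') (hY : Represents ψ U Y Y')
    (hZ : Represents ψ U Z Z') : Represents ψ U (cov.curv X Y Z)
      ((pushConnection ψ cov).curv X' Y' Z') :=
  ((hX.nabla hψ hs hcov hU hU' (hY.nabla hψ hs hcov hU hU' hZ)).sub
    (hY.nabla hψ hs hcov hU hU' (hX.nabla hψ hs hcov hU hU' hZ))).sub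
    ((hX.lie hψ hU hU' hY).nabla hψ hs hcov hU hU' hZ)

theorem Represents.extD (hψ : ψ ∈ IsManifold.maximalAtlas (I3 𝕜) ∞ M)
    (hs : ψ.source ⊆ s) (hc : c.IsSmoothOn s) (hcov : cov.IsSmoothOn s) (hU : IsOpen U)
    (hU' : U ⊆ ψ.target) (hX : Represents ψ U X X') (hY : Represents ψ U Y Y')
    (hZ : Represents ψ U Z Z') : Represents ψ U (cov.extD c X Y Z)
      ((pushConnection ψ cov).extD (pushProduct ψ c) X' Y' Z') :=
  ((hY.nabla hψ hs hcov hU hU' (hX.app hψ hs hc hU hU' hZ)).sub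
    (hZ.nabla hψ hs hcov hU hU' (hX.app hψ hs hc hU hU' hY))).sub
    (hX.app hψ hs hc hU hU' (hY.lie hψ hU hU' hZ))

theorem represents_pullField_of_smoothField (hU : U ⊆ ψ.target)
    (hX : SmoothField (𝕜 := 𝕜) (M := Fin 3 → 𝕜) X' U) : Represents ψ U (pullField ψ X') X' :=
  represents_pullField hU (smoothField_iff_contDiffOn.1 hX)

theorem mem_source_inter_preimage (hU' : U ⊆ ψ.target) {y : Fin 3 → 𝕜} (hy : y ∈ U) :
    ψ.symm y ∈ ψ.source ∩ ψ ⁻¹' U :=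
  ⟨ψ.map_target (hU' hy), by rwa [Set.mem_preimage, ψ.right_inv (hU' hy)]⟩

theorem represents_pushField_target (hψ : ψ ∈ IsManifold.maximalAtlas (I3 𝕜) ∞ M)
    (hs : ψ.source ⊆ s) (hX : SmoothField X s) : Represents ψ ψ.target X (pushField ψ X) :=
  represents_pushField hψ ψ.open_target subset_rfl
    (hX.mono (Set.inter_subset_left.trans hs))

theorem IsFManifoldOn.push (hψ : ψ ∈ IsManifold.maximalAtlas (I3 𝕜) ∞ M) (hs : ψ.source ⊆ s)
    {e : VField 𝕜 M} (h : IsFManifoldOn c e s) :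
    IsFManifoldOn (pushProduct ψ c) (pushField ψ e) ψ.target where
  smooth_mul := fun U hU' hU (X Y : (Fin 3 → 𝕜) → Fin 3 → 𝕜) hX hY => smoothField_iff_contDiffOn.2
    ((represents_pullField_of_smoothField hU' hX).app hψ hs h.smooth_mul hU hU'
      (represents_pullField_of_smoothField hU' hY)).1
  smooth_unit := smoothField_iff_contDiffOn.2 (represents_pushField_target hψ hs h.smooth_unit).1
  comm := fun x hx (v w : Fin 3 → 𝕜) =>
    congrArg (chartD ψ (ψ.symm x)) (h.comm _ (hs (ψ.map_target hx)) _ _)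
  assoc := fun x hx (v w z : Fin 3 → 𝕜) => by
    have hq := ψ.map_target hx
    refine congrArg (chartD ψ (ψ.symm x)) ?_
    refine (congrArg (fun a => c (ψ.symm x) a (chartDInv ψ (ψ.symm x) z))
      (chartDInv_chartD hψ hq (c (ψ.symm x) (chartDInv ψ (ψ.symm x) v)
        (chartDInv ψ (ψ.symm x) w)))).trans ((h.assoc _ (hs hq) _ _ _).trans ?_)
    exact (congrArg (fun a => c (ψ.symm x) (chartDInv ψ (ψ.symm x) v) a)
      (chartDInv_chartD hψ hq (c (ψ.symm x) (chartDInv ψ (ψ.symm x) w)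
        (chartDInv ψ (ψ.symm x) z)))).symm
  unit := fun x hx (v : Fin 3 → 𝕜) => by
    have hq := ψ.map_target hx
    have h1 : c (ψ.symm x) (chartDInv ψ (ψ.symm x) v) (chartDInv ψ (ψ.symm x)
        (chartD ψ (ψ.symm x) (e (ψ.symm x)))) = chartDInv ψ (ψ.symm x) v := by
      rw [chartDInv_chartD hψ hq, h.unit _ (hs hq)]
    exact (congrArg (chartD ψ (ψ.symm x)) h1).trans (chartD_chartDInv hψ hq v)
  hertling_manin := fun U hU' hU (X Y Z W : (Fin 3 → 𝕜) → Fin 3 → 𝕜) hX hY hZ hW x hx => by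
    have rX := represents_pullField_of_smoothField hU' hX
    have rY := represents_pullField_of_smoothField hU' hY
    have rZ := represents_pullField_of_smoothField hU' hZ
    have rW := represents_pullField_of_smoothField hU' hW
    have hc := h.smooth_mul
    refine (((rX.app hψ hs hc hU hU' rY).P hψ hs hc hU hU' rZ rW).eq_iff hψ hU'
      ((rX.app hψ hs hc hU hU' (rY.P hψ hs hc hU hU' rZ rW)).add
        (rY.app hψ hs hc hU hU' (rX.P hψ hs hc hU hU' rZ rW))) hx).1 ?_
    exact h.hertling_manin _ (source_inter_preimage_subset hs) (ψ.isOpen_inter_preimage hU) _ _ _ _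
      (rX.smoothField hψ hU) (rY.smoothField hψ hU) (rZ.smoothField hψ hU)
      (rW.smoothField hψ hU) _ (mem_source_inter_preimage hU' hx)

theorem IsCovariantDerivativeOn.pushConnection (hψ : ψ ∈ IsManifold.maximalAtlas (I3 𝕜) ∞ M)
    (hs : ψ.source ⊆ s) (h : IsCovariantDerivativeOn (I := I3 𝕜) (Fin 3 → 𝕜) cov s) :
    IsCovariantDerivativeOn (I := I3 𝕜) (Fin 3 → 𝕜) (pushConnection ψ cov) ψ.target where
  add {σ σ' x} hσ hσ' hx := ContinuousLinearMap.ext fun (v : Fin 3 → 𝕜) => by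
    have hq := ψ.map_target hx
    rw [← ψ.right_inv hx] at hσ hσ'
    have e : cov (pullField ψ (fun y => (σ y + σ' y : Fin 3 → 𝕜))) (ψ.symm x) =
        cov (pullField ψ σ) (ψ.symm x) + cov (pullField ψ σ') (ψ.symm x) := by
      rw [← h.add (mdifferentiableAt_pullField hψ hq hσ) (mdifferentiableAt_pullField hψ hq hσ')
        (hs hq)]
      congr 1
      funext q
      exact map_add (chartDInv ψ q) (σ (ψ q)) (σ' (ψ q))
    have e' := congrArg (fun L => chartD ψ (ψ.symm x) (L (chartDInv ψ (ψ.symm x) v))) e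
    exact e'.trans (map_add (chartD ψ (ψ.symm x)) _ _)
  leibniz {σ g x} hσ hg hx := ContinuousLinearMap.ext fun (v : Fin 3 → 𝕜) => by
    have hq := ψ.map_target hx
    rw [← ψ.right_inv hx] at hσ hg
    have hψd : MDifferentiableAt (I3 𝕜) (I3 𝕜) ψ (ψ.symm x) :=
      (contMDiffAt_of_mem_maximalAtlas hψ hq).mdifferentiableAt (by simp)
    have hgψ : MDifferentiableAt (I3 𝕜) 𝓘(𝕜, 𝕜) (g ∘ ψ) (ψ.symm x) := hg.comp _ hψd
    have e : cov (pullField ψ (fun y => (g y • σ y : Fin 3 → 𝕜))) (ψ.symm x) =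
        (g ∘ ψ) (ψ.symm x) • cov (pullField ψ σ) (ψ.symm x) +
          (mvfderiv (I3 𝕜) (g ∘ ψ) (ψ.symm x)).smulRight (pullField ψ σ (ψ.symm x)) := by
      rw [← h.leibniz (mdifferentiableAt_pullField hψ hq hσ) hgψ (hs hq)]
      congr 1
      funext q
      exact map_smul (chartDInv ψ q) (g (ψ q)) (σ (ψ q))
    -- Chain rule: the differential of g ∘ ψ on a pulled back vector is the differential of g on the
    -- vector.
    have e2 : mvfderiv (I3 𝕜) (g ∘ ψ) (ψ.symm x) (chartDInv ψ (ψ.symm x) v) =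
        mvfderiv (I3 𝕜) g x v := by
      have h1 := congrArg (fun L => L (chartDInv ψ (ψ.symm x) v)) (mfderiv_comp (ψ.symm x) hg hψd)
      have h2 := chartD_chartDInv hψ hq v
      have h3 : mfderiv (I3 𝕜) 𝓘(𝕜, 𝕜) (g ∘ ψ) (ψ.symm x) (chartDInv ψ (ψ.symm x) v) =
        mfderiv (I3 𝕜) 𝓘(𝕜, 𝕜) g (ψ (ψ.symm x)) (chartD ψ (ψ.symm x)
          (chartDInv ψ (ψ.symm x) v)) := h1
      rw [h2, ψ.right_inv hx] at h3
      exact h3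
    have e' := congrArg (fun L => chartD ψ (ψ.symm x) (L (chartDInv ψ (ψ.symm x) v))) e
    refine e'.trans ?_
    have e3 : pullField ψ σ (ψ.symm x) = chartDInv ψ (ψ.symm x) (σ x) :=
      congrArg (chartDInv ψ (ψ.symm x)) (congrArg (β := Fin 3 → 𝕜) σ (ψ.right_inv hx))
    rw [e3]
    have key : ∀ (a : Fin 3 → 𝕜), chartD ψ (ψ.symm x) (g x • (cov (pullField ψ σ) (ψ.symm x))
        (chartDInv ψ (ψ.symm x) v) + mvfderiv (I3 𝕜) g x v • chartDInv ψ (ψ.symm x) a) =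
        g x • chartD ψ (ψ.symm x) ((cov (pullField ψ σ) (ψ.symm x)) (chartDInv ψ (ψ.symm x) v)) +
          mvfderiv (I3 𝕜) g x v • a := fun a => by
      rw [map_add, map_smul, map_smul, chartD_chartDInv hψ hq]
    refine Eq.trans ?_ (key (σ x))
    refine congrArg (chartD ψ (ψ.symm x)) ?_
    rw [← e2]
    have e4 : g x = (g ∘ ψ) (ψ.symm x) := by rw [Function.comp, ψ.right_inv hx]
    rw [e4]
    rfl

theorem IsFlatConnectionOn.push (hψ : ψ ∈ IsManifold.maximalAtlas (I3 𝕜) ∞ M)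
    (hs : ψ.source ⊆ s) (h : IsFlatConnectionOn cov s) :
    IsFlatConnectionOn (pushConnection ψ cov) ψ.target where
  connection := h.connection.pushConnection hψ hs
  smooth := fun U hU' hU (X Y : (Fin 3 → 𝕜) → Fin 3 → 𝕜) hX hY => smoothField_iff_contDiffOn.2
    ((represents_pullField_of_smoothField hU' hX).nabla hψ hs ⟨h.connection, h.smooth⟩ hU hU'
      (represents_pullField_of_smoothField hU' hY)).1
  torsionless := fun U hU' hU (X Y : (Fin 3 → 𝕜) → Fin 3 → 𝕜) hX hY x hx => by
    have rX := represents_pullField_of_smoothField hU' hX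
    have rY := represents_pullField_of_smoothField hU' hY
    have hc : cov.IsSmoothOn s := ⟨h.connection, h.smooth⟩
    refine (((rX.nabla hψ hs hc hU hU' rY).sub (rY.nabla hψ hs hc hU hU' rX)).eq_iff hψ hU'
      (rX.lie hψ hU hU' rY) hx).1 ?_
    exact h.torsionless _ (source_inter_preimage_subset hs) (ψ.isOpen_inter_preimage hU) _ _
      (rX.smoothField hψ hU) (rY.smoothField hψ hU) _ (mem_source_inter_preimage hU' hx)
  flat := fun U hU' hU (X Y Z : (Fin 3 → 𝕜) → Fin 3 → 𝕜) hX hY hZ x hx => by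
    have rX := represents_pullField_of_smoothField hU' hX
    have rY := represents_pullField_of_smoothField hU' hY
    have rZ := represents_pullField_of_smoothField hU' hZ
    have hc : cov.IsSmoothOn s := ⟨h.connection, h.smooth⟩
    have r0 : Represents ψ U 0 0 := ⟨contDiffOn_const, fun y _ => (map_zero _).symm⟩
    refine ((rX.curv hψ hs hc hU hU' rY rZ).eq_iff hψ hU' r0 hx).1 ?_
    exact h.flat _ (source_inter_preimage_subset hs) (ψ.isOpen_inter_preimage hU) _ _ _
      (rX.smoothField hψ hU) (rY.smoothField hψ hU) (rZ.smoothField hψ hU) _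
      (mem_source_inter_preimage hU' hx)

theorem IsFlatFManifoldOn.push (hψ : ψ ∈ IsManifold.maximalAtlas (I3 𝕜) ∞ M)
    (hs : ψ.source ⊆ s) {e : VField 𝕜 M} (h : IsFlatFManifoldOn c cov e s) :
    IsFlatFManifoldOn (pushProduct ψ c) (pushConnection ψ cov) (pushField ψ e) ψ.target where
  fmanifold := h.fmanifold.push hψ hs
  connection := h.connection.push hψ hs
  compatible := fun U hU' hU (X Y Z : (Fin 3 → 𝕜) → Fin 3 → 𝕜) hX hY hZ x hx => by
    have rX := represents_pullField_of_smoothField hU' hX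
    have rY := represents_pullField_of_smoothField hU' hY
    have rZ := represents_pullField_of_smoothField hU' hZ
    have hc := h.fmanifold.smooth_mul
    have hn : cov.IsSmoothOn s := ⟨h.connection.connection, h.connection.smooth⟩
    refine ((rX.derivProduct hψ hs hc hn hU hU' rY rZ).eq_iff hψ hU'
      (rY.derivProduct hψ hs hc hn hU hU' rX rZ) hx).1 ?_
    exact h.compatible _ (source_inter_preimage_subset hs) (ψ.isOpen_inter_preimage hU) _ _ _
      (rX.smoothField hψ hU) (rY.smoothField hψ hU) (rZ.smoothField hψ hU) _
      (mem_source_inter_preimage hU' hx)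
  flat_unit := fun x hx (v : Fin 3 → 𝕜) => by
    have hq := ψ.map_target hx
    have r := represents_pushField_target hψ hs h.fmanifold.smooth_unit
    have hsrc : ψ.source ∩ ψ ⁻¹' ψ.target = ψ.source :=
      Set.inter_eq_left.2 fun _ => ψ.map_source
    have hmem : ψ.source ∈ nhds (ψ.symm x) := ψ.open_source.mem_nhds hq
    have s2 := smoothField_pullField hψ ψ.open_target r.1
    rw [hsrc] at s2
    -- Pushing and pulling back recovers e only on the chart domain; locality of the connection
    -- bridges the gap.
    have e1 : cov (pullField ψ (pushField ψ e)) (ψ.symm x) = cov e (ψ.symm x) :=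
      (h.connection.connection.mono hs).congr_of_eqOn
        ((s2.contMDiffAt hmem).mdifferentiableAt (by simp))
        (((h.fmanifold.smooth_unit.mono hs).contMDiffAt hmem).mdifferentiableAt (by simp))
        hmem fun q hq => (r.eqOn ⟨hq, ψ.map_source hq⟩).symm
    have e2 : cov (pullField ψ (pushField ψ e)) (ψ.symm x) (chartDInv ψ (ψ.symm x) v) = 0 := by
      rw [e1, h.flat_unit _ (hs hq)]
    exact (congrArg (chartD ψ (ψ.symm x)) e2).trans (map_zero _)

theorem extD_push_eq (hψ : ψ ∈ IsManifold.maximalAtlas (I3 𝕜) ∞ M)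
    (hs : ψ.source ⊆ s) {cov' : TConnection 𝕜 M} (hc : c.IsSmoothOn s) (hn : cov.IsSmoothOn s)
    (hn' : cov'.IsSmoothOn s)
    (h : ∀ U ⊆ s, IsOpen U → ∀ X Y Z : VField 𝕜 M, SmoothField X U → SmoothField Y U →
      SmoothField Z U → ∀ x ∈ U, cov.extD c X Y Z x = cov'.extD c X Y Z x)
    (hU' : U ⊆ ψ.target) (hU : IsOpen U) (hX : SmoothField (𝕜 := 𝕜) (M := Fin 3 → 𝕜) X' U)
    (hY : SmoothField (𝕜 := 𝕜) (M := Fin 3 → 𝕜) Y' U)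
    (hZ : SmoothField (𝕜 := 𝕜) (M := Fin 3 → 𝕜) Z' U) {x : Fin 3 → 𝕜} (hx : x ∈ U) :
    (pushConnection ψ cov).extD (pushProduct ψ c) X' Y' Z' x =
      (pushConnection ψ cov').extD (pushProduct ψ c) X' Y' Z' x := by
  have rX := represents_pullField_of_smoothField hU' hX
  have rY := represents_pullField_of_smoothField hU' hY
  have rZ := represents_pullField_of_smoothField hU' hZ
  refine ((rX.extD hψ hs hc hn hU hU' rY rZ).eq_iff hψ hU'
    (rX.extD hψ hs hc hn' hU hU' rY rZ) hx).1 ?_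
  exact h _ (source_inter_preimage_subset hs) (ψ.isOpen_inter_preimage hU) _ _ _
    (rX.smoothField hψ hU) (rY.smoothField hψ hU) (rZ.smoothField hψ hU) _
    (mem_source_inter_preimage hU' hx)

theorem SingleJordanBlock.conj {V W : Type*} [AddCommGroup V] [Module 𝕜 V] [AddCommGroup W]
    [Module 𝕜 W] {L : V →ₗ[𝕜] V} (h : SingleJordanBlock L) (f : V ≃ₗ[𝕜] W) {L' : W →ₗ[𝕜] W}
    (hL : ∀ v, L' (f v) = f (L v)) : SingleJordanBlock L' := by
  obtain ⟨a, b, hb⟩ := h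
  refine ⟨a, b.map f, ?_⟩
  rw [← hb]
  ext i j
  simp [LinearMap.toMatrix_apply, hL]

theorem IsBiFlatOn.push (hψ : ψ ∈ IsManifold.maximalAtlas (I3 𝕜) ∞ M)
    (hs : ψ.source ⊆ s) {S : BiFlatData 𝕜 M} (h : IsBiFlatOn S s) :
    IsBiFlatOn (S.push ψ) ψ.target where
  flat1 := h.flat1.push hψ hs
  flat2 := h.flat2.push hψ hs
  dual_eq := by
    obtain ⟨Einv, hE, hx⟩ := h.dual_eq
    refine ⟨pushField ψ Einv, smoothField_iff_contDiffOn.2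
      (represents_pushField_target hψ hs hE).1, fun x hxt => ?_⟩
    have hq := ψ.map_target hxt
    obtain ⟨h1, h2⟩ := hx _ (hs hq)
    constructor
    · refine congrArg (chartD ψ (ψ.symm x)) (Eq.trans ?_ h1)
      exact congrArg₂ (fun a b => S.mul (ψ.symm x) a b) (chartDInv_chartD hψ hq _)
        (chartDInv_chartD hψ hq _)
    · intro (v : Fin 3 → 𝕜) (w : Fin 3 → 𝕜)
      refine congrArg (chartD ψ (ψ.symm x)) ((h2 _ _).trans ?_)
      exact (congrArg₂ (fun a b => S.mul (ψ.symm x) a b) (chartDInv_chartD hψ hq _)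
        (chartDInv_chartD hψ hq _)).symm
  euler := fun x hx => by
    have re := represents_pushField_target hψ hs h.flat1.fmanifold.smooth_unit
    have rE := represents_pushField_target hψ hs h.flat2.fmanifold.smooth_unit
    exact ((re.lie hψ ψ.open_target subset_rfl rE).eq_iff hψ subset_rfl re hx).1
      (h.euler _ (hs (ψ.map_target hx)))
  hydro_mul := fun U hU' hU (X Y Z : (Fin 3 → 𝕜) → Fin 3 → 𝕜) hX hY hZ x hx =>
    extD_push_eq hψ hs h.flat1.fmanifold.smooth_mul
      ⟨h.flat1.connection.connection, h.flat1.connection.smooth⟩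
      ⟨h.flat2.connection.connection, h.flat2.connection.smooth⟩ h.hydro_mul hU' hU hX hY hZ hx
  hydro_dual := fun U hU' hU (X Y Z : (Fin 3 → 𝕜) → Fin 3 → 𝕜) hX hY hZ x hx =>
    extD_push_eq hψ hs h.flat2.fmanifold.smooth_mul
      ⟨h.flat1.connection.connection, h.flat1.connection.smooth⟩
      ⟨h.flat2.connection.connection, h.flat2.connection.smooth⟩ h.hydro_dual hU' hU hX hY hZ hx

theorem IsRegularBiFlatOneBlockOn.push (hψ : ψ ∈ IsManifold.maximalAtlas (I3 𝕜) ∞ M)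
    (hs : ψ.source ⊆ s) {S : BiFlatData 𝕜 M} (h : IsRegularBiFlatOneBlockOn S s) :
    IsRegularBiFlatOneBlockOn (S.push ψ) ψ.target := by
  refine ⟨h.1.push hψ hs, fun x hx => ?_⟩
  have hq := ψ.map_target hx
  refine (h.2 _ (hs hq)).conj
    { toFun := fun v => (chartD ψ (ψ.symm x) v : Fin 3 → 𝕜)
      map_add' := map_add _
      map_smul' := map_smul _
      invFun := fun v : Fin 3 → 𝕜 => chartDInv ψ (ψ.symm x) v
      left_inv := chartDInv_chartD hψ hq
      right_inv := chartD_chartDInv hψ hq } fun v => ?_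
  exact congrArg (chartD ψ (ψ.symm x)) (congrArg₂ (fun a b => S.mul (ψ.symm x) a b)
    (chartDInv_chartD hψ hq _) (chartDInv_chartD hψ hq _))

end Transfer

/-! ### Lie derivatives of the product along the unit and Euler fields. -/

section HertlingManin

variable {𝕜 : Type*} [RCLike 𝕜]

/-- The Lie bracket of vector fields on `𝕜³`. -/
noncomputable def flatBracket (X Y : (Fin 3 → 𝕜) → Fin 3 → 𝕜) (x : Fin 3 → 𝕜) : Fin 3 → 𝕜 :=
  fderiv 𝕜 Y x (X x) - fderiv 𝕜 X x (Y x)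

/-- `[X, Z ∘ W] - [X, Z] ∘ W - Z ∘ [X, W]` on `𝕜³`. -/
noncomputable def flatP (m : (Fin 3 → 𝕜) → (Fin 3 → 𝕜) →L[𝕜] (Fin 3 → 𝕜) →L[𝕜] Fin 3 → 𝕜)
    (X Z W : (Fin 3 → 𝕜) → Fin 3 → 𝕜) (x : Fin 3 → 𝕜) : Fin 3 → 𝕜 :=
  flatBracket X (fun y => m y (Z y) (W y)) x - m x (flatBracket X Z x) (W x)
    - m x (Z x) (flatBracket X W x)

/-- An `F`-manifold structure with unit on an open set of `𝕜³`. -/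
structure IsHertlingManinOn (m : (Fin 3 → 𝕜) → (Fin 3 → 𝕜) →L[𝕜] (Fin 3 → 𝕜) →L[𝕜] Fin 3 → 𝕜)
    (e : (Fin 3 → 𝕜) → Fin 3 → 𝕜) (s : Set (Fin 3 → 𝕜)) : Prop where
  isOpen : IsOpen s
  smooth : ContDiffOn 𝕜 ∞ m s
  smooth_unit : ContDiffOn 𝕜 ∞ e s
  comm : ∀ x ∈ s, ∀ v w, m x v w = m x w v
  assoc : ∀ x ∈ s, ∀ v w z, m x (m x v w) z = m x v (m x w z)
  unit : ∀ x ∈ s, ∀ v, m x v (e x) = v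
  hertling_manin : ∀ X Y Z W : (Fin 3 → 𝕜) → Fin 3 → 𝕜, ContDiffOn 𝕜 ∞ X s → ContDiffOn 𝕜 ∞ Y s →
    ContDiffOn 𝕜 ∞ Z s → ContDiffOn 𝕜 ∞ W s → ∀ x ∈ s,
    flatP m (fun y => m y (X y) (Y y)) Z W x = m x (X x) (flatP m Y Z W x)
      + m x (Y x) (flatP m X Z W x)

theorem IsFManifoldOn.isHertlingManinOn {c : TProduct 𝕜 (Fin 3 → 𝕜)}
    {e : (Fin 3 → 𝕜) → Fin 3 → 𝕜} {s : Set (Fin 3 → 𝕜)} (hs : IsOpen s)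
    (h : IsFManifoldOn c e s) : IsHertlingManinOn (fun x => bilinearCLM (c x)) e s where
  isOpen := hs
  smooth := contDiffOn_clm_apply.2 fun v => contDiffOn_clm_apply.2 fun w =>
    smoothField_iff_contDiffOn.1 (h.smooth_mul s subset_rfl hs (fun _ => v) (fun _ => w)
      (smoothField_iff_contDiffOn.2 contDiffOn_const)
      (smoothField_iff_contDiffOn.2 contDiffOn_const))
  smooth_unit := smoothField_iff_contDiffOn.1 h.smooth_unit
  comm := h.comm
  assoc := h.assoc
  unit := h.unit
  hertling_manin := fun X Y Z W hX hY hZ hW x hx => by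
    have hP : ∀ X Z W : (Fin 3 → 𝕜) → Fin 3 → 𝕜, (c.P X Z W x : Fin 3 → 𝕜) =
        flatP (fun x => bilinearCLM (c x)) X Z W x := fun X Z W => by
      have key : ∀ A B C : Fin 3 → 𝕜, A = flatBracket X (fun y => bilinearCLM (c y) (Z y) (W y)) x →
          B = flatBracket X Z x → C = flatBracket X W x →
          A - bilinearCLM (c x) B (W x) - bilinearCLM (c x) (Z x) C =
            flatP (fun x => bilinearCLM (c x)) X Z W x := by
        rintro A B C rfl rfl rfl; rfl
      exact key _ _ _ (lieB_apply X _ x) (lieB_apply X Z x) (lieB_apply X W x)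
    have := h.hertling_manin s subset_rfl hs X Y Z W (smoothField_iff_contDiffOn.2 hX)
      (smoothField_iff_contDiffOn.2 hY) (smoothField_iff_contDiffOn.2 hZ)
      (smoothField_iff_contDiffOn.2 hW) x hx
    refine ((hP _ Z W).symm.trans this).trans ?_
    exact congrArg₂ (fun a b : Fin 3 → 𝕜 => bilinearCLM (c x) (X x) a + bilinearCLM (c x) (Y x) b)
      (hP Y Z W) (hP X Z W)

theorem flatBracket_congr {s : Set (Fin 3 → 𝕜)} (hs : IsOpen s)
    {X X' Y Y' : (Fin 3 → 𝕜) → Fin 3 → 𝕜} (hX : Set.EqOn X X' s) (hY : Set.EqOn Y Y' s)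
    {x : Fin 3 → 𝕜} (hx : x ∈ s) : flatBracket X Y x = flatBracket X' Y' x := by
  have h1 : X =ᶠ[nhds x] X' := Filter.mem_of_superset (hs.mem_nhds hx) hX
  have h2 : Y =ᶠ[nhds x] Y' := Filter.mem_of_superset (hs.mem_nhds hx) hY
  rw [flatBracket, flatBracket, h1.fderiv_eq, h2.fderiv_eq, hX hx, hY hx]

theorem flatBracket_self (X : (Fin 3 → 𝕜) → Fin 3 → 𝕜) (x : Fin 3 → 𝕜) :
    flatBracket X X x = 0 := sub_self _

theorem flatBracket_swap (X Y : (Fin 3 → 𝕜) → Fin 3 → 𝕜) (x : Fin 3 → 𝕜) :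
    flatBracket X Y x = -flatBracket Y X x := (neg_sub _ _).symm

theorem flatBracket_add {X Y Z : (Fin 3 → 𝕜) → Fin 3 → 𝕜} {x : Fin 3 → 𝕜}
    (hY : DifferentiableAt 𝕜 Y x) (hZ : DifferentiableAt 𝕜 Z x) :
    flatBracket X (fun y => Y y + Z y) x = flatBracket X Y x + flatBracket X Z x := by
  simp only [flatBracket, fderiv_fun_add hY hZ, add_apply, map_add]
  abel

theorem flatBracket_smul {X Y : (Fin 3 → 𝕜) → Fin 3 → 𝕜} {f : (Fin 3 → 𝕜) → 𝕜} {x : Fin 3 → 𝕜}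
    (hf : DifferentiableAt 𝕜 f x) (hY : DifferentiableAt 𝕜 Y x) :
    flatBracket X (fun y => f y • Y y) x = f x • flatBracket X Y x + fderiv 𝕜 f x (X x) • Y x := by
  simp only [flatBracket, fderiv_fun_smul hf hY, add_apply, smul_apply, map_smul,
    ContinuousLinearMap.smulRight_apply, smul_sub]
  abel

namespace IsHertlingManinOn

variable {m : (Fin 3 → 𝕜) → (Fin 3 → 𝕜) →L[𝕜] (Fin 3 → 𝕜) →L[𝕜] Fin 3 → 𝕜}
  {e : (Fin 3 → 𝕜) → Fin 3 → 𝕜} {s : Set (Fin 3 → 𝕜)}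

theorem mul_unit (h : IsHertlingManinOn m e s) {x : Fin 3 → 𝕜} (hx : x ∈ s) (v : Fin 3 → 𝕜) :
    m x (e x) v = v := by rw [h.comm x hx, h.unit x hx]

theorem left_comm (h : IsHertlingManinOn m e s) {x : Fin 3 → 𝕜} (hx : x ∈ s)
    (v w z : Fin 3 → 𝕜) : m x v (m x w z) = m x w (m x v z) := by
  rw [← h.assoc x hx, h.comm x hx v w, h.assoc x hx]

theorem contDiffOn_mul (h : IsHertlingManinOn m e s) {X Y : (Fin 3 → 𝕜) → Fin 3 → 𝕜}
    (hX : ContDiffOn 𝕜 ∞ X s) (hY : ContDiffOn 𝕜 ∞ Y s) :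
    ContDiffOn 𝕜 ∞ (fun x => m x (X x) (Y x)) s :=
  (h.smooth.clm_apply hX).clm_apply hY

/-- The unit field is an infinitesimal automorphism. -/
theorem flatP_unit (h : IsHertlingManinOn m e s) {Z W : (Fin 3 → 𝕜) → Fin 3 → 𝕜}
    (hZ : ContDiffOn 𝕜 ∞ Z s) (hW : ContDiffOn 𝕜 ∞ W s) {x : Fin 3 → 𝕜} (hx : x ∈ s) :
    flatP m e Z W x = 0 := by
  -- As e ∘ e = e, the condition with X = Y = e reads P_e = P_e + P_e.
  have h1 := h.hertling_manin e e Z W h.smooth_unit h.smooth_unit hZ hW x hx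
  have hee : Set.EqOn (fun y => m y (e y) (e y)) e s := fun y hy => h.unit y hy _
  have h2 : flatP m (fun y => m y (e y) (e y)) Z W x = flatP m e Z W x := by
    rw [flatP, flatP, flatBracket_congr h.isOpen hee (fun _ _ => rfl) hx,
      flatBracket_congr h.isOpen hee (fun _ _ => rfl) hx,
      flatBracket_congr h.isOpen hee (fun _ _ => rfl) hx]
  rw [h2, h.mul_unit hx] at h1
  exact left_eq_add.1 h1

theorem flatBracket_unit (h : IsHertlingManinOn m e s) {Z W : (Fin 3 → 𝕜) → Fin 3 → 𝕜}
    (hZ : ContDiffOn 𝕜 ∞ Z s) (hW : ContDiffOn 𝕜 ∞ W s) {x : Fin 3 → 𝕜} (hx : x ∈ s) :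
    flatBracket e (fun y => m y (Z y) (W y)) x = m x (flatBracket e Z x) (W x)
      + m x (Z x) (flatBracket e W x) := by
  have := h.flatP_unit hZ hW hx
  rw [flatP, sub_sub, sub_eq_zero] at this
  exact this

/-- An invertible Euler field that is the unit of the dual product rescales the product. -/
theorem flatBracket_euler (h : IsHertlingManinOn m e s)
    {m' : (Fin 3 → 𝕜) → (Fin 3 → 𝕜) →L[𝕜] (Fin 3 → 𝕜) →L[𝕜] Fin 3 → 𝕜}
    {E ε : (Fin 3 → 𝕜) → Fin 3 → 𝕜} (h' : IsHertlingManinOn m' E s)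
    (hε : ∀ x ∈ s, m x (E x) (ε x) = e x) (hm : ∀ x ∈ s, ∀ v w, m' x v w = m x (m x v w) (ε x))
    (heE : ∀ x ∈ s, flatBracket e E x = e x) {Z W : (Fin 3 → 𝕜) → Fin 3 → 𝕜}
    (hZ : ContDiffOn 𝕜 ∞ Z s) (hW : ContDiffOn 𝕜 ∞ W s) {x : Fin 3 → 𝕜} (hx : x ∈ s) :
    flatBracket E (fun y => m y (Z y) (W y)) x = m x (flatBracket E Z x) (W x)
      + m x (Z x) (flatBracket E W x) + m x (Z x) (W x) := by
  have hE := h'.smooth_unit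
  have hEE := h.contDiffOn_mul hE hE
  -- The original product in terms of the dual one: v ∘ w = v * w * (E ∘ E).
  have hre : ∀ y ∈ s, ∀ v w, m y v w = m' y (m' y v w) (m y (E y) (E y)) := fun y hy v w => by
    have hc := h.comm y hy
    have hlc : ∀ v w z, _ := fun v w z => h.left_comm hy v w z
    have : m y (m y v w) (m y (m y (E y) (ε y)) (m y (E y) (ε y))) = m y v w := by
      rw [hε y hy, h.unit y hy, h.unit y hy]
    rw [hm y hy, hm y hy]
    refine this.symm.trans ?_
    simp only [hc, hlc]
  -- E is the unit of *, so its bracket is a derivation of *. In Z * W * (E ∘ E) the only term not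
  -- already of Leibniz form for ∘ is the one that brackets E ∘ E.
  have main : ∀ Z W : (Fin 3 → 𝕜) → Fin 3 → 𝕜, ContDiffOn 𝕜 ∞ Z s → ContDiffOn 𝕜 ∞ W s →
      flatBracket E (fun y => m y (Z y) (W y)) x = m x (flatBracket E Z x) (W x)
        + m x (Z x) (flatBracket E W x)
        + m' x (m' x (Z x) (W x)) (flatBracket E (fun y => m y (E y) (E y)) x) := by
    intro Z W hZ hW
    rw [flatBracket_congr h.isOpen (fun _ _ => rfl) (fun y hy => hre y hy (Z y) (W y)) hx,
      h'.flatBracket_unit (h'.contDiffOn_mul hZ hW) hEE hx, h'.flatBracket_unit hZ hW hx,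
      map_add, add_apply, ← hre x hx, ← hre x hx]
  -- The unknown bracket [E, E ∘ E] is found by evaluating on the unit: [E, e] = -e turns the
  -- formula into -e = -2 e + (last term), so this last term is e.
  have h1 := main e e h.smooth_unit h.smooth_unit
  rw [flatBracket_congr h.isOpen (fun _ _ => rfl) (fun y hy => h.unit y hy (e y)) hx,
    flatBracket_swap E e, heE x hx, h.unit x hx, h.mul_unit hx] at h1
  have h2 : m' x (m' x (e x) (e x)) (flatBracket E (fun y => m y (E y) (E y)) x) = e x := by
    have := eq_sub_iff_add_eq'.2 h1.symm
    rw [this]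
    abel
  rw [main Z W hZ hW]
  congr 1
  -- By associativity the last term for Z, W is Z ∘ W times the last term for e, e.
  have h3 : m' x (m' x (Z x) (W x)) (flatBracket E (fun y => m y (E y) (E y)) x) =
      m x (m x (Z x) (W x)) (m' x (m' x (e x) (e x))
        (flatBracket E (fun y => m y (E y) (E y)) x)) := by
    have hc := h.comm x hx
    have hlc : ∀ v w z, _ := fun v w z => h.left_comm hx v w z
    rw [hm x hx (m' x (Z x) (W x)), hm x hx (m' x (e x) (e x)), hm x hx, hm x hx,
      h.unit x hx, h.mul_unit hx]
    simp only [hc, hlc, h.assoc x hx]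
  rw [h3, h2, h.unit x hx]

/-- The square of the Euler field. -/
theorem flatBracket_euler_sq (h : IsHertlingManinOn m e s) {E : (Fin 3 → 𝕜) → Fin 3 → 𝕜}
    (hE : ContDiffOn 𝕜 ∞ E s)
    (hP : ∀ Z W : (Fin 3 → 𝕜) → Fin 3 → 𝕜, ContDiffOn 𝕜 ∞ Z s → ContDiffOn 𝕜 ∞ W s → ∀ x ∈ s,
      flatBracket E (fun y => m y (Z y) (W y)) x = m x (flatBracket E Z x) (W x)
        + m x (Z x) (flatBracket E W x) + m x (Z x) (W x)) {Z W : (Fin 3 → 𝕜) → Fin 3 → 𝕜}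
    (hZ : ContDiffOn 𝕜 ∞ Z s) (hW : ContDiffOn 𝕜 ∞ W s) {x : Fin 3 → 𝕜} (hx : x ∈ s) :
    flatBracket (fun y => m y (E y) (E y)) (fun y => m y (Z y) (W y)) x =
      m x (flatBracket (fun y => m y (E y) (E y)) Z x) (W x)
        + m x (Z x) (flatBracket (fun y => m y (E y) (E y)) W x)
        + (2 : 𝕜) • m x (E x) (m x (Z x) (W x)) := by
  -- P_E is the product itself, and the Hertling-Manin condition with X = Y = E doubles it.
  have h1 := h.hertling_manin E E Z W hE hE hZ hW x hx
  have h2 : flatP m E Z W x = m x (Z x) (W x) := by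
    rw [flatP, hP Z W hZ hW x hx]; abel
  rw [h2, ← two_smul 𝕜, flatP, sub_sub, sub_eq_iff_eq_add] at h1
  rw [h1]; abel

end IsHertlingManinOn

end HertlingManin

/-! ### The eigenvalue of a single Jordan block. -/

section OneBlock

variable {𝕜 : Type*} [RCLike 𝕜]

/-- A third of the trace of `L`. -/
noncomputable def thirdTrace (L : (Fin 3 → 𝕜) →L[𝕜] Fin 3 → 𝕜) : 𝕜 :=
  (∑ i, L (Pi.single i 1) i) / 3

/-- The eigenvalue is identified as a third of the trace, because that expression, unlike a
pointwise choice of Jordan basis, depends smoothly on the point. -/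
theorem SingleJordanBlock.exists_chain {L : (Fin 3 → 𝕜) →L[𝕜] Fin 3 → 𝕜}
    (h : SingleJordanBlock L.toLinearMap) : ∃ b : Module.Basis (Fin 3) 𝕜 (Fin 3 → 𝕜),
      L (b 0) = thirdTrace L • b 0 ∧ L (b 1) = thirdTrace L • b 1 + b 0 ∧
      L (b 2) = thirdTrace L • b 2 + b 1 := by
  obtain ⟨a, b, hb⟩ := h
  have ha : thirdTrace L = a := by
    have h1 := LinearMap.trace_eq_matrix_trace 𝕜 b L.toLinearMap
    have h2 := LinearMap.trace_eq_matrix_trace 𝕜 (Pi.basisFun 𝕜 (Fin 3)) L.toLinearMap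
    rw [h1, hb, Matrix.trace_fin_three] at h2
    simp only [Matrix.trace, Matrix.diag, LinearMap.toMatrix_apply, Pi.basisFun_apply,
      Pi.basisFun_repr, ContinuousLinearMap.coe_coe] at h2
    rw [thirdTrace, ← h2]
    simp
    ring
  have hL : ∀ j, L (b j) = ∑ i, LinearMap.toMatrix b b L.toLinearMap i j • b i := fun j => by
    simp only [LinearMap.toMatrix_apply, ContinuousLinearMap.coe_coe]
    exact (b.sum_repr _).symm
  refine ⟨b, ?_, ?_, ?_⟩ <;> rw [hL, hb, ha] <;> simp [Fin.sum_univ_three, add_comm]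

/-- Fields of a regular structure with a single Jordan block: `N = E - a e`, `N₂ = N ∘ N`. -/
structure IsOneBlockAt (μ : (Fin 3 → 𝕜) →L[𝕜] (Fin 3 → 𝕜) →L[𝕜] Fin 3 → 𝕜) (e E : Fin 3 → 𝕜)
    (a : 𝕜) : Prop where
  cube : μ (E - a • e) (μ (E - a • e) (E - a • e)) = 0
  indep : ∀ α β γ : 𝕜, α • e + β • (E - a • e) + γ • μ (E - a • e) (E - a • e) = 0 →
    α = 0 ∧ β = 0 ∧ γ = 0

theorem SingleJordanBlock.isOneBlockAt
    {μ : (Fin 3 → 𝕜) →L[𝕜] (Fin 3 → 𝕜) →L[𝕜] Fin 3 → 𝕜} {e E : Fin 3 → 𝕜}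
    (h : SingleJordanBlock (μ E).toLinearMap)
    (assoc : ∀ v w z, μ (μ v w) z = μ v (μ w z)) (unit : ∀ v, μ v e = v) (unit' : ∀ v, μ e v = v) :
    IsOneBlockAt μ e E (thirdTrace (μ E)) := by
  obtain ⟨b, h0, h1, h2⟩ := h.exists_chain
  set a := thirdTrace (μ E)
  have n0 : μ (E - a • e) (b 0) = 0 := by
    rw [map_sub, map_smul, sub_apply, smul_apply, h0, unit', sub_self]
  have n1 : μ (E - a • e) (b 1) = b 0 := by
    rw [map_sub, map_smul, sub_apply, smul_apply, h1, unit', add_sub_cancel_left]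
  have n2 : μ (E - a • e) (b 2) = b 1 := by
    rw [map_sub, map_smul, sub_apply, smul_apply, h2, unit', add_sub_cancel_left]
  constructor
  · have h3 : ∀ v, μ (E - a • e) (μ (E - a • e) (μ (E - a • e) v)) = 0 := fun v => by
      rw [← b.sum_repr v]
      generalize E - a • e = N at n0 n1 n2
      simp [Fin.sum_univ_three, n0, n1, n2, -Module.Basis.sum_repr]
    have := h3 e
    rwa [unit] at this
  · intro α β γ h
    -- Acting on the top of the chain turns e, N, N ∘ N into the basis vectors b 2, b 1, b 0.
    have := congrArg (fun v => μ v (b 2)) h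
    simp only [map_add, map_smul, add_apply, smul_apply, assoc, n2, n1, unit', map_zero,
      zero_apply] at this
    have hli := Fintype.linearIndependent_iff.1 b.linearIndependent ![γ, β, α] (by
      rw [Fin.sum_univ_three, ← this]; simp; abel)
    exact ⟨hli 2, hli 1, hli 0⟩

namespace IsHertlingManinOn

variable {m : (Fin 3 → 𝕜) → (Fin 3 → 𝕜) →L[𝕜] (Fin 3 → 𝕜) →L[𝕜] Fin 3 → 𝕜}
  {e E : (Fin 3 → 𝕜) → Fin 3 → 𝕜} {s : Set (Fin 3 → 𝕜)} {a : (Fin 3 → 𝕜) → 𝕜}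

theorem contDiffOn_thirdTrace (h : IsHertlingManinOn m e s) (hE : ContDiffOn 𝕜 ∞ E s) :
    ContDiffOn 𝕜 ∞ (fun x => thirdTrace (m x (E x))) s := by
  refine ContDiffOn.div_const (ContDiffOn.sum fun i _ => ?_) 3
  exact contDiffOn_pi.1 (h.contDiffOn_mul hE contDiffOn_const) i

/-- An Euler field acts on the product by rescaling. -/
structure IsEulerOn (m : (Fin 3 → 𝕜) → (Fin 3 → 𝕜) →L[𝕜] (Fin 3 → 𝕜) →L[𝕜] Fin 3 → 𝕜)
    (e E : (Fin 3 → 𝕜) → Fin 3 → 𝕜) (s : Set (Fin 3 → 𝕜)) : Prop where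
  smooth : ContDiffOn 𝕜 ∞ E s
  bracket_unit : ∀ x ∈ s, flatBracket e E x = e x
  bracket_mul : ∀ Z W : (Fin 3 → 𝕜) → Fin 3 → 𝕜, ContDiffOn 𝕜 ∞ Z s → ContDiffOn 𝕜 ∞ W s →
    ∀ x ∈ s, flatBracket E (fun y => m y (Z y) (W y)) x = m x (flatBracket E Z x) (W x)
        + m x (Z x) (flatBracket E W x) + m x (Z x) (W x)

/-- The bracket of any field with the Cayley-Hamilton relation. -/
theorem flatBracket_cube (h : IsHertlingManinOn m e s) (hE : ContDiffOn 𝕜 ∞ E s)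
    (ha : ContDiffOn 𝕜 ∞ a s) (hone : ∀ x ∈ s, IsOneBlockAt (m x) (e x) (E x) (a x))
    (X : (Fin 3 → 𝕜) → Fin 3 → 𝕜) {x : Fin 3 → 𝕜} (hx : x ∈ s) :
    flatBracket X (fun y => m y (E y) (m y (E y) (E y))) x =
      (3 * a x) • flatBracket X (fun y => m y (E y) (E y)) x
        + (3 * fderiv 𝕜 a x (X x)) • m x (E x) (E x)
        - ((3 * a x ^ 2) • flatBracket X E x + (6 * a x * fderiv 𝕜 a x (X x)) • E x)
        + (a x ^ 3 • flatBracket X e x + (3 * a x ^ 2 * fderiv 𝕜 a x (X x)) • e x) := by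
  have hE2 := h.contDiffOn_mul hE hE
  have hd : ∀ {Y : (Fin 3 → 𝕜) → Fin 3 → 𝕜}, ContDiffOn 𝕜 ∞ Y s → DifferentiableAt 𝕜 Y x :=
    fun hY => (hY.differentiableOn (by simp)).differentiableAt (h.isOpen.mem_nhds hx)
  have da : DifferentiableAt 𝕜 a x :=
    (ha.differentiableOn (by simp)).differentiableAt (h.isOpen.mem_nhds hx)
  have e1 : Set.EqOn (fun y => m y (E y) (m y (E y) (E y))) (fun y => (3 * a y) • m y (E y) (E y)
      + ((-(3 * a y ^ 2)) • E y + a y ^ 3 • e y)) s := fun y hy => by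
    have hc := (hone y hy).cube
    simp only [map_sub, map_smul, sub_apply, smul_apply, h.unit y hy, h.mul_unit hy] at hc
    rw [← sub_eq_zero]
    refine Eq.trans ?_ hc
    module
  have d1 : HasFDerivAt (fun y => 3 * a y) ((3 : 𝕜) • fderiv 𝕜 a x) x := da.hasFDerivAt.const_mul 3
  have d2 : HasFDerivAt (fun y => -(3 * a y ^ 2)) (-((6 * a x) • fderiv 𝕜 a x)) x := by
    have := ((da.hasFDerivAt.pow 2).const_mul 3).neg
    refine this.congr_fderiv ?_
    ext v; simp; ring
  have d3 : HasFDerivAt (fun y => a y ^ 3) ((3 * a x ^ 2) • fderiv 𝕜 a x) x := by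
    refine (da.hasFDerivAt.pow 3).congr_fderiv ?_
    ext v; simp
  have t1 : DifferentiableAt 𝕜 (fun y => (3 * a y) • m y (E y) (E y)) x :=
    d1.differentiableAt.smul (hd hE2)
  have t2 : DifferentiableAt 𝕜 (fun y => (-(3 * a y ^ 2)) • E y) x :=
    d2.differentiableAt.smul (hd hE)
  have t3 : DifferentiableAt 𝕜 (fun y => a y ^ 3 • e y) x :=
    d3.differentiableAt.smul (hd h.smooth_unit)
  have t23 : DifferentiableAt 𝕜 (fun y => (-(3 * a y ^ 2)) • E y + a y ^ 3 • e y) x := t2.add t3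
  rw [flatBracket_congr h.isOpen (fun _ _ => rfl) e1 hx, flatBracket_add t1 t23,
    flatBracket_add t2 t3,
    flatBracket_smul d1.differentiableAt (hd hE2), flatBracket_smul d2.differentiableAt (hd hE),
    flatBracket_smul d3.differentiableAt (hd h.smooth_unit), d1.fderiv, d2.fderiv, d3.fderiv]
  simp only [smul_apply, neg_apply, smul_eq_mul]
  module

theorem _root_.IsOneBlockAt.indep' {μ : (Fin 3 → 𝕜) →L[𝕜] (Fin 3 → 𝕜) →L[𝕜] Fin 3 → 𝕜}
    {e E : Fin 3 → 𝕜} {a : 𝕜} (h : IsOneBlockAt μ e E a) (unit : ∀ v, μ v e = v)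
    (unit' : ∀ v, μ e v = v) {α β γ : 𝕜} (h0 : α • e + β • E + γ • μ E E = 0) : γ = 0 := by
  refine (h.indep (α + β * a + γ * a ^ 2) (β + 2 * a * γ) γ ?_).2.2
  rw [← h0]
  simp only [map_sub, map_smul, sub_apply, smul_apply, unit, unit']
  module

/-- E satisfies E³ = 3 a E² - 3 a² E + a³ e. Bracketing this with e, E and E ∘ E, whose brackets
with powers of E are known, and comparing the coefficients of E ∘ E gives the derivative of a in
each direction. -/
theorem fderiv_eigenvalue (h : IsHertlingManinOn m e s) (hE : IsEulerOn m e E s)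
    (ha : ContDiffOn 𝕜 ∞ a s) (hone : ∀ x ∈ s, IsOneBlockAt (m x) (e x) (E x) (a x))
    {x : Fin 3 → 𝕜} (hx : x ∈ s) : fderiv 𝕜 a x (e x) = 1 ∧ fderiv 𝕜 a x (E x) = a x ∧
      fderiv 𝕜 a x (m x (E x) (E x)) = a x ^ 2 := by
  have sE := hE.smooth
  have sE2 := h.contDiffOn_mul sE sE
  have ind : ∀ {α β γ : 𝕜}, _ → γ = 0 := fun {α β γ} =>
    (hone x hx).indep' (h.unit x hx) (h.mul_unit hx) (α := α) (β := β)
  have e1 : flatBracket e (fun y => m y (E y) (E y)) x = (2 : 𝕜) • E x := by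
    rw [h.flatBracket_unit sE sE hx, hE.bracket_unit x hx, h.unit x hx, h.mul_unit hx, two_smul]
  have e2 : flatBracket E (fun y => m y (E y) (E y)) x = m x (E x) (E x) := by
    rw [hE.bracket_mul E E sE sE x hx, flatBracket_self]
    simp
  have e3 : flatBracket E e x = -e x := by rw [flatBracket_swap, hE.bracket_unit x hx]
  have hcube : m x (E x) (m x (E x) (E x)) =
      (3 * a x) • m x (E x) (E x) - (3 * a x ^ 2) • E x + a x ^ 3 • e x := by
    have hc := (hone x hx).cube
    simp only [map_sub, map_smul, sub_apply, smul_apply, h.unit x hx, h.mul_unit hx] at hc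
    rw [← sub_eq_zero]
    refine Eq.trans ?_ hc
    module
  refine ⟨?_, ?_, ?_⟩
  · have := h.flatBracket_cube sE ha hone e hx
    rw [h.flatBracket_unit sE sE2 hx, e1, hE.bracket_unit x hx, h.mul_unit hx, flatBracket_self,
      map_smul, ← sub_eq_zero] at this
    have key := ind (α := 3 * a x ^ 2 - 3 * a x ^ 2 * fderiv 𝕜 a x (e x))
      (β := -6 * a x + 6 * a x * fderiv 𝕜 a x (e x)) (γ := 3 - 3 * fderiv 𝕜 a x (e x))
      (by rw [← this]; module)
    linear_combination (-1 / 3 : 𝕜) * key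
  · have := h.flatBracket_cube sE ha hone E hx
    rw [hE.bracket_mul E _ sE sE2 x hx, e2, flatBracket_self, e3, map_zero, zero_apply, zero_add,
      hcube, ← sub_eq_zero] at this
    have key := ind (α := 3 * a x ^ 3 - 3 * a x ^ 2 * fderiv 𝕜 a x (E x))
      (β := -6 * a x ^ 2 + 6 * a x * fderiv 𝕜 a x (E x))
      (γ := 3 * a x - 3 * fderiv 𝕜 a x (E x)) (by rw [← this]; module)
    linear_combination (-1 / 3 : 𝕜) * key
  · have := h.flatBracket_cube sE ha hone (fun y => m y (E y) (E y)) hx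
    have b1 : flatBracket (fun y => m y (E y) (E y)) E x = -m x (E x) (E x) := by
      rw [flatBracket_swap, e2]
    have b2 : flatBracket (fun y => m y (E y) (E y)) e x = -((2 : 𝕜) • E x) := by
      rw [flatBracket_swap, e1]
    rw [h.flatBracket_euler_sq sE hE.bracket_mul sE sE2 hx, b1, b2, flatBracket_self, map_zero,
      map_neg, neg_apply, h.assoc x hx] at this
    simp only [hcube, map_add, map_sub, map_smul, h.unit x hx] at this
    rw [← sub_eq_zero] at this
    have key := ind (α := 3 * a x ^ 4 - 3 * a x ^ 2 * fderiv 𝕜 a x (m x (E x) (E x)))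
      (β := -6 * a x ^ 3 + 6 * a x * fderiv 𝕜 a x (m x (E x) (E x)))
      (γ := 3 * a x ^ 2 - 3 * fderiv 𝕜 a x (m x (E x) (E x))) (by rw [← this]; module)
    linear_combination (-1 / 3 : 𝕜) * key

end IsHertlingManinOn

end OneBlock

/-! ### The nilpotent frame and its brackets. -/

section OneBlock

variable {𝕜 : Type*} [RCLike 𝕜]

namespace IsHertlingManinOn

variable {m : (Fin 3 → 𝕜) → (Fin 3 → 𝕜) →L[𝕜] (Fin 3 → 𝕜) →L[𝕜] Fin 3 → 𝕜}
  {e E : (Fin 3 → 𝕜) → Fin 3 → 𝕜} {s : Set (Fin 3 → 𝕜)} {a : (Fin 3 → 𝕜) → 𝕜}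

theorem flatBracket_nilpotent (h : IsHertlingManinOn m e s) (hE : ContDiffOn 𝕜 ∞ E s)
    (ha : ContDiffOn 𝕜 ∞ a s) (X : (Fin 3 → 𝕜) → Fin 3 → 𝕜) {x : Fin 3 → 𝕜} (hx : x ∈ s) :
    flatBracket X (fun y => E y - a y • e y) x =
      flatBracket X E x - a x • flatBracket X e x - fderiv 𝕜 a x (X x) • e x := by
  have hmem := h.isOpen.mem_nhds hx
  have dE := (hE.differentiableOn (by simp)).differentiableAt hmem
  have de := (h.smooth_unit.differentiableOn (by simp)).differentiableAt hmem
  have da : DifferentiableAt 𝕜 a x := (ha.differentiableOn (by simp)).differentiableAt hmem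
  have t1 : DifferentiableAt 𝕜 (fun y => (-a y) • e y) x := da.neg.smul de
  have da' : DifferentiableAt 𝕜 (fun y => -a y) x := da.neg
  have e1 : (fun y => E y - a y • e y) = fun y => E y + (-a y) • e y := by
    funext y; rw [neg_smul, sub_eq_add_neg]
  rw [e1, flatBracket_add dE t1, flatBracket_smul da' de, fderiv_fun_neg]
  simp only [neg_apply]
  module

/-- The frame `e`, `N = E - a e`, `N ∘ N` of a structure with a single Jordan block. -/
structure IsNilpotentFrameOn (m : (Fin 3 → 𝕜) → (Fin 3 → 𝕜) →L[𝕜] (Fin 3 → 𝕜) →L[𝕜] Fin 3 → 𝕜)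
    (e N : (Fin 3 → 𝕜) → Fin 3 → 𝕜) (a : (Fin 3 → 𝕜) → 𝕜) (s : Set (Fin 3 → 𝕜)) : Prop where
  smooth : ContDiffOn 𝕜 ∞ N s
  smooth_sq : ContDiffOn 𝕜 ∞ (fun y => m y (N y) (N y)) s
  cube : ∀ x ∈ s, m x (N x) (m x (N x) (N x)) = 0
  indep : ∀ x ∈ s, ∀ α β γ : 𝕜, α • e x + β • N x + γ • m x (N x) (N x) = 0 → α = 0 ∧ β = 0 ∧ γ = 0
  unit_bracket : ∀ x ∈ s, flatBracket e N x = 0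
  unit_bracket_sq : ∀ x ∈ s, flatBracket e (fun y => m y (N y) (N y)) x = 0
  bracket_sq : ∀ x ∈ s, flatBracket N (fun y => m y (N y) (N y)) x = m x (N x) (N x)
  fderiv_unit : ∀ x ∈ s, fderiv 𝕜 a x (e x) = 1
  fderiv_nilpotent : ∀ x ∈ s, fderiv 𝕜 a x (N x) = 0
  fderiv_sq : ∀ x ∈ s, fderiv 𝕜 a x (m x (N x) (N x)) = 0

/-- From e(a) = 1 and E(a) = a one gets [e, N] = 0 and [E, N] = 0. The Lie derivative of ∘ along e
vanishes, so [e, N ∘ N] = 0; that along E is ∘ itself, so [E, N ∘ N] = N ∘ N. Since N(a) = 0 and a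
kills N ∘ N, the bracket [N, N ∘ N] is N ∘ N as well. -/
theorem isNilpotentFrameOn (h : IsHertlingManinOn m e s) (hE : IsEulerOn m e E s)
    (ha : ContDiffOn 𝕜 ∞ a s) (hone : ∀ x ∈ s, IsOneBlockAt (m x) (e x) (E x) (a x)) :
    IsNilpotentFrameOn m e (fun x => E x - a x • e x) a s := by
  have sE := hE.smooth
  have sN : ContDiffOn 𝕜 ∞ (fun x => E x - a x • e x) s := sE.sub (ha.smul h.smooth_unit)
  have sN2 := h.contDiffOn_mul sN sN
  have f1 : ∀ x ∈ s, _ := fun x hx => (h.fderiv_eigenvalue hE ha hone hx).1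
  have f2 : ∀ x ∈ s, _ := fun x hx => (h.fderiv_eigenvalue hE ha hone hx).2.1
  have f3 : ∀ x ∈ s, _ := fun x hx => (h.fderiv_eigenvalue hE ha hone hx).2.2
  have b1 : ∀ x ∈ s, flatBracket e (fun x => E x - a x • e x) x = 0 := fun x hx => by
    rw [h.flatBracket_nilpotent sE ha e hx, hE.bracket_unit x hx, flatBracket_self, f1 x hx]
    simp
  have b2 : ∀ x ∈ s, flatBracket E (fun x => E x - a x • e x) x = 0 := fun x hx => by
    rw [h.flatBracket_nilpotent sE ha E hx, flatBracket_self, flatBracket_swap E e,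
      hE.bracket_unit x hx, f2 x hx]
    simp
  have b3 : ∀ x ∈ s, flatBracket e (fun y => m y (E y - a y • e y) (E y - a y • e y)) x = 0 :=
    fun x hx => by
      rw [h.flatBracket_unit sN sN hx, b1 x hx]
      simp
  have g3 : ∀ x ∈ s, fderiv 𝕜 a x (m x (E x - a x • e x) (E x - a x • e x)) = 0 := fun x hx => by
    simp only [map_sub, map_smul, sub_apply, smul_apply, h.unit x hx, h.mul_unit hx, f1 x hx,
      f2 x hx, f3 x hx, smul_eq_mul]
    ring
  refine ⟨sN, sN2, fun x hx => (hone x hx).cube, fun x hx => (hone x hx).indep, b1, b3,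
    fun x hx => ?_, f1, fun x hx => ?_, g3⟩
  · rw [flatBracket_swap, h.flatBracket_nilpotent sE ha _ hx, flatBracket_swap _ E,
      flatBracket_swap _ e, b3 x hx, g3 x hx, hE.bracket_mul _ _ sN sN x hx, b2 x hx]
    simp
  · rw [map_sub, map_smul, f1 x hx, f2 x hx]
    simp

/-- If a were zero then E³ = 0, while invertibility of E gives e = E³ ∘ ε³. -/
theorem eigenvalue_ne_zero (h : IsHertlingManinOn m e s) {x ε E : Fin 3 → 𝕜} {a : 𝕜}
    (hone : IsOneBlockAt (m x) (e x) E a) (hx : x ∈ s) (hε : m x E ε = e x) : a ≠ 0 := by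
  rintro rfl
  have hc := hone.cube
  simp only [zero_smul, sub_zero] at hc
  have e0 : m x (m x ε (m x ε ε)) (m x E (m x E E)) =
      m x (m x E ε) (m x (m x E ε) (m x E ε)) := by
    have h1 := h.comm x hx
    have h2 : ∀ v w z, _ := fun v w z => h.left_comm hx v w z
    simp only [h1, h2]
  rw [hc, map_zero, hε, h.unit x hx, h.unit x hx] at e0
  exact one_ne_zero (hone.indep 1 0 0 (by simp [← e0])).1

end IsHertlingManinOn

/-- A bi-flat structure whose operator has a single Jordan block has a nilpotent frame. -/
theorem IsRegularBiFlatOneBlockOn.exists_isNilpotentFrameOn {S : BiFlatData 𝕜 (Fin 3 → 𝕜)}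
    {s : Set (Fin 3 → 𝕜)} (hs : IsOpen s) (h : IsRegularBiFlatOneBlockOn S s) :
    ∃ a : (Fin 3 → 𝕜) → 𝕜, ContDiffOn 𝕜 ∞ a s ∧ (∀ x ∈ s, a x ≠ 0) ∧
      IsHertlingManinOn.IsNilpotentFrameOn (fun x => bilinearCLM (S.mul x)) S.e
        (fun x => (S.E x : Fin 3 → 𝕜) - a x • (S.e x : Fin 3 → 𝕜)) a s := by
  have h1 := h.1.flat1.fmanifold.isHertlingManinOn hs
  have h2 := h.1.flat2.fmanifold.isHertlingManinOn hs
  obtain ⟨ε, -, hε⟩ := h.1.dual_eq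
  have heE : ∀ x ∈ s, flatBracket (S.e : (Fin 3 → 𝕜) → Fin 3 → 𝕜) S.E x = S.e x := fun x hx =>
    (lieB_apply S.e S.E x).symm.trans (h.1.euler x hx)
  have hE : IsHertlingManinOn.IsEulerOn (fun x => bilinearCLM (S.mul x)) S.e S.E s :=
    ⟨h2.smooth_unit, heE, fun Z W hZ hW x hx => h1.flatBracket_euler h2 (fun x hx => (hε x hx).1)
      (fun x hx => (hε x hx).2) heE hZ hW hx⟩
  have ha := h1.contDiffOn_thirdTrace hE.smooth
  have hone : ∀ x ∈ s, _ := fun x hx => SingleJordanBlock.isOneBlockAt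
    (μ := bilinearCLM (S.mul x)) (h.2 x hx) (h1.assoc x hx) (h1.unit x hx) (fun v => h1.mul_unit hx v)
  exact ⟨_, ha, fun x hx => h1.eigenvalue_ne_zero (hone x hx) hx (hε x hx).1,
    h1.isNilpotentFrameOn hE ha hone⟩

end OneBlock

/-! ### Functions with prescribed derivatives along a frame. -/

section Primitive

variable {𝕜 : Type*} [RCLike 𝕜]

/-- The map with given columns. -/
noncomputable def frameMap (Y : Fin 3 → Fin 3 → 𝕜) : (Fin 3 → 𝕜) →L[𝕜] Fin 3 → 𝕜 :=
  ∑ i, (ContinuousLinearMap.proj (R := 𝕜) (φ := fun _ : Fin 3 => 𝕜) i).smulRight (Y i)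

theorem frameMap_apply (Y : Fin 3 → Fin 3 → 𝕜) (c : Fin 3 → 𝕜) :
    frameMap Y c = ∑ i, c i • Y i := by
  simp [frameMap]

theorem frameMap_single (Y : Fin 3 → Fin 3 → 𝕜) (i : Fin 3) : frameMap Y (Pi.single i 1) = Y i := by
  simp [frameMap_apply, Pi.single_apply]

theorem isInvertible_frameMap {Y : Fin 3 → Fin 3 → 𝕜} (h : LinearIndependent 𝕜 Y) :
    (frameMap Y).IsInvertible := by
  have hinj : Function.Injective (frameMap Y).toLinearMap := by
    rw [← LinearMap.ker_eq_bot, LinearMap.ker_eq_bot']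
    intro c hc
    have hc' : ∑ i, c i • Y i = 0 := by rw [← frameMap_apply]; exact hc
    exact funext (Fintype.linearIndependent_iff.1 h c hc')
  refine ⟨(LinearEquiv.ofInjectiveEndo _ hinj).toContinuousLinearEquiv, ?_⟩
  ext v : 1
  rfl

theorem contDiffOn_inverse_frameMap {Y : Fin 3 → (Fin 3 → 𝕜) → Fin 3 → 𝕜} {s : Set (Fin 3 → 𝕜)}
    (hY : ∀ i, ContDiffOn 𝕜 ∞ (Y i) s) (h : ∀ x ∈ s, LinearIndependent 𝕜 fun i => Y i x) :
    ContDiffOn 𝕜 ∞ (fun x => (frameMap fun i => Y i x).inverse) s := fun x hx => by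
  obtain ⟨f, hf⟩ := isInvertible_frameMap (h x hx)
  have h1 : ContDiffOn 𝕜 ∞ (fun x => frameMap fun i => Y i x) s :=
    contDiffOn_clm_apply.2 fun v => by
      simp only [frameMap_apply]
      exact ContDiffOn.sum fun i _ => (hY i).const_smul (v i)
  have h2 : ContDiffAt 𝕜 ∞ ContinuousLinearMap.inverse (frameMap fun i => Y i x) := by
    rw [← hf]; exact contDiffAt_map_inverse f
  exact h2.comp_contDiffWithinAt (E := Fin 3 → 𝕜) (F := (Fin 3 → 𝕜) →L[𝕜] Fin 3 → 𝕜)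
    (G := (Fin 3 → 𝕜) →L[𝕜] Fin 3 → 𝕜) x (h1 x hx)

/-- The covector with given values on a frame. -/
theorem exists_covector {Y : Fin 3 → (Fin 3 → 𝕜) → Fin 3 → 𝕜} {s : Set (Fin 3 → 𝕜)}
    (hY : ∀ i, ContDiffOn 𝕜 ∞ (Y i) s) (h : ∀ x ∈ s, LinearIndependent 𝕜 fun i => Y i x)
    {g : Fin 3 → (Fin 3 → 𝕜) → 𝕜} (hg : ∀ i, ContDiffOn 𝕜 ∞ (g i) s) :
    ∃ θ : (Fin 3 → 𝕜) → (Fin 3 → 𝕜) →L[𝕜] 𝕜, ContDiffOn 𝕜 ∞ θ s ∧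
      ∀ x ∈ s, ∀ i, θ x (Y i x) = g i x := by
  refine ⟨fun x => ∑ i, g i x • (ContinuousLinearMap.proj (R := 𝕜) (φ := fun _ : Fin 3 => 𝕜) i).comp
    (frameMap fun i => Y i x).inverse, contDiffOn_clm_apply.2 fun v => ?_, fun x hx i => ?_⟩
  · have h1 : ContDiffOn 𝕜 ∞ (fun x => (frameMap fun i => Y i x).inverse v) s :=
      (contDiffOn_inverse_frameMap hY h).clm_apply contDiffOn_const
    simp only [sum_apply, smul_apply, ContinuousLinearMap.comp_apply,
      ContinuousLinearMap.proj_apply]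
    exact ContDiffOn.sum fun i _ => (hg i).smul (contDiffOn_pi.1 h1 i)
  · obtain ⟨f, hf⟩ := isInvertible_frameMap (h x hx)
    have h1 : (frameMap fun i => Y i x).inverse (Y i x) = Pi.single i 1 := by
      have h2 := frameMap_single (fun i => Y i x) i
      rw [← hf] at h2 ⊢
      rw [ContinuousLinearMap.inverse_equiv, ← h2]
      exact f.symm_apply_apply _
    simp [h1, Pi.single_apply]

/-- A function with given derivatives along a frame, subject to the integrability condition. -/
theorem exists_primitive {Y : Fin 3 → (Fin 3 → 𝕜) → Fin 3 → 𝕜} {s : Set (Fin 3 → 𝕜)}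
    (hs : IsOpen s) (hconv : Convex ℝ s) (hY : ∀ i, ContDiffOn 𝕜 ∞ (Y i) s)
    (h : ∀ x ∈ s, LinearIndependent 𝕜 fun i => Y i x)
    {g : Fin 3 → (Fin 3 → 𝕜) → 𝕜} (hg : ∀ i, ContDiffOn 𝕜 ∞ (g i) s)
    (hint : ∀ θ : (Fin 3 → 𝕜) → (Fin 3 → 𝕜) →L[𝕜] 𝕜, (∀ x ∈ s, ∀ i, θ x (Y i x) = g i x) →
      ∀ x ∈ s, ∀ i j, fderiv 𝕜 (g j) x (Y i x) - fderiv 𝕜 (g i) x (Y j x) =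
        θ x (flatBracket (Y i) (Y j) x)) :
    ∃ f : (Fin 3 → 𝕜) → 𝕜, ContDiffOn 𝕜 ∞ f s ∧ ∀ x ∈ s, ∀ i, fderiv 𝕜 f x (Y i x) = g i x := by
  obtain ⟨θ, hθ, hθY⟩ := exists_covector hY h hg
  have dθ : ∀ x ∈ s, DifferentiableAt 𝕜 θ x := fun x hx =>
    (hθ.differentiableOn (by simp)).differentiableAt (hs.mem_nhds hx)
  have hclosed : ∀ x ∈ s, ∀ v w, fderiv 𝕜 θ x v w = fderiv 𝕜 θ x w v := by
    intro x hx
    have hder : ∀ i j, fderiv 𝕜 (g j) x (Y i x) =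
        fderiv 𝕜 θ x (Y i x) (Y j x) + θ x (fderiv 𝕜 (Y j) x (Y i x)) := fun i j => by
      have dY : DifferentiableAt 𝕜 (Y j) x :=
        ((hY j).differentiableOn (by simp)).differentiableAt (hs.mem_nhds hx)
      have e1 : (fun y => θ y (Y j y)) =ᶠ[nhds x] g j :=
        Filter.mem_of_superset (hs.mem_nhds hx) fun y hy => hθY y hy j
      rw [← e1.fderiv_eq, ((dθ x hx).hasFDerivAt.clm_apply dY.hasFDerivAt).fderiv]
      simp [add_comm]
    -- Cartan's formula for dθ on two fields of the frame: the hypothesis says exactly that it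
    -- vanishes.
    have hbase : ∀ i j, fderiv 𝕜 θ x (Y i x) (Y j x) = fderiv 𝕜 θ x (Y j x) (Y i x) := fun i j => by
      have := hint θ hθY x hx i j
      rw [hder i j, hder j i, flatBracket, map_sub] at this
      linear_combination this
    obtain ⟨f, hf⟩ := isInvertible_frameMap (h x hx)
    have hspan : ∀ v, ∃ c : Fin 3 → 𝕜, v = ∑ i, c i • Y i x := fun v =>
      ⟨f.symm v, by
        rw [← frameMap_apply (fun i => Y i x), ← hf]; exact (f.apply_symm_apply v).symm⟩
    intro v w
    obtain ⟨c, rfl⟩ := hspan v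
    obtain ⟨d, rfl⟩ := hspan w
    simp only [map_sum, map_smul, sum_apply, smul_apply]
    simp only [Finset.smul_sum]
    rw [Finset.sum_comm]
    refine Finset.sum_congr rfl fun i _ => Finset.sum_congr rfl fun j _ => ?_
    rw [hbase, smul_comm]
  -- Poincaré lemma on a convex set. The form is differentiated over ℝ only; the primitive has the
  -- 𝕜-linear form θ as its derivative and is therefore 𝕜-differentiable.
  obtain ⟨f, hf⟩ := hconv.exists_forall_hasFDerivWithinAt_of_hasFDerivWithinAt_symmetric
    (fun x hx => ((dθ x hx).hasFDerivAt.restrictScalars ℝ).hasFDerivWithinAt)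
    (fun x hx v _ w _ => hclosed x hx v w)
  have hf' : ∀ x ∈ s, HasFDerivAt f (θ x) x := fun x hx => (hf x hx).hasFDerivAt (hs.mem_nhds hx)
  refine ⟨f, (contDiffOn_infty_iff_fderiv_of_isOpen hs).2 ⟨fun x hx =>
    (hf' x hx).differentiableAt.differentiableWithinAt, hθ.congr fun x hx => (hf' x hx).fderiv⟩,
    fun x hx i => ?_⟩
  rw [(hf' x hx).fderiv, hθY x hx]

end Primitive

/-! ### Coordinate functions adapted to the nilpotent frame. -/

section JordanCoordinates

variable {𝕜 : Type*} [RCLike 𝕜]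

namespace IsHertlingManinOn

variable {m : (Fin 3 → 𝕜) → (Fin 3 → 𝕜) →L[𝕜] (Fin 3 → 𝕜) →L[𝕜] Fin 3 → 𝕜}
  {e N : (Fin 3 → 𝕜) → Fin 3 → 𝕜} {s : Set (Fin 3 → 𝕜)} {a : (Fin 3 → 𝕜) → 𝕜}

/-- The three conditions are the integrability conditions for the brackets [e, N] = [e, N ∘ N] = 0
and [N, N ∘ N] = N ∘ N. -/
theorem IsNilpotentFrameOn.exists_primitive (h : IsHertlingManinOn m e s)
    (hN : IsNilpotentFrameOn m e N a s) (hconv : Convex ℝ s) {g : Fin 3 → (Fin 3 → 𝕜) → 𝕜}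
    (hg : ∀ i, ContDiffOn 𝕜 ∞ (g i) s)
    (h01 : ∀ x ∈ s, fderiv 𝕜 (g 1) x (e x) - fderiv 𝕜 (g 0) x (N x) = 0)
    (h02 : ∀ x ∈ s, fderiv 𝕜 (g 2) x (e x) - fderiv 𝕜 (g 0) x (m x (N x) (N x)) = 0)
    (h12 : ∀ x ∈ s, fderiv 𝕜 (g 2) x (N x) - fderiv 𝕜 (g 1) x (m x (N x) (N x)) = g 2 x) :
    ∃ f : (Fin 3 → 𝕜) → 𝕜, ContDiffOn 𝕜 ∞ f s ∧ ∀ x ∈ s, fderiv 𝕜 f x (e x) = g 0 x ∧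
      fderiv 𝕜 f x (N x) = g 1 x ∧ fderiv 𝕜 f x (m x (N x) (N x)) = g 2 x := by
  obtain ⟨f, hf, hfY⟩ := _root_.exists_primitive (Y := ![e, N, fun x => m x (N x) (N x)])
    h.isOpen hconv (fun i => by
      fin_cases i
      exacts [h.smooth_unit, hN.smooth, hN.smooth_sq])
    (fun x hx => Fintype.linearIndependent_iff.2 fun c hc => by
      rw [Fin.sum_univ_three] at hc
      obtain ⟨h0, h1, h2⟩ := hN.indep x hx _ _ _ hc
      intro i; fin_cases i
      exacts [h0, h1, h2]) hg
    (fun θ hθ x hx i j => by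
      have h2 : θ x (m x (N x) (N x)) = g 2 x := hθ x hx 2
      have key : ∀ i j : Fin 3, i < j → fderiv 𝕜 (g j) x ((![e, N, fun x => m x (N x) (N x)] i) x)
          - fderiv 𝕜 (g i) x ((![e, N, fun x => m x (N x) (N x)] j) x) =
          θ x (flatBracket (![e, N, fun x => m x (N x) (N x)] i)
            (![e, N, fun x => m x (N x) (N x)] j) x) := by
        intro i j hij
        fin_cases i <;> fin_cases j <;> simp at hij
        · exact (h01 x hx).trans (by simp [hN.unit_bracket x hx])
        · exact (h02 x hx).trans (by simp [hN.unit_bracket_sq x hx])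
        · exact (h12 x hx).trans (by simp [hN.bracket_sq x hx, h2])
      rcases lt_trichotomy i j with hij | rfl | hij
      · exact key i j hij
      · rw [flatBracket_self, sub_self, map_zero]
      · rw [flatBracket_swap, map_neg, ← key j i hij, neg_sub])
  exact ⟨f, hf, fun x hx => ⟨hfY x hx 0, hfY x hx 1, hfY x hx 2⟩⟩

/-- The target frame is e = ∂₀, N = u 1 ∂₁ + u 2 ∂₂, N ∘ N = (u 1)² ∂₂, which multiplies like
truncated polynomials. The eigenvalue serves as u 0, an exponential as u 1, and u 2 / u 1 is
obtained by a second integration. -/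
theorem IsNilpotentFrameOn.exists_coordinate_functions (h : IsHertlingManinOn m e s)
    (hN : IsNilpotentFrameOn m e N a s) (ha : ContDiffOn 𝕜 ∞ a s) (hconv : Convex ℝ s) :
    ∃ u : (Fin 3 → 𝕜) → Fin 3 → 𝕜, ContDiffOn 𝕜 ∞ u s ∧ ∀ x ∈ s, u x 0 = a x ∧ u x 1 ≠ 0 ∧
      fderiv 𝕜 u x (e x) = ![1, 0, 0] ∧ fderiv 𝕜 u x (N x) = ![0, u x 1, u x 2] ∧
      fderiv 𝕜 u x (m x (N x) (N x)) = ![0, 0, u x 1 ^ 2] := by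
  have hd : ∀ {f : (Fin 3 → 𝕜) → 𝕜}, ContDiffOn 𝕜 ∞ f s → ∀ x ∈ s, DifferentiableAt 𝕜 f x :=
    fun hf x hx => (hf.differentiableOn (by simp)).differentiableAt (h.isOpen.mem_nhds hx)
  -- A logarithm of u 1: it increases at unit rate along N and is constant along e and N ∘ N.
  -- Exponentiating makes u 1 nonzero and N(u 1) = u 1.
  obtain ⟨l, hl, hlY⟩ := hN.exists_primitive h hconv
    (g := ![fun _ => 0, fun _ => 1, fun _ => 0])
    (fun i => by fin_cases i <;> exact contDiffOn_const) (fun x _ => by simp) (fun x _ => by simp)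
    (fun x _ => by simp)
  have hexp : ContDiff 𝕜 ∞ (NormedSpace.exp : 𝕜 → 𝕜) := contDiff_iff_contDiffAt.2 fun x =>
    (NormedSpace.exp_analytic (𝕂 := 𝕜) x).contDiffAt
  have hv : ContDiffOn 𝕜 ∞ (fun x => NormedSpace.exp (l x)) s := hexp.comp_contDiffOn hl
  have hv0 : ∀ x, NormedSpace.exp (l x) ≠ 0 := fun x => (NormedSpace.isUnit_exp (l x)).ne_zero
  have hvd : ∀ x ∈ s, fderiv 𝕜 (fun x => NormedSpace.exp (l x)) x =
      NormedSpace.exp (l x) • fderiv 𝕜 l x := fun x hx =>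
    ((hasDerivAt_exp (𝕂 := 𝕜)).comp_hasFDerivAt x (hd hl x hx).hasFDerivAt).fderiv
  generalize hveq : (fun x => NormedSpace.exp (l x)) = v at hv hvd
  have hvx : ∀ x, NormedSpace.exp (l x) = v x := fun x => by rw [← hveq]
  simp only [hvx] at hv0 hvd
  -- The quotient k = u 2 / u 1: constant along e and N, with derivative v = u 1 along N ∘ N.
  -- Integrability is N(v) = v and e(v) = 0.
  obtain ⟨k, hk, hkY⟩ := hN.exists_primitive h hconv (g := ![fun _ => 0, fun _ => 0, v])
    (fun i => by fin_cases i; exacts [contDiffOn_const, contDiffOn_const, hv])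
    (fun x _ => by simp)
    (fun x hx => by simp [hvd x hx, (hlY x hx).1]) (fun x hx => by simp [hvd x hx, (hlY x hx).2.1])
  have hw := hv.mul hk
  have hwd : ∀ x ∈ s, fderiv 𝕜 (fun x => v x * k x) x = v x • fderiv 𝕜 k x + k x • fderiv 𝕜 v x :=
    fun x hx => fderiv_fun_mul (hd hv x hx) (hd hk x hx)
  refine ⟨fun x => ![a x, v x, v x * k x], contDiffOn_pi.2 fun i => by
    fin_cases i; exacts [ha, hv, hw], fun x hx => ⟨rfl, hv0 x, ?_⟩⟩
  have hu : ∀ w, fderiv 𝕜 (fun x => ![a x, v x, v x * k x]) x w =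
      ![fderiv 𝕜 a x w, fderiv 𝕜 v x w, fderiv 𝕜 (fun x => v x * k x) x w] := fun w => by
    have : HasFDerivAt (fun x => ![a x, v x, v x * k x]) (ContinuousLinearMap.pi
        ![fderiv 𝕜 a x, fderiv 𝕜 v x, fderiv 𝕜 (fun x => v x * k x) x]) x :=
      hasFDerivAt_pi.2 fun i => by
        fin_cases i
        exacts [(hd ha x hx).hasFDerivAt, (hd hv x hx).hasFDerivAt, (hd hw x hx).hasFDerivAt]
    rw [this.fderiv]
    ext i; fin_cases i <;> rfl
  simp only [hu, hwd x hx, hvd x hx, hN.fderiv_unit x hx, hN.fderiv_nilpotent x hx,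
    hN.fderiv_sq x hx, add_apply, smul_apply, (hlY x hx).1, (hlY x hx).2.1, (hlY x hx).2.2,
    (hkY x hx).1, (hkY x hx).2.1, (hkY x hx).2.2]
  refine ⟨?_, ?_, ?_⟩ <;> ext i <;> fin_cases i <;> simp <;> ring

end IsHertlingManinOn

end JordanCoordinates

/-! ### Restriction, the inverse function theorem and boxes. -/

section JordanCoordinates

variable {𝕜 : Type*} [RCLike 𝕜]

section Mono

variable {M : Type*} [TopologicalSpace M] [ChartedSpace (Fin 3 → 𝕜) M] [IsManifold (I3 𝕜) ∞ M]
  {s t : Set M}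

theorem IsFManifoldOn.mono {c : TProduct 𝕜 M} {e : VField 𝕜 M} (h : IsFManifoldOn c e s)
    (hts : t ⊆ s) : IsFManifoldOn c e t where
  smooth_mul := fun U hU => h.smooth_mul U (hU.trans hts)
  smooth_unit := ContMDiffOn.mono h.smooth_unit hts
  comm := fun x hx => h.comm x (hts hx)
  assoc := fun x hx => h.assoc x (hts hx)
  unit := fun x hx => h.unit x (hts hx)
  hertling_manin := fun U hU => h.hertling_manin U (hU.trans hts)

theorem IsFlatFManifoldOn.mono {c : TProduct 𝕜 M} {cov : TConnection 𝕜 M} {e : VField 𝕜 M}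
    (h : IsFlatFManifoldOn c cov e s) (hts : t ⊆ s) : IsFlatFManifoldOn c cov e t where
  fmanifold := h.fmanifold.mono hts
  connection :=
    { connection := h.connection.connection.mono hts
      smooth := fun U hU => h.connection.smooth U (hU.trans hts)
      torsionless := fun U hU => h.connection.torsionless U (hU.trans hts)
      flat := fun U hU => h.connection.flat U (hU.trans hts) }
  compatible := fun U hU => h.compatible U (hU.trans hts)
  flat_unit := fun x hx => h.flat_unit x (hts hx)

theorem IsRegularBiFlatOneBlockOn.mono {S : BiFlatData 𝕜 M} (h : IsRegularBiFlatOneBlockOn S s)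
    (hts : t ⊆ s) : IsRegularBiFlatOneBlockOn S t where
  left :=
    { flat1 := h.1.flat1.mono hts
      dual_eq := by
        obtain ⟨ε, hε, hx⟩ := h.1.dual_eq
        exact ⟨ε, ContMDiffOn.mono hε hts, fun x hxt => hx x (hts hxt)⟩
      euler := fun x hx => h.1.euler x (hts hx)
      flat2 := h.1.flat2.mono hts
      hydro_mul := fun U hU => h.1.hydro_mul U (hU.trans hts)
      hydro_dual := fun U hU => h.1.hydro_dual U (hU.trans hts) }
  right := fun x hx => h.2 x (hts hx)

end Mono

theorem exists_eq_sum_of_linearIndependent {Y : Fin 3 → Fin 3 → 𝕜} (h : LinearIndependent 𝕜 Y)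
    (v : Fin 3 → 𝕜) : ∃ c : Fin 3 → 𝕜, v = ∑ i, c i • Y i := by
  obtain ⟨f, hf⟩ := isInvertible_frameMap h
  exact ⟨f.symm v, by rw [← frameMap_apply, ← hf]; exact (f.apply_symm_apply v).symm⟩

/-- Inverse function theorem, with a prescribed open image. -/
theorem exists_openPartialHomeomorph {u : (Fin 3 → 𝕜) → Fin 3 → 𝕜} {s : Set (Fin 3 → 𝕜)}
    (hs : IsOpen s) (hu : ContDiffOn 𝕜 ∞ u s) {p : Fin 3 → 𝕜} (hp : p ∈ s)
    (hsurj : ∀ x ∈ s, Function.Surjective (fderiv 𝕜 u x)) :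
    ∃ T ∈ nhds (u p), ∀ W ⊆ T, IsOpen W → u p ∈ W →
      ∃ g : OpenPartialHomeomorph (Fin 3 → 𝕜) (Fin 3 → 𝕜), g ∈ contDiffGroupoid ∞ (I3 𝕜) ∧
        p ∈ g.source ∧ g.source ⊆ s ∧ g.target = W ∧ ⇑g = u := by
  have hequiv : ∀ x ∈ s, ∃ f : (Fin 3 → 𝕜) ≃L[𝕜] Fin 3 → 𝕜,
      HasFDerivAt u (f : (Fin 3 → 𝕜) →L[𝕜] Fin 3 → 𝕜) x := fun x hx => by
    have hinj : Function.Injective (fderiv 𝕜 u x).toLinearMap :=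
      LinearMap.injective_iff_surjective.2 (hsurj x hx)
    refine ⟨(LinearEquiv.ofInjectiveEndo _ hinj).toContinuousLinearEquiv, ?_⟩
    exact ((hu.differentiableOn (by simp)).differentiableAt (hs.mem_nhds hx)).hasFDerivAt
  obtain ⟨f, hf⟩ := hequiv p hp
  set g₀ := (hu.contDiffAt (hs.mem_nhds hp)).toOpenPartialHomeomorph u hf (by simp) with hg₀
  have hg₀u : ⇑g₀ = u := rfl
  have hpg : p ∈ g₀.source :=
    (hu.contDiffAt (hs.mem_nhds hp)).mem_toOpenPartialHomeomorph_source hf (by simp)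
  set g₁ := g₀.restrOpen s hs with hg₁
  have hg₁u : ⇑g₁ = u := rfl
  have hpg₁ : p ∈ g₁.source := ⟨hpg, hp⟩
  have hT : u p ∈ g₁.target := g₁.map_source hpg₁
  refine ⟨g₁.target, g₁.open_target.mem_nhds hT, fun W hWT hW hpW =>
    ⟨(g₁.symm.restrOpen W hW).symm, ?_, ?_, ?_, ?_, rfl⟩⟩
  · have htgt : (g₁.symm.restrOpen W hW).symm.target = g₁.target ∩ W := rfl
    have hsrc : (g₁.symm.restrOpen W hW).symm.source ⊆ s := fun x hx => by
      have := (g₁.symm.restrOpen W hW).map_target hx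
      have h2 := hx.1
      exact h2.2
    have h1 : ContDiffOn 𝕜 ∞ (g₁.symm.restrOpen W hW).symm
      (g₁.symm.restrOpen W hW).symm.source := hu.mono hsrc
    have h2 : ContDiffOn 𝕜 ∞ (g₁.symm.restrOpen W hW) (g₁.symm.restrOpen W hW).symm.target :=
      fun y hy => by
        have hy' : y ∈ g₁.target := hWT hy.2
        have hys : g₁.symm y ∈ s := (g₁.map_target hy').2
        obtain ⟨f', hf'⟩ := hequiv _ hys
        exact (g₁.contDiffAt_symm hy' hf' (hu.contDiffAt (hs.mem_nhds hys))).contDiffWithinAt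
    constructor
    · exact h1.mono fun x hx => hx.1
    · exact h2.mono fun x hx => hx.1
  · exact ⟨hpg₁, by
      have : u p ∈ W := hpW
      exact this⟩
  · exact fun x hx => hx.1.2
  · exact Set.inter_eq_right.2 hWT

/-- A neighbourhood of a point contains a box in the coordinates `u⁰`, `u¹`, `u² / u¹`. -/
theorem exists_box {T : Set (Fin 3 → 𝕜)} {q : Fin 3 → 𝕜} (hT : T ∈ nhds q) (h0 : q 0 ≠ 0)
    (h1 : q 1 ≠ 0) : ∃ r > 0, (∀ t ∈ Metric.ball (q 0) r, t ≠ 0) ∧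
      (∀ t ∈ Metric.ball (q 1) r, t ≠ 0) ∧
      ∀ u : Fin 3 → 𝕜, u 0 ∈ Metric.ball (q 0) r → u 1 ∈ Metric.ball (q 1) r →
        u 2 / u 1 ∈ Metric.ball (q 2 / q 1) r → u ∈ T := by
  have hT' : T ∩ ({u | u 0 ≠ 0} ∩ {u | u 1 ≠ 0}) ∈ nhds q := by
    have o0 : IsOpen {u : Fin 3 → 𝕜 | u 0 ≠ 0} := isOpen_ne_fun (by fun_prop) (by fun_prop)
    have o1 : IsOpen {u : Fin 3 → 𝕜 | u 1 ≠ 0} := isOpen_ne_fun (by fun_prop) (by fun_prop)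
    exact Filter.inter_mem hT (Filter.inter_mem (o0.mem_nhds h0) (o1.mem_nhds h1))
  -- This map undoes passing to the quotient: a ball around (q 0, q 1, q 2 / q 1) becomes a box in u
  -- 0, u 1 and u 2 / u 1.
  have hκ : Continuous fun w : Fin 3 → 𝕜 => ![w 0, w 1, w 1 * w 2] := by fun_prop
  have hq : ![q 0, q 1, q 1 * (q 2 / q 1)] = q := by
    ext i; fin_cases i <;> simp [mul_div_cancel₀ _ h1]
  have hpre : (fun w : Fin 3 → 𝕜 => ![w 0, w 1, w 1 * w 2]) ⁻¹'
      (T ∩ ({u | u 0 ≠ 0} ∩ {u | u 1 ≠ 0})) ∈ nhds ![q 0, q 1, q 2 / q 1] := by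
    refine hκ.continuousAt.preimage_mem_nhds ?_
    have : ![(![q 0, q 1, q 2 / q 1] : Fin 3 → 𝕜) 0, (![q 0, q 1, q 2 / q 1] : Fin 3 → 𝕜) 1,
        (![q 0, q 1, q 2 / q 1] : Fin 3 → 𝕜) 1 * (![q 0, q 1, q 2 / q 1] : Fin 3 → 𝕜) 2] = q := hq
    rw [this]
    exact hT'
  obtain ⟨r, hr, hball⟩ := Metric.mem_nhds_iff.1 hpre
  have hmem : ∀ t0 ∈ Metric.ball (q 0) r, ∀ t1 ∈ Metric.ball (q 1) r,
      ∀ t2 ∈ Metric.ball (q 2 / q 1) r, ![t0, t1, t1 * t2] ∈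
        T ∩ ({u | u 0 ≠ 0} ∩ {u | u 1 ≠ 0}) := fun t0 ht0 t1 ht1 t2 ht2 => by
    refine hball (a := ![t0, t1, t2]) ((dist_pi_lt_iff hr).2 fun i => ?_)
    fin_cases i
    exacts [ht0, ht1, ht2]
  refine ⟨r, hr, fun t ht => (hmem t ht _ (Metric.mem_ball_self hr) _
    (Metric.mem_ball_self hr)).2.1, fun t ht => (hmem _ (Metric.mem_ball_self hr) t ht _
    (Metric.mem_ball_self hr)).2.2, fun u hu0 hu1 hu2 => ?_⟩
  have h := hmem _ hu0 _ hu1 _ hu2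
  have hu1' : u 1 ≠ 0 := h.2.2
  have e : ![u 0, u 1, u 1 * (u 2 / u 1)] = u := by
    ext i; fin_cases i <;> simp [mul_div_cancel₀ _ hu1']
  rw [e] at h
  exact h.1

end JordanCoordinates

/-! ### Jordan coordinates of a bi-flat structure. -/

section JordanCoordinates

variable {𝕜 : Type*} [RCLike 𝕜]

namespace IsHertlingManinOn

variable {m : (Fin 3 → 𝕜) → (Fin 3 → 𝕜) →L[𝕜] (Fin 3 → 𝕜) →L[𝕜] Fin 3 → 𝕜}
  {e N : (Fin 3 → 𝕜) → Fin 3 → 𝕜} {s : Set (Fin 3 → 𝕜)} {a : (Fin 3 → 𝕜) → 𝕜}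

/-- A linear map with the values of a Jordan coordinate system on the frame is an isomorphism of
algebras. -/
theorem IsNilpotentFrameOn.map_mul (h : IsHertlingManinOn m e s) (hN : IsNilpotentFrameOn m e N a s)
    {x : Fin 3 → 𝕜} (hx : x ∈ s) {L : (Fin 3 → 𝕜) →L[𝕜] Fin 3 → 𝕜} {b c : 𝕜}
    (h0 : L (e x) = ![1, 0, 0]) (h1 : L (N x) = ![0, b, c])
    (h2 : L (m x (N x) (N x)) = ![0, 0, b ^ 2]) (v w : Fin 3 → 𝕜) :
    L (m x v w) = jetMulL 𝕜 (L v) (L w) := by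
  have hspan : ∀ v, ∃ d : Fin 3 → 𝕜, v = d 0 • e x + d 1 • N x + d 2 • m x (N x) (N x) := fun v => by
    obtain ⟨d, hd⟩ := exists_eq_sum_of_linearIndependent (Y := ![e x, N x, m x (N x) (N x)])
      (Fintype.linearIndependent_iff.2 fun c hc => by
        rw [Fin.sum_univ_three] at hc
        obtain ⟨h0, h1, h2⟩ := hN.indep x hx _ _ _ hc
        intro i; fin_cases i
        exacts [h0, h1, h2]) v
    exact ⟨d, by rw [hd, Fin.sum_univ_three]; rfl⟩
  obtain ⟨d, rfl⟩ := hspan v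
  obtain ⟨d', rfl⟩ := hspan w
  have hc := hN.cube x hx
  have hc' : m x (m x (N x) (N x)) (N x) = 0 := by rw [h.assoc x hx, hc]
  have hc2 : m x (m x (N x) (N x)) (m x (N x) (N x)) = 0 := by rw [h.assoc x hx, hc, map_zero]
  simp only [map_add, map_smul, add_apply, smul_apply, h.unit x hx, h.mul_unit hx, hc, hc', hc2,
    smul_zero, add_zero, h0, h1, h2]
  ext i; fin_cases i <;> 
    simp [jetMulL_apply, -mul_eq_mul_left_iff, -mul_eq_mul_right_iff] <;> ring

end IsHertlingManinOn

theorem surjective_of_triangular {L : (Fin 3 → 𝕜) →L[𝕜] Fin 3 → 𝕜} {v₀ v₁ v₂ : Fin 3 → 𝕜} {b c : 𝕜}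
    (hb : b ≠ 0) (h0 : L v₀ = ![1, 0, 0]) (h1 : L v₁ = ![0, b, c]) (h2 : L v₂ = ![0, 0, b ^ 2]) :
    Function.Surjective L := fun w => by
  refine ⟨w 0 • v₀ + (w 1 / b) • v₁ + ((w 2 - w 1 / b * c) / b ^ 2) • v₂, ?_⟩
  rw [map_add, map_add, map_smul, map_smul, map_smul, h0, h1, h2]
  ext i; fin_cases i <;> simp [hb]

theorem map_euler_of_map_nilpotent {L : (Fin 3 → 𝕜) →L[𝕜] Fin 3 → 𝕜} {e E : Fin 3 → 𝕜} {a b c : 𝕜}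
    (h0 : L e = ![1, 0, 0]) (h1 : L (E - a • e) = ![0, b, c]) : L E = ![a, b, c] := by
  have h : L E = L (E - a • e) + a • L e := by rw [map_sub, map_smul, sub_add_cancel]
  rw [h, h0, h1]
  ext i; fin_cases i <;> simp

/-- Jordan coordinates of a bi-flat structure on an open set of `𝕜³`. -/
theorem IsRegularBiFlatOneBlockOn.exists_jordanCoordinates {S : BiFlatData 𝕜 (Fin 3 → 𝕜)}
    {s : Set (Fin 3 → 𝕜)} (hs : IsOpen s) (h : IsRegularBiFlatOneBlockOn S s) {p : Fin 3 → 𝕜}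
    (hp : p ∈ s) : ∃ g : OpenPartialHomeomorph (Fin 3 → 𝕜) (Fin 3 → 𝕜),
      g ∈ contDiffGroupoid ∞ (I3 𝕜) ∧ p ∈ g.source ∧ g.source ⊆ s ∧
      (∀ x ∈ g.source, fderiv 𝕜 g x (S.e x) = Pi.single 0 1 ∧ fderiv 𝕜 g x (S.E x) = g x ∧
        ∀ v w : Fin 3 → 𝕜, fderiv 𝕜 g x (S.mul x v w) =
          jetMulL 𝕜 (fderiv 𝕜 g x v) (fderiv 𝕜 g x w)) ∧
      ∃ q : Fin 3 → 𝕜, ∃ r > 0, (∀ t ∈ Metric.ball (q 0) r, t ≠ 0) ∧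
        (∀ t ∈ Metric.ball (q 1) r, t ≠ 0) ∧
        g.target = {u | u 0 ∈ Metric.ball (q 0) r ∧ u 1 ∈ Metric.ball (q 1) r ∧
          u 2 / u 1 ∈ Metric.ball (q 2 / q 1) r} := by
  -- Shrinking to a ball supplies the convexity needed to integrate the frame.
  obtain ⟨ρ, hρ, hball⟩ := Metric.isOpen_iff.1 hs p hp
  have hB := h.mono hball
  have hBo : IsOpen (Metric.ball p ρ) := Metric.isOpen_ball
  have hm := hB.1.flat1.fmanifold.isHertlingManinOn hBo
  obtain ⟨a, ha, ha0, hN⟩ := hB.exists_isNilpotentFrameOn hBo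
  obtain ⟨u, hu, hux⟩ := hN.exists_coordinate_functions hm ha (convex_ball p ρ)
  have hpB := Metric.mem_ball_self (x := p) hρ
  obtain ⟨T, hT, hg⟩ := exists_openPartialHomeomorph hBo hu hpB fun x hx w => by
    obtain ⟨-, h1, e0, e1, e2⟩ := hux x hx
    exact surjective_of_triangular h1 e0 e1 e2 w
  obtain ⟨h0, h1, -⟩ := hux p hpB
  obtain ⟨r, hr, hr0, hr1, hbox⟩ := exists_box hT (h0 ▸ ha0 p hpB) h1
  have hWo : IsOpen {v : Fin 3 → 𝕜 | v 0 ∈ Metric.ball (u p 0) r ∧ v 1 ∈ Metric.ball (u p 1) r ∧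
      v 2 / v 1 ∈ Metric.ball (u p 2 / u p 1) r} := by
    have o0 : IsOpen {v : Fin 3 → 𝕜 | v 0 ∈ Metric.ball (u p 0) r} :=
      Metric.isOpen_ball.preimage (continuous_apply 0)
    have o1 : IsOpen {v : Fin 3 → 𝕜 | v 1 ∈ Metric.ball (u p 1) r} :=
      Metric.isOpen_ball.preimage (continuous_apply 1)
    have := (o0.inter o1).inter (isOpen_modelRegion (𝕜 := 𝕜)
      (Metric.isOpen_ball (x := u p 2 / u p 1) (ε := r)))
    convert! this using 1
    ext v
    exact ⟨fun hv => ⟨⟨hv.1, hv.2.1⟩, hr0 _ hv.1, hr1 _ hv.2.1, hv.2.2⟩,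
      fun hv => ⟨hv.1.1, hv.1.2, hv.2.2.2⟩⟩
  obtain ⟨g, hgG, hpg, hgs, hgt, hgu⟩ := hg _ (fun v hv => hbox v hv.1 hv.2.1 hv.2.2) hWo
    ⟨Metric.mem_ball_self hr, Metric.mem_ball_self hr, Metric.mem_ball_self hr⟩
  refine ⟨g, hgG, hpg, hgs.trans hball, fun x hx => ?_, u p, r, hr, hr0, hr1, hgt⟩
  obtain ⟨f0, -, e0, e1, e2⟩ := hux x (hgs hx)
  rw [hgu]
  refine ⟨e0.trans ?_, ?_, hN.map_mul hm (hgs hx) e0 e1 e2⟩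
  · ext i; fin_cases i <;> rfl
  · refine (map_euler_of_map_nilpotent e0 e1).trans ?_
    ext i; fin_cases i
    exacts [f0.symm, rfl, rfl]

end JordanCoordinates

/-! ### Christoffel symbols of an abstract connection on 𝕜³. -/

section Christoffel

variable {𝕜 : Type*} [RCLike 𝕜]

theorem mdifferentiableAt_of_contDiffOn {Y : (Fin 3 → 𝕜) → Fin 3 → 𝕜} {U : Set (Fin 3 → 𝕜)}
    (hU : IsOpen U) (hY : ContDiffOn 𝕜 ∞ Y U) {x : Fin 3 → 𝕜} (hx : x ∈ U) :
    MDifferentiableAt (I3 𝕜) (I3 𝕜).tangent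
      (fun y => (⟨y, Y y⟩ : TangentBundle (I3 𝕜) (Fin 3 → 𝕜))) x :=
  ((smoothField_iff_contDiffOn.2 hY).contMDiffAt (hU.mem_nhds hx)).mdifferentiableAt (by simp)

/-- The Christoffel map of a connection on `𝕜³`. -/
noncomputable def christoffelMap (cov : TConnection 𝕜 (Fin 3 → 𝕜)) (x : Fin 3 → 𝕜) :
    (Fin 3 → 𝕜) →L[𝕜] (Fin 3 → 𝕜) →L[𝕜] Fin 3 → 𝕜 :=
  (∑ i, (ContinuousLinearMap.proj (R := 𝕜) (φ := fun _ : Fin 3 => 𝕜) i).smulRight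
    (cov (fun _ => (Pi.single i 1 : Fin 3 → 𝕜)) x : (Fin 3 → 𝕜) →L[𝕜] Fin 3 → 𝕜)).flip

theorem christoffelMap_apply (cov : TConnection 𝕜 (Fin 3 → 𝕜)) (x v w : Fin 3 → 𝕜) :
    christoffelMap cov x v w =
      ∑ i, w i • (cov (fun _ => (Pi.single i 1 : Fin 3 → 𝕜)) x v : Fin 3 → 𝕜) := by
  have key : ∀ A : Fin 3 → (Fin 3 → 𝕜) →L[𝕜] Fin 3 → 𝕜,
      (∑ i, (ContinuousLinearMap.proj (R := 𝕜) (φ := fun _ : Fin 3 => 𝕜) i).smulRight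
        (A i)).flip v w = ∑ i, w i • A i v := fun A => by
    simp
  exact key _

/-- Y is a combination of the three constant fields with its components as coefficients; additivity
and the Leibniz rule do the rest. -/
theorem IsCovariantDerivativeOn.eq_christoffelMap {cov : TConnection 𝕜 (Fin 3 → 𝕜)}
    {s : Set (Fin 3 → 𝕜)} (h : IsCovariantDerivativeOn (I := I3 𝕜) (Fin 3 → 𝕜) cov s)
    {U : Set (Fin 3 → 𝕜)} (hU : IsOpen U) {Y : (Fin 3 → 𝕜) → Fin 3 → 𝕜} (hY : ContDiffOn 𝕜 ∞ Y U)
    {x : Fin 3 → 𝕜} (hx : x ∈ U) (hxs : x ∈ s) (v : Fin 3 → 𝕜) :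
    (cov Y x v : Fin 3 → 𝕜) = fderiv 𝕜 Y x v + christoffelMap cov x v (Y x) := by
  set σ : Fin 3 → (Fin 3 → 𝕜) → Fin 3 → 𝕜 := fun i _ => Pi.single i 1 with hσ
  set f : Fin 3 → (Fin 3 → 𝕜) → 𝕜 := fun i y => Y y i with hf
  have hYi : ∀ i, ContDiffOn 𝕜 ∞ (f i) U := fun i => contDiffOn_pi.1 hY i
  have df : ∀ i, DifferentiableAt 𝕜 (f i) x := fun i =>
    ((hYi i).differentiableOn (by simp)).differentiableAt (hU.mem_nhds hx)
  have hterm : ∀ i, ContDiffOn 𝕜 ∞ (fun y => f i y • σ i y) U := fun i =>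
    (hYi i).smul contDiffOn_const
  have hm := fun i => mdifferentiableAt_of_contDiffOn hU (hterm i) hx
  have hsum : ∀ y, Y y = (f 0 y • σ 0 y + f 1 y • σ 1 y) + f 2 y • σ 2 y := fun y => by
    ext i; fin_cases i <;> simp [hf, hσ]
  have h01 : ContDiffOn 𝕜 ∞ (fun y => f 0 y • σ 0 y + f 1 y • σ 1 y) U := (hterm 0).add (hterm 1)
  have e1 : cov Y x = cov (fun y => f 0 y • σ 0 y + f 1 y • σ 1 y) x
      + cov (fun y => f 2 y • σ 2 y) x := by
    rw [← h.add (mdifferentiableAt_of_contDiffOn hU h01 hx) (hm 2) hxs]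
    exact congrArg (fun Z : (Fin 3 → 𝕜) → Fin 3 → 𝕜 => cov Z x) (funext hsum)
  have e2 : cov (fun y => f 0 y • σ 0 y + f 1 y • σ 1 y) x = cov (fun y => f 0 y • σ 0 y) x
      + cov (fun y => f 1 y • σ 1 y) x := h.add (hm 0) (hm 1) hxs
  let C : ((Fin 3 → 𝕜) → Fin 3 → 𝕜) → (Fin 3 → 𝕜) := fun Z => cov Z x v
  have e3 : ∀ i, C (fun y => f i y • σ i y) = f i x • C (σ i)
      + fderiv 𝕜 (f i) x v • (Pi.single i 1 : Fin 3 → 𝕜) := fun i => by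
    have := h.leibniz (σ := σ i) (g := f i)
      (mdifferentiableAt_of_contDiffOn isOpen_univ contDiffOn_const (Set.mem_univ x))
      (mdifferentiableAt_iff_differentiableAt.2 (df i)) hxs
    have e := congrArg (fun L => L v) this
    refine e.trans ?_
    have e' := mvfderiv_eq_fderiv (f i) x v
    exact congrArg (fun t => f i x • C (σ i) + t • (Pi.single i 1 : Fin 3 → 𝕜)) e'
  have kadd : ∀ P Q A B D : (Fin 3 → 𝕜) →L[𝕜] Fin 3 → 𝕜, P = Q + D → Q = A + B →
      P v = A v + B v + D v := by
    rintro P Q A B D rfl rfl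
    rfl
  have e4 : C Y = (C (fun y => f 0 y • σ 0 y) + C (fun y => f 1 y • σ 1 y))
      + C (fun y => f 2 y • σ 2 y) :=
    kadd _ _ _ _ _ e1 e2
  have e5 : fderiv 𝕜 Y x v = ∑ i, fderiv 𝕜 (f i) x v • (Pi.single i 1 : Fin 3 → 𝕜) := by
    have : HasFDerivAt Y (ContinuousLinearMap.pi fun i => fderiv 𝕜 (f i) x) x :=
      hasFDerivAt_pi.2 fun i => (df i).hasFDerivAt
    rw [this.fderiv]
    ext i
    simp [Finset.sum_apply, Pi.single_apply]
  have e6 : christoffelMap cov x v (Y x) = ∑ i, f i x • C (σ i) := christoffelMap_apply cov x v (Y x)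
  have e7 : C Y = fderiv 𝕜 Y x v + christoffelMap cov x v (Y x) := by
    rw [e4, e3, e3, e3, e5, e6, Fin.sum_univ_three, Fin.sum_univ_three]
    abel
  exact e7

theorem christoffelMap_eq_cov {cov : TConnection 𝕜 (Fin 3 → 𝕜)} {s : Set (Fin 3 → 𝕜)}
    (h : IsCovariantDerivativeOn (I := I3 𝕜) (Fin 3 → 𝕜) cov s) {x : Fin 3 → 𝕜} (hx : x ∈ s)
    (v w : Fin 3 → 𝕜) : (cov (fun _ => w) x v : Fin 3 → 𝕜) = christoffelMap cov x v w := by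
  have h0 : fderiv 𝕜 (fun _ : Fin 3 → 𝕜 => w) x v = 0 := by simp
  have h1 := h.eq_christoffelMap isOpen_univ contDiffOn_const (Set.mem_univ x) hx
    (Y := fun _ => w) v
  rw [h0, zero_add] at h1
  exact h1

namespace IsFlatConnectionOn

variable {cov : TConnection 𝕜 (Fin 3 → 𝕜)} {s : Set (Fin 3 → 𝕜)}

theorem contDiffOn_christoffelMap (h : IsFlatConnectionOn cov s) (hs : IsOpen s) :
    ContDiffOn 𝕜 ∞ (christoffelMap cov) s :=
  contDiffOn_clm_apply.2 fun v => contDiffOn_clm_apply.2 fun w => by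
    have := smoothField_iff_contDiffOn.1 (h.smooth s subset_rfl hs (fun _ => v) (fun _ => w)
      (smoothField_iff_contDiffOn.2 contDiffOn_const)
      (smoothField_iff_contDiffOn.2 contDiffOn_const))
    exact this.congr fun x hx => (christoffelMap_eq_cov h.connection hx v w).symm

theorem christoffelMap_comm (h : IsFlatConnectionOn cov s) (hs : IsOpen s) {x : Fin 3 → 𝕜}
    (hx : x ∈ s) (v w : Fin 3 → 𝕜) : christoffelMap cov x v w = christoffelMap cov x w v := by
  have h0 : ∀ v w : Fin 3 → 𝕜, fderiv 𝕜 (fun _ : Fin 3 → 𝕜 => w) x v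
      - fderiv 𝕜 (fun _ : Fin 3 → 𝕜 => v) x w = 0 := by simp
  have h1 := h.torsionless s subset_rfl hs (fun _ => v) (fun _ => w)
    (smoothField_iff_contDiffOn.2 contDiffOn_const)
    (smoothField_iff_contDiffOn.2 contDiffOn_const) x hx
  have h2 := lieB_apply (fun _ => v) (fun _ => w) x
  have h3 : (cov (fun _ => w) x v : Fin 3 → 𝕜) - (cov (fun _ => v) x w : Fin 3 → 𝕜) = 0 :=
    (h1.trans h2).trans (h0 v w)
  rw [christoffelMap_eq_cov h.connection hx, christoffelMap_eq_cov h.connection hx] at h3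
  exact sub_eq_zero.1 h3

/-- Flatness is evaluated on constant fields, whose brackets vanish. -/
theorem christoffelMap_curvature (h : IsFlatConnectionOn cov s) (hs : IsOpen s) {x : Fin 3 → 𝕜}
    (hx : x ∈ s) (k v w : Fin 3 → 𝕜) :
    fderiv 𝕜 (christoffelMap cov) x k v w - fderiv 𝕜 (christoffelMap cov) x v k w
      + christoffelMap cov x k (christoffelMap cov x v w)
      - christoffelMap cov x v (christoffelMap cov x k w) = 0 := by
  have hG := h.contDiffOn_christoffelMap hs
  have dG := (hG.differentiableOn (by simp)).differentiableAt (hs.mem_nhds hx)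
  have hc : ∀ v w : Fin 3 → 𝕜, ContDiffOn 𝕜 ∞ (fun y => christoffelMap cov y v w) s := fun v w =>
    (hG.clm_apply contDiffOn_const).clm_apply contDiffOn_const
  have hd : ∀ v w k : Fin 3 → 𝕜, fderiv 𝕜 (fun y => christoffelMap cov y v w) x k =
      fderiv 𝕜 (christoffelMap cov) x k v w := fun v w k => by
    have := ((dG.hasFDerivAt.clm_apply (hasFDerivAt_const v x)).clm_apply
      (hasFDerivAt_const w x)).fderiv
    rw [this]; simp
  have h0 : ∀ v w : Fin 3 → 𝕜, fderiv 𝕜 (fun _ : Fin 3 → 𝕜 => w) x v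
      - fderiv 𝕜 (fun _ : Fin 3 → 𝕜 => v) x w = 0 := by simp
  have h1 := h.flat s subset_rfl hs (fun _ => k) (fun _ => v) (fun _ => w)
    (smoothField_iff_contDiffOn.2 contDiffOn_const)
    (smoothField_iff_contDiffOn.2 contDiffOn_const)
    (smoothField_iff_contDiffOn.2 contDiffOn_const) x hx
  have hsm : ∀ v, ContDiffOn 𝕜 ∞ (fun y => (cov (fun _ => w) y v : Fin 3 → 𝕜)) s := fun v =>
    (hc v w).congr fun y hy => christoffelMap_eq_cov h.connection hy v w
  have h2 : ∀ v k : Fin 3 → 𝕜, (cov (fun y => (cov (fun _ => w) y v : Fin 3 → 𝕜)) x k : Fin 3 → 𝕜) =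
      fderiv 𝕜 (christoffelMap cov) x k v w
        + christoffelMap cov x k (christoffelMap cov x v w) := fun v k => by
    have e : (fun y => (cov (fun _ => w) y v : Fin 3 → 𝕜)) =ᶠ[nhds x]
        fun y => christoffelMap cov y v w := Filter.mem_of_superset (hs.mem_nhds hx)
      fun y hy => christoffelMap_eq_cov h.connection hy v w
    rw [h.connection.eq_christoffelMap hs (hsm v) hx hx, e.fderiv_eq, hd,
      christoffelMap_eq_cov h.connection hx]
  have h3 : (lieB (𝕜 := 𝕜) (M := Fin 3 → 𝕜) (fun _ => k) (fun _ => v) x : Fin 3 → 𝕜) = 0 :=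
    (lieB_apply (fun _ => k) (fun _ => v) x).trans (h0 k v)
  have h4 : (cov (fun y => (cov (fun _ => w) y v : Fin 3 → 𝕜)) x k : Fin 3 → 𝕜)
      - (cov (fun y => (cov (fun _ => w) y k : Fin 3 → 𝕜)) x v : Fin 3 → 𝕜)
      - (cov (fun _ => w) x (lieB (𝕜 := 𝕜) (M := Fin 3 → 𝕜) (fun _ => k) (fun _ => v) x) :
        Fin 3 → 𝕜) = 0 := h1
  have h5 : (cov (fun _ => w) x (lieB (𝕜 := 𝕜) (M := Fin 3 → 𝕜) (fun _ => k) (fun _ => v) x) :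
        Fin 3 → 𝕜) = 0 :=
    (congrArg (cov (fun _ => w) x : (Fin 3 → 𝕜) →L[𝕜] Fin 3 → 𝕜) h3).trans (map_zero _)
  have key : ∀ A B C D Z : Fin 3 → 𝕜, A + C - (B + D) - Z = 0 → Z = 0 → A - B + C - D = 0 := by
    rintro A B C D Z h rfl
    rw [← h]
    abel
  rw [h2, h2] at h4
  exact key _ _ _ _ _ h4 h5

end IsFlatConnectionOn

end Christoffel

/-! ### Bi-flat structures in Jordan coordinates. -/

section JordanForm

variable {𝕜 : Type*} [RCLike 𝕜]

/-- The standard coordinates are Jordan coordinates on `W`: `e = ∂₁`, `E` is the position field, and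
the product is multiplication of truncated polynomials. -/
structure IsJordanFormOn (S : BiFlatData 𝕜 (Fin 3 → 𝕜)) (W : Set (Fin 3 → 𝕜)) : Prop where
  unit : ∀ x ∈ W, (S.e x : Fin 3 → 𝕜) = Pi.single 0 1
  euler : ∀ x ∈ W, (S.E x : Fin 3 → 𝕜) = x
  mul : ∀ x ∈ W, ∀ v w : Fin 3 → 𝕜, (S.mul x v w : Fin 3 → 𝕜) = jetMulL 𝕜 v w

theorem smoothField_const (v : Fin 3 → 𝕜) (U : Set (Fin 3 → 𝕜)) :
    SmoothField (𝕜 := 𝕜) (M := Fin 3 → 𝕜) (fun _ => v) U :=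
  smoothField_iff_contDiffOn.2 contDiffOn_const

theorem IsCovariantDerivativeOn.eq_of_eqOn_const {cov : TConnection 𝕜 (Fin 3 → 𝕜)}
    {s : Set (Fin 3 → 𝕜)} (h : IsCovariantDerivativeOn (I := I3 𝕜) (Fin 3 → 𝕜) cov s)
    (hs : IsOpen s) {Y : (Fin 3 → 𝕜) → Fin 3 → 𝕜} {w : Fin 3 → 𝕜} (hY : ∀ x ∈ s, Y x = w)
    {x : Fin 3 → 𝕜} (hx : x ∈ s) (v : Fin 3 → 𝕜) :
    (cov Y x v : Fin 3 → 𝕜) = christoffelMap cov x v w := by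
  have he : Y =ᶠ[nhds x] fun _ => w := Filter.mem_of_superset (hs.mem_nhds hx) hY
  have h1 := h.eq_christoffelMap hs (contDiffOn_const.congr hY) hx hx v
  have h0 : fderiv 𝕜 Y x v = 0 := by rw [he.fderiv_eq]; simp
  rw [h0, zero_add, hY x hx] at h1
  exact h1

theorem IsCovariantDerivativeOn.eq_of_eqOn_id {cov : TConnection 𝕜 (Fin 3 → 𝕜)}
    {s : Set (Fin 3 → 𝕜)} (h : IsCovariantDerivativeOn (I := I3 𝕜) (Fin 3 → 𝕜) cov s)
    (hs : IsOpen s) {Y : (Fin 3 → 𝕜) → Fin 3 → 𝕜} (hY : ∀ x ∈ s, Y x = x)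
    {x : Fin 3 → 𝕜} (hx : x ∈ s) (v : Fin 3 → 𝕜) :
    (cov Y x v : Fin 3 → 𝕜) = v + christoffelMap cov x v x := by
  have he : Y =ᶠ[nhds x] fun y => y := Filter.mem_of_superset (hs.mem_nhds hx) hY
  have h1 := h.eq_christoffelMap hs (contDiffOn_id.congr hY) hx hx v
  have h0 : fderiv 𝕜 Y x v = v := by rw [he.fderiv_eq]; simp
  rw [h0, hY x hx] at h1
  exact h1

namespace IsBiFlatOn

variable {S : BiFlatData 𝕜 (Fin 3 → 𝕜)} {W : Set (Fin 3 → 𝕜)}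

theorem christoffelMap_unit (h : IsBiFlatOn S W) (hJ : IsJordanFormOn S W) (hW : IsOpen W)
    {x : Fin 3 → 𝕜} (hx : x ∈ W) (v : Fin 3 → 𝕜) :
    christoffelMap S.cov1 x v (Pi.single 0 1) = 0 :=
  (h.flat1.connection.connection.eq_of_eqOn_const hW (fun y hy => hJ.unit y hy) hx v).symm.trans
    (h.flat1.flat_unit x hx v)

theorem christoffelMap_euler (h : IsBiFlatOn S W) (hJ : IsJordanFormOn S W) (hW : IsOpen W)
    {x : Fin 3 → 𝕜} (hx : x ∈ W) (v : Fin 3 → 𝕜) :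
    v + christoffelMap S.cov2 x v x = 0 :=
  (h.flat2.connection.connection.eq_of_eqOn_id hW (fun y hy => hJ.euler y hy) hx v).symm.trans
    (h.flat2.flat_unit x hx v)

theorem christoffelMap_compatible (h : IsBiFlatOn S W) (hJ : IsJordanFormOn S W) (hW : IsOpen W)
    {x : Fin 3 → 𝕜} (hx : x ∈ W) (a b c : Fin 3 → 𝕜) :
    christoffelMap S.cov1 x a (jetMulL 𝕜 b c) - jetMulL 𝕜 (christoffelMap S.cov1 x a b) c
        - jetMulL 𝕜 b (christoffelMap S.cov1 x a c) =
      christoffelMap S.cov1 x b (jetMulL 𝕜 a c) - jetMulL 𝕜 (christoffelMap S.cov1 x b a) c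
        - jetMulL 𝕜 a (christoffelMap S.cov1 x b c) := by
  have hc := h.flat1.connection.connection
  have h1 := h.flat1.compatible W subset_rfl hW (fun _ => a) (fun _ => b) (fun _ => c)
    (smoothField_const a W) (smoothField_const b W) (smoothField_const c W) x hx
  have key : ∀ a b : Fin 3 → 𝕜, (S.cov1.derivProduct S.mul (fun _ => a) (fun _ => b)
      (fun _ => c) x : Fin 3 → 𝕜) = christoffelMap S.cov1 x a (jetMulL 𝕜 b c)
        - jetMulL 𝕜 (christoffelMap S.cov1 x a b) c
        - jetMulL 𝕜 b (christoffelMap S.cov1 x a c) := fun a b => by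
    have h2 : (S.cov1 (S.mul.app (fun _ => b) (fun _ => c)) x a : Fin 3 → 𝕜) =
        christoffelMap S.cov1 x a (jetMulL 𝕜 b c) :=
      hc.eq_of_eqOn_const hW (fun y hy => hJ.mul y hy b c) hx a
    have h3 : (S.mul x (S.cov1 (fun _ => b) x a) c : Fin 3 → 𝕜) =
        jetMulL 𝕜 (christoffelMap S.cov1 x a b) c :=
      (hJ.mul x hx _ c).trans (congrArg (fun t => jetMulL 𝕜 t c) (christoffelMap_eq_cov hc hx a b))
    have h4 : (S.mul x b (S.cov1 (fun _ => c) x a) : Fin 3 → 𝕜) =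
        jetMulL 𝕜 b (christoffelMap S.cov1 x a c) :=
      (hJ.mul x hx b _).trans (congrArg (fun t => jetMulL 𝕜 b t) (christoffelMap_eq_cov hc hx a c))
    have sub3 : ∀ P Q R P' Q' R' : Fin 3 → 𝕜, P = P' → Q = Q' → R = R' →
        P - Q - R = P' - Q' - R' := by
      rintro P Q R _ _ _ rfl rfl rfl; rfl
    exact sub3 _ _ _ _ _ _ h2 h3 h4
  exact (key a b).symm.trans (h1.trans (key b a))

/-- The equality of exterior derivatives on constant fields, with e in the last slot. Flatness of
the unit and absence of torsion make the Christoffel map of ∇₁ vanish in the direction e. -/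
theorem christoffelMap_hydro (h : IsBiFlatOn S W) (hJ : IsJordanFormOn S W) (hW : IsOpen W)
    {x : Fin 3 → 𝕜} (hx : x ∈ W) (a b : Fin 3 → 𝕜) :
    christoffelMap S.cov1 x b a = christoffelMap S.cov2 x b a
      - christoffelMap S.cov2 x (Pi.single 0 1) (jetMulL 𝕜 a b) := by
  set e : Fin 3 → 𝕜 := Pi.single 0 1
  have h1 := h.hydro_mul W subset_rfl hW (fun _ => a) (fun _ => b) (fun _ => e)
    (smoothField_const a W) (smoothField_const b W) (smoothField_const e W) x hx
  have sub3 : ∀ P Q R P' Q' : Fin 3 → 𝕜, P = P' → Q = Q' → P - Q - R = P' - Q' - R := by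
    rintro P Q R _ _ rfl rfl; rfl
  have hcc : ∀ cov : TConnection 𝕜 (Fin 3 → 𝕜),
      IsCovariantDerivativeOn (I := I3 𝕜) (Fin 3 → 𝕜) cov W → ∀ u v w : Fin 3 → 𝕜,
      (cov (S.mul.app (fun _ => u) (fun _ => v)) x w : Fin 3 → 𝕜) =
        christoffelMap cov x w (jetMulL 𝕜 u v) := fun cov hc u v w =>
    hc.eq_of_eqOn_const hW (fun y hy => hJ.mul y hy u v) hx w
  let R : Fin 3 → 𝕜 := S.mul x a (lieB (𝕜 := 𝕜) (M := Fin 3 → 𝕜) (fun _ => b) (fun _ => e) x)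
  have h2 : ∀ cov : TConnection 𝕜 (Fin 3 → 𝕜),
      IsCovariantDerivativeOn (I := I3 𝕜) (Fin 3 → 𝕜) cov W →
      (cov.extD S.mul (fun _ => a) (fun _ => b) (fun _ => e) x : Fin 3 → 𝕜) =
        christoffelMap cov x b (jetMulL 𝕜 a e) - christoffelMap cov x e (jetMulL 𝕜 a b)
        - R :=
    fun cov hc => sub3 _ _ _ _ _ (hcc cov hc a e b) (hcc cov hc a b e)
  have h3 : ∀ P Q R P' Q' : Fin 3 → 𝕜, P - Q - R = P' - Q' - R → Q = 0 → P = P' - Q' := by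
    rintro P Q R P' Q' h rfl
    rw [← sub_left_inj.1 h, sub_zero]
  have h4 := h3 _ _ _ _ _ (((h2 _ h.flat1.connection.connection).symm.trans h1).trans
    (h2 _ h.flat2.connection.connection))
      ((h.flat1.connection.christoffelMap_comm hW hx _ _).trans
        (h.christoffelMap_unit hJ hW hx _))
  rw [jetMulL_single_zero] at h4
  exact h4

theorem dual_eq_jetInv (h : IsBiFlatOn S W) (hJ : IsJordanFormOn S W) {x : Fin 3 → 𝕜} (hx : x ∈ W)
    (h0 : x 0 ≠ 0) (v w : Fin 3 → 𝕜) :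
    (S.dual x v w : Fin 3 → 𝕜) = jetMulL 𝕜 (jetMulL 𝕜 v w) (jetInv x) := by
  obtain ⟨N, -, hN⟩ := h.dual_eq
  obtain ⟨h1, h2⟩ := hN x hx
  have e1 : jetMulL 𝕜 x (N x) = (Pi.single 0 1 : Fin 3 → 𝕜) := by
    have := ((hJ.mul x hx (S.E x) (N x)).symm.trans h1).trans (hJ.unit x hx)
    exact (congrArg (fun t => jetMulL 𝕜 t (N x : Fin 3 → 𝕜)) (hJ.euler x hx)).symm.trans this
  have e2 : (N x : Fin 3 → 𝕜) = jetInv x := by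
    have key : ∀ n : Fin 3 → 𝕜, jetMulL 𝕜 x n = Pi.single 0 1 → n = jetInv x := fun n hn => by
      have := congrArg (fun t => jetMulL 𝕜 t (jetInv x)) hn
      simp only [jetMulL_comm x n, jetMulL_assoc, jetMulL_jetInv h0, jetMulL_single_zero] at this
      rw [this, jetMulL_comm, jetMulL_single_zero]
    exact key _ e1
  refine (h2 v w).trans ((hJ.mul x hx _ _).trans ?_)
  exact congrArg₂ (fun s t => jetMulL 𝕜 s t) (hJ.mul x hx v w) e2

end IsBiFlatOn

end JordanForm

/-! ### Invariance and homogeneity of the Christoffel symbols. -/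

section Homogeneity

variable {𝕜 : Type*} [RCLike 𝕜]

namespace IsBiFlatOn

variable {S : BiFlatData 𝕜 (Fin 3 → 𝕜)} {W : Set (Fin 3 → 𝕜)}

/-- Let b = v * w, so that E ∘ b = v ∘ w. Applying `christoffelMap_hydro` to the pairs (v, w) and
(b, E) produces the same unknown term in direction e; eliminating it and using ∇₂E = 0 gives the
formula for ∇₂ in terms of ∇₁. -/
theorem christoffelMap₂_one (h : IsBiFlatOn S W) (hJ : IsJordanFormOn S W) (hW : IsOpen W)
    {x : Fin 3 → 𝕜} (hx : x ∈ W) (h0 : x 0 ≠ 0) (v w : Fin 3 → 𝕜) :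
    christoffelMap S.cov2 x v w = christoffelMap S.cov1 x v w
      - (jetMulL 𝕜 (jetMulL 𝕜 v w) (jetInv x)
        + christoffelMap S.cov1 x (jetMulL 𝕜 (jetMulL 𝕜 v w) (jetInv x)) x) := by
  set b := jetMulL 𝕜 (jetMulL 𝕜 v w) (jetInv x) with hb
  have h1 := h.christoffelMap_hydro hJ hW hx x b
  have h2 := h.christoffelMap_hydro hJ hW hx w v
  have h3 := h.christoffelMap_euler hJ hW hx b
  have h4 : jetMulL 𝕜 x b = jetMulL 𝕜 w v := by
    rw [hb, jetMulL_left_comm, jetMulL_jetInv h0, jetMulL_single_zero, jetMulL_comm]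
  rw [h4] at h1
  have key : ∀ A B C D E : Fin 3 → 𝕜, A = B - C → D = E - C → b + B = 0 → E = D - (b + A) := by
    rintro A B C D E rfl rfl h
    have : B = -b := by rw [← sub_eq_zero]; simpa [add_comm] using h
    rw [this]
    abel
  exact key _ _ _ _ _ h1 h2 h3

/-- ∇₂E = 0 says that the Christoffel map contracted with the position is minus the identity. Its
derivative computes ∂_v of the map with one slot fixed at x, and the curvature in the directions v
and x turns this into the derivative along x. -/
theorem fderiv_christoffelMap₂_self (h : IsBiFlatOn S W) (hJ : IsJordanFormOn S W) (hW : IsOpen W)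
    {x : Fin 3 → 𝕜} (hx : x ∈ W) (v w : Fin 3 → 𝕜) :
    fderiv 𝕜 (christoffelMap S.cov2) x x v w = -christoffelMap S.cov2 x v w := by
  have hc := h.flat2.connection
  have dG := ((hc.contDiffOn_christoffelMap hW).differentiableOn (by simp)).differentiableAt
    (hW.mem_nhds hx)
  have e1 := (((dG.hasFDerivAt.clm_apply (hasFDerivAt_const w x)).clm_apply
    (hasFDerivAt_id x)).const_add w).fderiv
  have e2 : fderiv 𝕜 (fun y => w + christoffelMap S.cov2 y w y) x = 0 := by
    have : (fun y => w + christoffelMap S.cov2 y w y) =ᶠ[nhds x] fun _ => (0 : Fin 3 → 𝕜) :=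
      Filter.mem_of_superset (hW.mem_nhds hx) fun y hy => h.christoffelMap_euler hJ hW hy w
    rw [this.fderiv_eq]; simp
  have e3 := congrArg (fun L : (Fin 3 → 𝕜) →L[𝕜] Fin 3 → 𝕜 => L v) (e1.symm.trans e2)
  have e4 : christoffelMap S.cov2 x w v + fderiv 𝕜 (christoffelMap S.cov2) x v w x = 0 := by
    simpa using e3
  have e5 := hc.christoffelMap_curvature hW hx v x w
  have hsymm : fderiv 𝕜 (christoffelMap S.cov2) x v x w
      = fderiv 𝕜 (christoffelMap S.cov2) x v w x := by
    have hd : ∀ a b : Fin 3 → 𝕜, fderiv 𝕜 (fun y => christoffelMap S.cov2 y a b) x v =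
        fderiv 𝕜 (christoffelMap S.cov2) x v a b := fun a b => by
      rw [((dG.hasFDerivAt.clm_apply (hasFDerivAt_const a x)).clm_apply
        (hasFDerivAt_const b x)).fderiv]
      simp
    have he : (fun y => christoffelMap S.cov2 y x w) =ᶠ[nhds x]
        fun y => christoffelMap S.cov2 y w x := Filter.mem_of_superset (hW.mem_nhds hx)
      fun y hy => hc.christoffelMap_comm hW hy x w
    rw [← hd, ← hd, he.fderiv_eq]
  have hE : ∀ u : Fin 3 → 𝕜, christoffelMap S.cov2 x x u = -u := fun u => by
    rw [hc.christoffelMap_comm hW hx, ← sub_eq_zero, sub_neg_eq_add, add_comm]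
    exact h.christoffelMap_euler hJ hW hx u
  rw [hE, hE, map_neg, hsymm] at e5
  rw [hc.christoffelMap_comm hW hx w v] at e4
  have key : ∀ A B C : Fin 3 → 𝕜, C + A = 0 → A - B + -C - -C = 0 → B = -C := by
    intro A B C h1 h2
    have : A = -C := by rw [← sub_eq_zero]; simpa [add_comm] using h1
    rw [this] at h2
    rw [← sub_eq_zero, ← neg_eq_zero, ← h2]
    abel
  exact key _ _ _ e4 e5

/-- By `christoffelMap_hydro` the symbols of ∇₁ are combinations of those of ∇₂ with constant
coefficients, so homogeneity of degree -1 passes to them. -/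
theorem fderiv_christoffelMap₁_self (h : IsBiFlatOn S W) (hJ : IsJordanFormOn S W) (hW : IsOpen W)
    {x : Fin 3 → 𝕜} (hx : x ∈ W) (v w : Fin 3 → 𝕜) :
    fderiv 𝕜 (christoffelMap S.cov1) x x v w = -christoffelMap S.cov1 x v w := by
  have d1 := ((h.flat1.connection.contDiffOn_christoffelMap hW).differentiableOn
    (by simp)).differentiableAt (hW.mem_nhds hx)
  have d2 := ((h.flat2.connection.contDiffOn_christoffelMap hW).differentiableOn
    (by simp)).differentiableAt (hW.mem_nhds hx)
  have hv : ∀ v w : Fin 3 → 𝕜, HasFDerivAt (fun y => christoffelMap S.cov2 y v w) _ x := fun v w =>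
    (d2.hasFDerivAt.clm_apply (hasFDerivAt_const v x)).clm_apply (hasFDerivAt_const w x)
  have e1 := ((d1.hasFDerivAt.clm_apply (hasFDerivAt_const v x)).clm_apply
    (hasFDerivAt_const w x)).fderiv
  have he : (fun y => christoffelMap S.cov1 y v w) =ᶠ[nhds x] fun y => christoffelMap S.cov2 y v w
      - christoffelMap S.cov2 y (Pi.single 0 1) (jetMulL 𝕜 w v) :=
    Filter.mem_of_superset (hW.mem_nhds hx) fun y hy => h.christoffelMap_hydro hJ hW hy w v
  have e2 := congrArg (fun L : (Fin 3 → 𝕜) →L[𝕜] Fin 3 → 𝕜 => L x)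
    (((hv v w).sub (hv (Pi.single 0 1) (jetMulL 𝕜 w v))).fderiv.symm.trans
      (he.fderiv_eq.symm.trans e1))
  have e3 : fderiv 𝕜 (christoffelMap S.cov2) x x v w
      - fderiv 𝕜 (christoffelMap S.cov2) x x (Pi.single 0 1) (jetMulL 𝕜 w v)
      = fderiv 𝕜 (christoffelMap S.cov1) x x v w := by
    simpa using e2
  rw [← e3, h.fderiv_christoffelMap₂_self hJ hW hx, h.fderiv_christoffelMap₂_self hJ hW hx,
    h.christoffelMap_hydro hJ hW hx w v]
  abel

/-- The Christoffel map vanishes identically when one slot is e, so of the curvature in the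
directions e and v only the derivative along e is left. -/
theorem fderiv_christoffelMap₁_unit (h : IsBiFlatOn S W) (hJ : IsJordanFormOn S W) (hW : IsOpen W)
    {x : Fin 3 → 𝕜} (hx : x ∈ W) (v w : Fin 3 → 𝕜) :
    fderiv 𝕜 (christoffelMap S.cov1) x (Pi.single 0 1) v w = 0 := by
  have hc := h.flat1.connection
  have dG := ((hc.contDiffOn_christoffelMap hW).differentiableOn (by simp)).differentiableAt
    (hW.mem_nhds hx)
  set e : Fin 3 → 𝕜 := Pi.single 0 1 with he
  have hu : ∀ y ∈ W, ∀ u : Fin 3 → 𝕜, christoffelMap S.cov1 y e u = 0 := fun y hy u =>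
    (hc.christoffelMap_comm hW hy e u).trans (h.christoffelMap_unit hJ hW hy u)
  have e1 := ((dG.hasFDerivAt.clm_apply (hasFDerivAt_const e x)).clm_apply
    (hasFDerivAt_const w x)).fderiv
  have e2 : (fun y => christoffelMap S.cov1 y e w) =ᶠ[nhds x] fun _ => (0 : Fin 3 → 𝕜) :=
    Filter.mem_of_superset (hW.mem_nhds hx) fun y hy => hu y hy w
  rw [e2.fderiv_eq] at e1
  have e3 := congrArg (fun L : (Fin 3 → 𝕜) →L[𝕜] Fin 3 → 𝕜 => L v) e1
  have e4 : fderiv 𝕜 (christoffelMap S.cov1) x v e w = 0 := by simpa using e3.symm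
  have e5 := hc.christoffelMap_curvature hW hx e v w
  rw [e4, hu x hx, hu x hx, map_zero] at e5
  simpa using e5

/-- The six Christoffel symbols of `∇₁`, as a vector. -/
noncomputable def _root_.christoffelCoeff (cov : TConnection 𝕜 (Fin 3 → 𝕜)) (x : Fin 3 → 𝕜) :
    Fin 6 → 𝕜 :=
  let G := christoffelMap cov x
  let a : Fin 3 → 𝕜 := G (Pi.single 1 1) (Pi.single 1 1)
  let b : Fin 3 → 𝕜 := G (Pi.single 1 1) (Pi.single 2 1)
  ![b 0, b 2, b 1, a 0, a 1, a 2]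

/-- The symbols with a lower index 0 vanish by flatness of the unit. Compatibility on (∂₁, ∂₂, ∂₁),
with ∂₁ ∘ ∂₁ = ∂₂ and ∂₁ ∘ ∂₂ = 0, expresses the value on (∂₂, ∂₂) through those on (∂₁, ∂₁) and
(∂₁, ∂₂). Six components remain. -/
theorem christoffelMap_eq_christoffelL (h : IsBiFlatOn S W) (hJ : IsJordanFormOn S W)
    (hW : IsOpen W) {x : Fin 3 → 𝕜} (hx : x ∈ W) :
    christoffelMap S.cov1 x = christoffelL 𝕜 (christoffelCoeff S.cov1 x) := by
  have hc := h.flat1.connection.christoffelMap_comm hW hx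
  have h0 := h.christoffelMap_unit hJ hW hx
  have h1 := h.christoffelMap_compatible hJ hW hx (Pi.single 1 1) (Pi.single 2 1) (Pi.single 1 1)
  ext v w i
  set G := christoffelMap S.cov1 x with hG
  have hx : ∀ v : Fin 3 → 𝕜, v = v 0 • Pi.single 0 1 + v 1 • Pi.single 1 1 + v 2 • Pi.single 2 1 :=
    fun v => by ext i; fin_cases i <;> simp
  set a : Fin 3 → 𝕜 := G (Pi.single 1 1) (Pi.single 1 1) with ha
  set b : Fin 3 → 𝕜 := G (Pi.single 1 1) (Pi.single 2 1) with hb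
  have h21 : G (Pi.single 2 1) (Pi.single 1 1) = b := hc _ _
  have h01 : G (Pi.single 0 1) (Pi.single 1 1) = 0 := (hc _ _).trans (h0 _)
  have h02 : G (Pi.single 0 1) (Pi.single 2 1) = 0 := (hc _ _).trans (h0 _)
  have j1 : jetMulL 𝕜 (Pi.single 2 1) (Pi.single 1 1) = 0 := by
    ext i; fin_cases i <;> simp [jetMulL_apply]
  have j2 : jetMulL 𝕜 (Pi.single 1 1) (Pi.single 1 1) = Pi.single 2 1 := by
    ext i; fin_cases i <;> simp [jetMulL_apply]
  have h22 : G (Pi.single 2 1) (Pi.single 2 1) = ![0, b 0, b 1 - a 0] := by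
    rw [j1, j2, h21, map_zero] at h1
    have h3 : G (Pi.single 2 1) (Pi.single 2 1) =
        jetMulL 𝕜 (Pi.single 1 1) b - jetMulL 𝕜 (Pi.single 2 1) a := by
      rw [← sub_eq_zero, ← sub_eq_zero.2 h1.symm]
      abel
    rw [h3]
    ext i; fin_cases i <;> simp [jetMulL_apply]
  have hexp : G v w = (v 1 * w 1) • a + (v 1 * w 2 + v 2 * w 1) • b
      + (v 2 * w 2) • (![0, b 0, b 1 - a 0] : Fin 3 → 𝕜) := by
    conv_lhs => rw [hx v, hx w]
    simp only [map_add, map_smul, add_apply, smul_apply, h0, h01, h02, h21, h22, ← ha, ← hb]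
    module
  rw [hexp, christoffelL_apply]
  simp only [christoffelCoeff, ← hG, ← ha, ← hb]
  fin_cases i <;> simp <;> ring

theorem contDiffOn_christoffelCoeff (h : IsBiFlatOn S W) (hW : IsOpen W) :
    ContDiffOn 𝕜 ∞ (christoffelCoeff S.cov1) W := by
  have hc := h.flat1.connection.contDiffOn_christoffelMap hW
  have hvw : ∀ v w : Fin 3 → 𝕜, ∀ i, ContDiffOn 𝕜 ∞ (fun y => christoffelMap S.cov1 y v w i) W :=
    fun v w => contDiffOn_pi.1 ((hc.clm_apply contDiffOn_const).clm_apply contDiffOn_const)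
  refine contDiffOn_pi.2 fun i => ?_
  fin_cases i
  · exact hvw (Pi.single 1 1) (Pi.single 2 1) 0
  · exact hvw (Pi.single 1 1) (Pi.single 2 1) 2
  · exact hvw (Pi.single 1 1) (Pi.single 2 1) 1
  · exact hvw (Pi.single 1 1) (Pi.single 1 1) 0
  · exact hvw (Pi.single 1 1) (Pi.single 1 1) 1
  · exact hvw (Pi.single 1 1) (Pi.single 1 1) 2

theorem fderiv_christoffelMap₁ (h : IsBiFlatOn S W) (hJ : IsJordanFormOn S W) (hW : IsOpen W)
    {x : Fin 3 → 𝕜} (hx : x ∈ W) (k : Fin 3 → 𝕜) :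
    fderiv 𝕜 (christoffelMap S.cov1) x k =
      christoffelL 𝕜 (fderiv 𝕜 (christoffelCoeff S.cov1) x k) := by
  have hd := (((h.contDiffOn_christoffelCoeff hW).differentiableOn (by simp)).differentiableAt
    (hW.mem_nhds hx)).hasFDerivAt
  have he : christoffelMap S.cov1 =ᶠ[nhds x] fun y => christoffelL 𝕜 (christoffelCoeff S.cov1 y) :=
    Filter.mem_of_superset (hW.mem_nhds hx) fun y hy => h.christoffelMap_eq_christoffelL hJ hW hy
  have hL : HasFDerivAt (fun a => christoffelL 𝕜 a) (christoffelL 𝕜) (christoffelCoeff S.cov1 x) := by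
    apply ContinuousLinearMap.hasFDerivAt
  have := HasFDerivAt.comp (E := Fin 3 → 𝕜) (F := Fin 6 → 𝕜)
    (G := (Fin 3 → 𝕜) →L[𝕜] (Fin 3 → 𝕜) →L[𝕜] Fin 3 → 𝕜) x hL hd
  rw [he.fderiv_eq]
  exact congrArg (fun L : (Fin 3 → 𝕜) →L[𝕜] (Fin 3 → 𝕜) →L[𝕜] (Fin 3 → 𝕜) →L[𝕜] Fin 3 → 𝕜 =>
    L k) this.fderiv

theorem _root_.christoffelL_injective {a b : Fin 6 → 𝕜}
    (h : ∀ v w, christoffelL 𝕜 a v w = christoffelL 𝕜 b v w) : a = b := by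
  have h1 := h (Pi.single 1 1) (Pi.single 1 1)
  have h2 := h (Pi.single 1 1) (Pi.single 2 1)
  simp only [christoffelL_apply] at h1 h2
  ext i
  fin_cases i
  · simpa using congrFun h2 0
  · simpa using congrFun h2 2
  · simpa using congrFun h2 1
  · simpa using congrFun h1 0
  · simpa using congrFun h1 1
  · simpa using congrFun h1 2

theorem fderiv_christoffelCoeff_self (h : IsBiFlatOn S W) (hJ : IsJordanFormOn S W) (hW : IsOpen W)
    {x : Fin 3 → 𝕜} (hx : x ∈ W) :
    fderiv 𝕜 (christoffelCoeff S.cov1) x x = -christoffelCoeff S.cov1 x := by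
  refine christoffelL_injective fun v w => ?_
  rw [← h.fderiv_christoffelMap₁ hJ hW hx, h.fderiv_christoffelMap₁_self hJ hW hx,
    h.christoffelMap_eq_christoffelL hJ hW hx, map_neg]
  rfl

theorem fderiv_christoffelCoeff_unit (h : IsBiFlatOn S W) (hJ : IsJordanFormOn S W) (hW : IsOpen W)
    {x : Fin 3 → 𝕜} (hx : x ∈ W) :
    fderiv 𝕜 (christoffelCoeff S.cov1) x (Pi.single 0 1) = 0 := by
  refine christoffelL_injective fun v w => ?_
  rw [← h.fderiv_christoffelMap₁ hJ hW hx, h.fderiv_christoffelMap₁_unit hJ hW hx, map_zero]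
  rfl

end IsBiFlatOn

end Homogeneity

/-! ### The system of equations from the curvature. -/

section Box

variable {𝕜 : Type*} [RCLike 𝕜]

/-- The region `u⁰ ∈ B(q⁰, r)`, `u¹ ∈ B(q¹, r)`, `u²/u¹ ∈ B(q²/q¹, r)`. -/
def jordanBox (q : Fin 3 → 𝕜) (r : ℝ) : Set (Fin 3 → 𝕜) :=
  {u | u 0 ∈ Metric.ball (q 0) r ∧ u 1 ∈ Metric.ball (q 1) r ∧
    u 2 / u 1 ∈ Metric.ball (q 2 / q 1) r}

/-- A function on a box that is invariant under `∂₀` and homogeneous of degree `-1` is determined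
by its values at `u⁰ = q⁰`, `u¹ = q¹`. -/
theorem smul_eq_of_homogeneous {V : Type*} [NormedAddCommGroup V] [NormedSpace 𝕜 V]
    {q : Fin 3 → 𝕜} {r : ℝ} (hr : 0 < r) (h1 : ∀ t ∈ Metric.ball (q 1) r, t ≠ 0)
    {a : (Fin 3 → 𝕜) → V} (ha : ∀ x ∈ jordanBox q r, DifferentiableAt 𝕜 a x)
    (he : ∀ x ∈ jordanBox q r, fderiv 𝕜 a x (Pi.single 0 1) = 0)
    (hE : ∀ x ∈ jordanBox q r, fderiv 𝕜 a x x = -a x) {x : Fin 3 → 𝕜} (hx : x ∈ jordanBox q r) :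
    x 1 • a x = q 1 • a ![q 0, q 1, q 1 * (x 2 / x 1)] := by
  obtain ⟨hx0, hx1, hx2⟩ := hx
  set z := x 2 / x 1 with hz
  have hxz : x 1 * z = x 2 := by rw [hz]; field_simp [h1 _ hx1]
  have hmem : ∀ s ∈ Metric.ball (q 0) r, ∀ t ∈ Metric.ball (q 1) r,
      (![s, t, t * z] : Fin 3 → 𝕜) ∈ jordanBox q r := fun s hs t ht => by
    have : t * z / t = z := by field_simp [h1 t ht]
    exact ⟨by simpa using hs, by simpa using ht, by simpa [this] using hx2⟩
  have hconv : ∀ c : 𝕜, IsPreconnected (Metric.ball c r) := fun c =>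
    (convex_ball c r).isPreconnected
  -- Invariance moves the first coordinate to q 0 inside the box.
  have s1 : a ![x 0, x 1, x 1 * z] = a ![q 0, x 1, x 1 * z] := by
    have hd : ∀ s ∈ Metric.ball (q 0) r,
        HasDerivAt (fun s => a (![s, x 1, x 1 * z] : Fin 3 → 𝕜)) 0 s := fun s hs => by
      have hm := hmem s hs _ hx1
      have hl : HasDerivAt (fun s => (![s, x 1, x 1 * z] : Fin 3 → 𝕜)) (Pi.single 0 1) s := by
        refine hasDerivAt_pi.2 fun i => ?_
        fin_cases i
        · simpa using hasDerivAt_id' s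
        · simpa using hasDerivAt_const s (x 1)
        · simpa using hasDerivAt_const s (x 1 * z)
      have := (ha _ hm).hasFDerivAt.comp_hasDerivAt s hl
      rwa [he _ hm] at this
    exact Metric.isOpen_ball.is_const_of_deriv_eq_zero (hconv _)
      (fun s hs => (hd s hs).differentiableAt.differentiableWithinAt)
      (fun s hs => (hd s hs).deriv) hx0 (Metric.mem_ball_self hr)
  -- Along the line (q 0, t, t z) the quotient of the last two coordinates is fixed, so the line
  -- stays in the box, and t times the function is constant: its direction differs from the position
  -- field only by a multiple of ∂₀.
  have s2 : x 1 • a ![q 0, x 1, x 1 * z] = q 1 • a ![q 0, q 1, q 1 * z] := by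
    have hd : ∀ t ∈ Metric.ball (q 1) r,
        HasDerivAt (fun t => t • a (![q 0, t, t * z] : Fin 3 → 𝕜)) 0 t := fun t ht => by
      have hm := hmem _ (Metric.mem_ball_self hr) t ht
      have hl : HasDerivAt (fun t => (![q 0, t, t * z] : Fin 3 → 𝕜)) ![0, 1, z] t := by
        refine hasDerivAt_pi.2 fun i => ?_
        fin_cases i
        · simpa using hasDerivAt_const t (q 0)
        · simpa using hasDerivAt_id' t
        · simpa using (hasDerivAt_id t).mul_const z
      have h3 := (hasDerivAt_id t).smul ((ha _ hm).hasFDerivAt.comp_hasDerivAt t hl)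
      refine h3.congr_deriv ?_
      have hv : t • (![0, 1, z] : Fin 3 → 𝕜) = ![q 0, t, t * z] - q 0 • Pi.single 0 1 := by
        ext i; fin_cases i <;> simp
      have h4 : t • fderiv 𝕜 a ![q 0, t, t * z] ![0, 1, z] = -a ![q 0, t, t * z] := by
        rw [← map_smul, hv, map_sub, map_smul, he _ hm, hE _ hm, smul_zero, sub_zero]
      simp [h4]
    exact Metric.isOpen_ball.is_const_of_deriv_eq_zero (hconv _)
      (fun s hs => (hd s hs).differentiableAt.differentiableWithinAt)
      (fun s hs => (hd s hs).deriv) hx1 (Metric.mem_ball_self hr)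
  have hx' : x = ![x 0, x 1, x 1 * z] := by
    ext i; fin_cases i <;> simp [hxz]
  conv_lhs => rw [hx']
  rw [← s2, ← s1]
  simp

/-- The curvature of the connection with Christoffel symbols `F/u¹`, evaluated on the second and
third coordinate vector fields, vanishes exactly when the six equations hold. -/
theorem system_of_curvature {f f' : Fin 6 → 𝕜} {z : 𝕜}
    (h : ∀ w : Fin 3 → 𝕜, christoffelL 𝕜 (-(f + z • f')) (Pi.single 2 1) w
      - christoffelL 𝕜 f' (Pi.single 1 1) w
      + christoffelL 𝕜 f (Pi.single 1 1) (christoffelL 𝕜 f (Pi.single 2 1) w)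
      - christoffelL 𝕜 f (Pi.single 2 1) (christoffelL 𝕜 f (Pi.single 1 1) w) = 0) :
    f' 0 = 0 ∧
    f' 1 = 2 * f 3 * f 2 * z + 2 * f 1 * f 0 * z - 2 * f 4 * f 0 * z + f 5 * f 0 - f 1 * f 2
      + f 3 - f 2 ∧
    f' 2 = -f 3 * f 2 - f 1 * f 0 + f 4 * f 0 - f 0 ∧
    f' 3 = f 3 * f 2 + f 1 * f 0 - f 4 * f 0 - f 0 ∧
    f' 4 = f 3 * f 2 * z + f 1 * f 0 * z - f 4 * f 0 * z - f 5 * f 0 + f 1 * f 2 + f 0 * z - f 2 ∧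
    f' 5 = -2 * f 3 * f 2 * z ^ 2 - 2 * f 1 * f 0 * z ^ 2 + 2 * f 4 * f 0 * z ^ 2 - f 5 * f 0 * z
      + f 1 * f 2 * z + f 3 * f 5 - f 3 * z + f 1 ^ 2 - f 1 * f 4 + f 2 * z - f 1 := by
  -- The two values of w give six scalar equations, triangular in the derivatives once taken in the
  -- order below.
  have h1 := h (Pi.single 1 1)
  have h2 := h (Pi.single 2 1)
  have p0 := congrFun h2 0
  have p1 := congrFun h2 1
  have p2 := congrFun h2 2
  have r0 := congrFun h1 0
  have r1 := congrFun h1 1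
  have r2 := congrFun h1 2
  simp only [christoffelL_apply] at p0 p1 p2 r0 r1 r2
  simp at p0 p1 p2 r0 r1 r2
  have e0 : f' 0 = 0 := by linear_combination -p0
  have e2 : f' 2 = -f 3 * f 2 - f 1 * f 0 + f 4 * f 0 - f 0 := by linear_combination -p1 - z * e0
  have e3 : f' 3 = f 3 * f 2 + f 1 * f 0 - f 4 * f 0 - f 0 := by linear_combination -r0 - z * e0
  have e1 : f' 1 = 2 * f 3 * f 2 * z + 2 * f 1 * f 0 * z - 2 * f 4 * f 0 * z + f 5 * f 0
      - f 1 * f 2 + f 3 - f 2 := by linear_combination -p2 - z * e2 + z * e3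
  refine ⟨e0, e1, e2, e3, ?_, ?_⟩
  · linear_combination -r1 - z * e2
  · linear_combination -r2 - z * e1

namespace IsBiFlatOn

variable {S : BiFlatData 𝕜 (Fin 3 → 𝕜)} {q : Fin 3 → 𝕜} {r : ℝ}

/-- By invariance and homogeneity the six symbols at x are F(x 2 / x 1) / x 1, where F is read off
on the transversal line u 0 = q 0, u 1 = q 1. The curvature in the directions ∂₁ and ∂₂ along this
line, multiplied by (q 1)², involves only F and its derivative. -/
theorem exists_isSolutionOn (h : IsBiFlatOn S (jordanBox q r))
    (hJ : IsJordanFormOn S (jordanBox q r)) (hW : IsOpen (jordanBox q r)) (hr : 0 < r)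
    (h1 : ∀ t ∈ Metric.ball (q 1) r, t ≠ 0) :
    ∃ F : SixFunctions 𝕜, F.IsSolutionOn (Metric.ball (q 2 / q 1) r) ∧
      ∀ x ∈ jordanBox q r, christoffelMap S.cov1 x = christoffelL 𝕜 (F.coefficients x) := by
  set a := christoffelCoeff S.cov1 with ha
  have hq1 : q 1 ≠ 0 := h1 _ (Metric.mem_ball_self hr)
  have hda : ∀ x ∈ jordanBox q r, DifferentiableAt 𝕜 a x := fun x hx =>
    ((h.contDiffOn_christoffelCoeff hW).differentiableOn (by simp)).differentiableAt
      (hW.mem_nhds hx)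
  set p : 𝕜 → Fin 3 → 𝕜 := fun t => ![q 0, q 1, q 1 * t] with hp
  set f : 𝕜 → Fin 6 → 𝕜 := fun t => q 1 • a (p t) with hf
  have hpm : ∀ t ∈ Metric.ball (q 2 / q 1) r, p t ∈ jordanBox q r := fun t ht => by
    refine ⟨by simpa [hp] using hr, by simpa [hp] using hr, ?_⟩
    simpa [hp, mul_div_cancel_left₀ t hq1] using ht
  have hfd : ∀ t ∈ Metric.ball (q 2 / q 1) r,
      HasDerivAt f ((q 1 * q 1) • fderiv 𝕜 a (p t) (Pi.single 2 1)) t := fun t ht => by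
    have hl : HasDerivAt p (q 1 • Pi.single 2 1) t := by
      refine hasDerivAt_pi.2 fun i => ?_
      fin_cases i
      · simpa [hp] using hasDerivAt_const t (q 0)
      · simpa [hp] using hasDerivAt_const t (q 1)
      · simpa [hp] using (hasDerivAt_id' t).const_mul (q 1)
    refine (((hda _ (hpm t ht)).hasFDerivAt.comp_hasDerivAt t hl).const_smul (q 1)).congr_deriv ?_
    rw [map_smul, smul_smul]
  have key : ∀ t ∈ Metric.ball (q 2 / q 1) r, ∀ w : Fin 3 → 𝕜,
      christoffelL 𝕜 (-(f t + t • ((q 1 * q 1) • fderiv 𝕜 a (p t) (Pi.single 2 1))))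
        (Pi.single 2 1) w
      - christoffelL 𝕜 ((q 1 * q 1) • fderiv 𝕜 a (p t) (Pi.single 2 1)) (Pi.single 1 1) w
      + christoffelL 𝕜 (f t) (Pi.single 1 1) (christoffelL 𝕜 (f t) (Pi.single 2 1) w)
      - christoffelL 𝕜 (f t) (Pi.single 2 1) (christoffelL 𝕜 (f t) (Pi.single 1 1) w) = 0 := by
    intro t ht w
    have hm := hpm t ht
    have e1 := h.flat1.connection.christoffelMap_curvature hW hm (Pi.single 1 1) (Pi.single 2 1) w
    rw [h.fderiv_christoffelMap₁ hJ hW hm, h.fderiv_christoffelMap₁ hJ hW hm,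
      h.christoffelMap_eq_christoffelL hJ hW hm, ← ha] at e1
    have e2 := h.fderiv_christoffelCoeff_self hJ hW hm
    have e3 := h.fderiv_christoffelCoeff_unit hJ hW hm
    rw [← ha] at e2 e3
    have hv : p t = q 0 • Pi.single 0 1 + q 1 • Pi.single 1 1 + (q 1 * t) • Pi.single 2 1 := by
      ext i; fin_cases i <;> simp [hp]
    -- The derivative transverse to the line is eliminated by the Euler relation of degree -1.
    have e4 : (q 1 * q 1) • fderiv 𝕜 a (p t) (Pi.single 1 1) =
        -(f t + t • ((q 1 * q 1) • fderiv 𝕜 a (p t) (Pi.single 2 1))) := by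
      have e5 : fderiv 𝕜 a (p t) (p t) = q 1 • fderiv 𝕜 a (p t) (Pi.single 1 1)
          + (q 1 * t) • fderiv 𝕜 a (p t) (Pi.single 2 1) := by
        conv_lhs => rw [show fderiv 𝕜 a (p t) (p t) = fderiv 𝕜 a (p t) (q 0 • Pi.single 0 1
            + q 1 • Pi.single 1 1 + (q 1 * t) • Pi.single 2 1) from congrArg _ hv]
        rw [map_add, map_add, map_smul, map_smul, map_smul, e3, smul_zero, zero_add]
      have e6 := congrArg (fun X => q 1 • X) (e5.symm.trans e2)
      simp only [smul_add, smul_smul, smul_neg] at e6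
      rw [hf, neg_add, ← e6, smul_smul]
      have : t * (q 1 * q 1) = q 1 * (q 1 * t) := by ring
      rw [this]
      abel
    have e7 := congrArg (fun X => (q 1 * q 1) • X) e1
    simp only [smul_add, smul_sub, smul_zero] at e7
    rw [← e4, map_smul, map_smul, hf, map_smul]
    rw [← e7]
    simp only [smul_apply, map_smul, smul_smul]
  refine ⟨⟨fun t => f t 0, fun t => f t 1, fun t => f t 2, fun t => f t 3, fun t => f t 4,
    fun t => f t 5⟩, ?_, fun x hx => ?_⟩
  · have hs := fun t ht => system_of_curvature (key t ht)
    have hd := fun t ht i => hasDerivAt_pi.1 (hfd t ht) i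
    exact ⟨fun t ht => (hd t ht 0).congr_deriv (hs t ht).1,
      fun t ht => (hd t ht 1).congr_deriv (hs t ht).2.1,
      fun t ht => (hd t ht 2).congr_deriv (hs t ht).2.2.1,
      fun t ht => (hd t ht 3).congr_deriv (hs t ht).2.2.2.1,
      fun t ht => (hd t ht 4).congr_deriv (hs t ht).2.2.2.2.1,
      fun t ht => (hd t ht 5).congr_deriv (hs t ht).2.2.2.2.2⟩
  · rw [h.christoffelMap_eq_christoffelL hJ hW hx]
    congr 1
    have e1 := smul_eq_of_homogeneous hr h1 hda
      (fun x hx => h.fderiv_christoffelCoeff_unit hJ hW hx)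
      (fun x hx => h.fderiv_christoffelCoeff_self hJ hW hx) hx
    have hx1 : x 1 ≠ 0 := h1 _ hx.2.1
    have e2 : ∀ i, a x i = f (x 2 / x 1) i / x 1 := fun i => by
      rw [eq_div_iff hx1, mul_comm]
      exact congrFun e1 i
    ext i
    fin_cases i
    · exact e2 0
    · exact e2 1
    · exact e2 2
    · exact e2 3
    · exact e2 4
    · exact e2 5

end IsBiFlatOn

end Box

/-! ### From Jordan coordinates to the normal form on the manifold. -/

section Charts

variable {𝕜 : Type*} [RCLike 𝕜] {M : Type*} [TopologicalSpace M] [ChartedSpace (Fin 3 → 𝕜) M]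
  [IsManifold (I3 𝕜) ∞ M] {φ ψ : OpenPartialHomeomorph M (Fin 3 → 𝕜)}
  {g : OpenPartialHomeomorph (Fin 3 → 𝕜) (Fin 3 → 𝕜)}

theorem trans_mem_maximalAtlas_of_mem_contDiffGroupoid
    (hφ : φ ∈ IsManifold.maximalAtlas (I3 𝕜) ∞ M) (hg : g ∈ contDiffGroupoid ∞ (I3 𝕜)) :
    φ.trans g ∈ IsManifold.maximalAtlas (I3 𝕜) ∞ M := by
  have hg' : g ∈ IsManifold.maximalAtlas (I3 𝕜) ∞ (Fin 3 → 𝕜) :=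
    StructureGroupoid.mem_maximalAtlas_of_mem_groupoid _ hg
  refine OpenPartialHomeomorph.mem_maximalAtlas_of_contMDiffOn (I := I3 𝕜) _ ?_ ?_
  · exact (contMDiffOn_of_mem_maximalAtlas hg').comp
      ((contMDiffOn_of_mem_maximalAtlas hφ).mono fun q hq => hq.1) fun q hq => hq.2
  · exact (contMDiffOn_symm_of_mem_maximalAtlas hφ).comp
      ((contMDiffOn_symm_of_mem_maximalAtlas hg').mono fun q hq => hq.1) fun q hq => hq.2

theorem chartD_trans (hφ : φ ∈ IsManifold.maximalAtlas (I3 𝕜) ∞ M)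
    (hg : g ∈ contDiffGroupoid ∞ (I3 𝕜)) {q : M} (hq : q ∈ (φ.trans g).source)
    (v : TangentSpace (I3 𝕜) q) :
    chartD (φ.trans g) q v = fderiv 𝕜 g (φ q) (chartD φ q v) := by
  have hg' : g ∈ IsManifold.maximalAtlas (I3 𝕜) ∞ (Fin 3 → 𝕜) :=
    StructureGroupoid.mem_maximalAtlas_of_mem_groupoid _ hg
  have d1 : MDifferentiableAt (I3 𝕜) (I3 𝕜) φ q :=
    (contMDiffAt_of_mem_maximalAtlas hφ hq.1).mdifferentiableAt (by simp)
  have d2 : MDifferentiableAt (I3 𝕜) (I3 𝕜) g (φ q) :=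
    (contMDiffAt_of_mem_maximalAtlas hg' hq.2).mdifferentiableAt (by simp)
  have e := mfderiv_comp q d2 d1
  rw [mfderiv_eq_fderiv] at e
  exact congrArg (fun L => L v) e

theorem IsJordanFormOn.push_trans {S : BiFlatData 𝕜 M}
    (hφ : φ ∈ IsManifold.maximalAtlas (I3 𝕜) ∞ M)
    (hg : g ∈ contDiffGroupoid ∞ (I3 𝕜)) (hs : g.source ⊆ φ.target)
    (h : ∀ x ∈ g.source, fderiv 𝕜 g x ((S.push φ).e x) = Pi.single 0 1 ∧
      fderiv 𝕜 g x ((S.push φ).E x) = g x ∧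
      ∀ v w : Fin 3 → 𝕜, fderiv 𝕜 g x ((S.push φ).mul x v w) =
        jetMulL 𝕜 (fderiv 𝕜 g x v) (fderiv 𝕜 g x w)) :
    IsJordanFormOn (S.push (φ.trans g)) g.target := by
  have hψ := trans_mem_maximalAtlas_of_mem_contDiffGroupoid hφ hg
  have hmem : ∀ y ∈ g.target, φ.symm (g.symm y) ∈ (φ.trans g).source := fun y hy => by
    have := hs (g.map_target hy)
    refine ⟨φ.map_target this, ?_⟩
    change φ (φ.symm (g.symm y)) ∈ g.source
    rw [φ.right_inv this]
    exact g.map_target hy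
  have hD : ∀ y ∈ g.target, ∀ v : TangentSpace (I3 𝕜) (φ.symm (g.symm y)),
      chartD (φ.trans g) (φ.symm (g.symm y)) v =
        fderiv 𝕜 g (g.symm y) (chartD φ (φ.symm (g.symm y)) v) := fun y hy v => by
    rw [chartD_trans hφ hg (hmem y hy), φ.right_inv (hs (g.map_target hy))]
  refine ⟨fun y hy => (hD y hy _).trans (h _ (g.map_target hy)).1, fun y hy =>
    (hD y hy _).trans ((h _ (g.map_target hy)).2.1.trans (g.right_inv hy)), fun y hy v w => ?_⟩
  have hq := hmem y hy
  have e := (h _ (g.map_target hy)).2.2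
    (chartD φ (φ.symm (g.symm y)) (chartDInv (φ.trans g) (φ.symm (g.symm y)) v))
    (chartD φ (φ.symm (g.symm y)) (chartDInv (φ.trans g) (φ.symm (g.symm y)) w))
  rw [← hD y hy, ← hD y hy, chartD_chartDInv hψ hq, chartD_chartDInv hψ hq] at e
  refine (hD y hy _).trans (Eq.trans ?_ e)
  refine congrArg (fun t => fderiv 𝕜 g (g.symm y) t) ?_
  refine Eq.trans ?_ (pushProduct_apply φ S.mul _ _ _).symm
  rw [chartDInv_chartD hφ hq.1, chartDInv_chartD hφ hq.1]
  rfl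

theorem eq_chartDInv (hψ : ψ ∈ IsManifold.maximalAtlas (I3 𝕜) ∞ M) {q : M} (hq : q ∈ ψ.source)
    {v : TangentSpace (I3 𝕜) q} {w : Fin 3 → 𝕜} (h : chartD ψ q v = w) : v = chartDInv ψ q w := by
  rw [← h, chartDInv_chartD hψ hq]

theorem chartDInv_eq_sum (ψ : OpenPartialHomeomorph M (Fin 3 → 𝕜)) (q : M) (w : Fin 3 → 𝕜) :
    chartDInv ψ q w = ∑ i, w i • coordField ψ i q := by
  have : w = ∑ i, w i • (Pi.single i 1 : Fin 3 → 𝕜) := by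
    ext j; simp [Finset.sum_apply, Pi.single_apply]
  conv_lhs => rw [this]
  rw [map_sum]
  simp only [map_smul]
  rfl

theorem jetMulL_single_single (i j : Fin 3) :
    jetMulL 𝕜 (Pi.single i 1) (Pi.single j 1) =
      if h : i.val + j.val < 3 then Pi.single (⟨i.val + j.val, h⟩ : Fin 3) 1 else 0 := by
  ext k
  fin_cases i <;> fin_cases j <;> fin_cases k <;> simp [jetMulL_apply]

theorem hasNormalFormOn_of_push {S : BiFlatData 𝕜 M} {s : Set M} {q₀ : Fin 3 → 𝕜} {r : ℝ}
    (hψ : ψ ∈ IsManifold.maximalAtlas (I3 𝕜) ∞ M) (hs : ψ.source ⊆ s) (h : IsBiFlatOn S s)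
    (hB : IsBiFlatOn (S.push ψ) ψ.target) (hJ : IsJordanFormOn (S.push ψ) ψ.target)
    (ht : ψ.target = jordanBox q₀ r) (h0 : ∀ t ∈ Metric.ball (q₀ 0) r, t ≠ 0)
    (h1 : ∀ t ∈ Metric.ball (q₀ 1) r, t ≠ 0) {F : SixFunctions 𝕜}
    (hF : ∀ x ∈ ψ.target, christoffelMap (S.push ψ).cov1 x = christoffelL 𝕜 (F.coefficients x)) :
    HasNormalFormOn S ψ ψ.source F (Metric.ball (q₀ 2 / q₀ 1) r) := by
  have hbox : ∀ q ∈ ψ.source, ψ q ∈ jordanBox q₀ r := fun q hq => ht ▸ ψ.map_source hq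
  have hex : ∀ q ∈ ψ.source, ∃ y ∈ ψ.target, ψ.symm y = q := fun q hq =>
    ⟨ψ q, ψ.map_source hq, ψ.left_inv hq⟩
  have hW := ψ.open_target
  have hcoord : ∀ k, pullField ψ (fun _ => (Pi.single k 1 : Fin 3 → 𝕜)) = coordField ψ k :=
    fun k => rfl
  have hcov : ∀ cov : TConnection 𝕜 M, IsFlatConnectionOn (pushConnection ψ cov) ψ.target →
      ∀ y ∈ ψ.target, ∀ j k : Fin 3,
      chartD ψ (ψ.symm y) (cov (coordField ψ k) (ψ.symm y) (coordField ψ j (ψ.symm y))) =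
        christoffelMap (pushConnection ψ cov) y (Pi.single j 1) (Pi.single k 1) :=
    fun cov hc y hy j k => christoffelMap_eq_cov hc.connection hy _ _
  have hd : ∀ y ∈ ψ.target, ∀ j k : Fin 3,
      chartD ψ (ψ.symm y) (S.dual (ψ.symm y) (coordField ψ j (ψ.symm y))
        (coordField ψ k (ψ.symm y))) = jetMulL 𝕜 (jetMulL 𝕜 (Pi.single j 1) (Pi.single k 1))
          (jetInv y) :=
    fun y hy j k => hB.dual_eq_jetInv hJ hy (h0 _ (ht ▸ hy).1) _ _
  refine ⟨fun q hq => ⟨h0 _ (hbox q hq).1, h1 _ (hbox q hq).2.1⟩, fun q hq => (hbox q hq).2.2,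
    ?_, ?_, ?_, ?_, ?_⟩
  · intro q hq
    obtain ⟨y, hy, rfl⟩ := hex q hq
    exact eq_chartDInv hψ hq (hJ.unit y hy)
  · intro q hq
    obtain ⟨y, hy, rfl⟩ := hex q hq
    rw [← chartDInv_eq_sum, ψ.right_inv hy]
    exact eq_chartDInv hψ hq (hJ.euler y hy)
  · intro q hq i j
    obtain ⟨y, hy, rfl⟩ := hex q hq
    have e := eq_chartDInv hψ hq ((hJ.mul y hy (Pi.single i 1) (Pi.single j 1)).trans
      (jetMulL_single_single i j))
    refine e.trans ?_
    split_ifs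
    · rfl
    · exact map_zero _
  · intro q hq j k
    obtain ⟨y, hy, rfl⟩ := hex q hq
    rw [← chartDInv_eq_sum, ψ.right_inv hy]
    refine eq_chartDInv hψ hq ((hcov S.cov1 hB.flat1.connection y hy j k).trans ?_)
    rw [← christoffelL_coefficients_single, ← hF y hy]
    rfl
  · intro q hq j k
    obtain ⟨y, hy, rfl⟩ := hex q hq
    set b : Fin 3 → 𝕜 := jetMulL 𝕜 (jetMulL 𝕜 (Pi.single j 1) (Pi.single k 1)) (jetInv y) with hb
    have e1 := eq_chartDInv hψ hq (hd y hy j k)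
    have rE := represents_pushField_target hψ hs h.flat2.fmanifold.smooth_unit
    have rb : Represents ψ ψ.target (pullField ψ fun _ => b) (fun _ => b) :=
      represents_pullField subset_rfl contDiffOn_const
    have e2 := (rb.nabla hψ hs ⟨h.flat1.connection.connection, h.flat1.connection.smooth⟩
      hW subset_rfl rE).2 y hy
    have e3 : ((pushConnection ψ S.cov1).app (fun _ => b) (pushField ψ S.E) y : Fin 3 → 𝕜) =
        b + christoffelMap (S.push ψ).cov1 y b y :=
      hB.flat1.connection.connection.eq_of_eqOn_id hW (fun x hx => hJ.euler x hx) hy b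
    have e4 : S.cov1 S.E (ψ.symm y) (S.dual (ψ.symm y) (coordField ψ j (ψ.symm y))
        (coordField ψ k (ψ.symm y))) =
        chartDInv ψ (ψ.symm y) (b + christoffelMap (S.push ψ).cov1 y b y) := by
      rw [e1, ← e3]
      exact e2
    -- The normal form of ∇₂ is not chosen but forced by the bi-flat axioms in Jordan coordinates.
    have e5 := hB.christoffelMap₂_one hJ hW hy (h0 _ (ht ▸ hy).1) (Pi.single j 1) (Pi.single k 1)
    rw [← hb] at e5
    have e6 := eq_chartDInv hψ hq ((hcov S.cov2 hB.flat2.connection y hy j k).trans e5)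
    have e7 := eq_chartDInv hψ hq (hcov S.cov1 hB.flat1.connection y hy j k)
    rw [e6, e7, e4, map_sub]
    rfl

end Charts

/-! ### Existence of the normal form. -/

section NormalFormExistence

variable {𝕜 : Type*} [RCLike 𝕜] {M : Type*} [TopologicalSpace M] [ChartedSpace (Fin 3 → 𝕜) M]
  [IsManifold (I3 𝕜) ∞ M]

/-- A chart restricted to s, followed by Jordan coordinates of the pushed structure. The image is a
box, so the solution lives on a ball of quotients u 2 / u 1, which is connected. -/
theorem IsRegularBiFlatOneBlockOn.exists_hasNormalFormOn {s : Set M} {S : BiFlatData 𝕜 M}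
    (hs : IsOpen s) (h : IsRegularBiFlatOneBlockOn S s) {p : M} (hp : p ∈ s) :
    ∃ ψ ∈ IsManifold.maximalAtlas (I3 𝕜) ∞ M, p ∈ ψ.source ∧ ψ.source ⊆ s ∧
      ∃ (D : Set 𝕜) (F : SixFunctions 𝕜), IsOpen D ∧ IsConnected D ∧ F.IsSolutionOn D ∧
        HasNormalFormOn S ψ ψ.source F D := by
  set φ : OpenPartialHomeomorph M (Fin 3 → 𝕜) :=
    (chartAt (Fin 3 → 𝕜) p).restr s with hφ_def
  have hφ : φ ∈ IsManifold.maximalAtlas (I3 𝕜) ∞ M :=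
    restr_mem_maximalAtlas _ (IsManifold.chart_mem_maximalAtlas p) hs
  have hφs : φ.source ⊆ s := fun q hq => by
    have : q ∈ (chartAt (Fin 3 → 𝕜) p).source ∩ interior s := hq
    exact interior_subset this.2
  have hpφ : p ∈ φ.source := ⟨mem_chart_source _ p, by rwa [hs.interior_eq]⟩
  obtain ⟨g, hg, hpg, hgs, hJ, q₀, r, hr, h0, h1, ht⟩ :=
    (h.push hφ hφs).exists_jordanCoordinates φ.open_target (φ.map_source hpφ)
  have hψ := trans_mem_maximalAtlas_of_mem_contDiffGroupoid hφ hg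
  have hψs : (φ.trans g).source ⊆ s := fun q hq => hφs hq.1
  have hψt : (φ.trans g).target = g.target := by
    refine Set.Subset.antisymm (fun y hy => hy.1) fun y hy => ⟨hy, hgs (g.map_target hy)⟩
  have hJψ : IsJordanFormOn (S.push (φ.trans g)) (φ.trans g).target :=
    hψt ▸ IsJordanFormOn.push_trans hφ hg hgs hJ
  have hB := (h.push hψ hψs).1
  have ht' : (φ.trans g).target = jordanBox q₀ r := hψt.trans ht
  obtain ⟨F, hF, hFc⟩ := (ht' ▸ hB : IsBiFlatOn _ (jordanBox q₀ r)).exists_isSolutionOn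
    (ht' ▸ hJψ) (ht' ▸ (φ.trans g).open_target) hr h1
  exact ⟨φ.trans g, hψ, ⟨hpφ, hpg⟩, hψs, _, F, Metric.isOpen_ball,
    (convex_ball _ r).isConnected ⟨_, Metric.mem_ball_self hr⟩, hF,
    hasNormalFormOn_of_push hψ hψs h.1 hB hJψ ht' h0 h1 fun x hx => hFc x (ht' ▸ hx)⟩

end NormalFormExistence

/-! ### The theorem. -/

theorem mainTheorem4 (𝕜 : Type*) [RCLike 𝕜] :
    -- (1) Every structure has, near each point, the normal form given by a solution of the system,
    -- and, for a nonzero first integral, hence by a solution of Painlevé IV.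
    (∀ (M : Type*) [TopologicalSpace M] [ChartedSpace (Fin 3 → 𝕜) M] [IsManifold (I3 𝕜) ∞ M]
      (s : Set M) (S : BiFlatData 𝕜 M), IsOpen s → IsRegularBiFlatOneBlockOn S s → ∀ p ∈ s,
      ∃ ψ ∈ IsManifold.maximalAtlas (I3 𝕜) ∞ M, p ∈ ψ.source ∧ ψ.source ⊆ s ∧
      ∃ (D : Set 𝕜) (F : SixFunctions 𝕜), IsOpen D ∧ IsConnected D ∧ F.IsSolutionOn D ∧
        HasNormalFormOn S ψ ψ.source F D ∧
        ∃ k₁ k₂ k₃ : 𝕜, F.HasIntegralsOn k₁ k₂ k₃ D ∧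
          (k₁ ≠ 0 → ∃ α β c : 𝕜, IsScaling k₁ α β ∧
            IsPainleveIVSolutionOn ((k₃ - 1) * β / α) c (F.painleveVar k₁ k₂ α β)
              (rescaledVar k₁ k₂ α ⁻¹' D))) ∧
    -- (2) Conversely, every solution of the system defines such a structure.
    (∀ (D : Set 𝕜) (F : SixFunctions 𝕜), IsOpen D → F.IsSolutionOn D →
      ∃ S : BiFlatData 𝕜 (Fin 3 → 𝕜), IsRegularBiFlatOneBlockOn S (modelRegion D) ∧
        HasNormalFormOn S (OpenPartialHomeomorph.refl (Fin 3 → 𝕜)) (modelRegion D) F D) ∧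
    -- (3) The system has three first integrals.
    (∀ (D : Set 𝕜) (F : SixFunctions 𝕜), IsOpen D → IsConnected D → F.IsSolutionOn D →
      ∃ k₁ k₂ k₃ : 𝕜, F.HasIntegralsOn k₁ k₂ k₃ D) ∧
    -- (4) For a nonzero value of the first one, scaling factors exist, and for any choice of them
    -- the solutions of the system with given values of the integrals correspond bijectively to the
    -- solutions of the Painlevé IV equations with given `b` and arbitrary `c`.
    (∀ k₁ : 𝕜, k₁ ≠ 0 → ∃ α β : 𝕜, IsScaling k₁ α β) ∧
    (∀ k₁ k₂ k₃ α β : 𝕜, k₁ ≠ 0 → IsScaling k₁ α β →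
      ∀ D : Set 𝕜, IsOpen D → IsConnected D →
      (∀ F : SixFunctions 𝕜, F.IsSolutionOn D → F.HasIntegralsOn k₁ k₂ k₃ D →
        ∃ c : 𝕜, IsPainleveIVSolutionOn ((k₃ - 1) * β / α) c (F.painleveVar k₁ k₂ α β)
          (rescaledVar k₁ k₂ α ⁻¹' D)) ∧
      (∀ (c : 𝕜) (y : 𝕜 → 𝕜),
        IsPainleveIVSolutionOn ((k₃ - 1) * β / α) c y (rescaledVar k₁ k₂ α ⁻¹' D) →
        ∃ F : SixFunctions 𝕜, F.IsSolutionOn D ∧ F.HasIntegralsOn k₁ k₂ k₃ D ∧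
          Set.EqOn (F.painleveVar k₁ k₂ α β) y (rescaledVar k₁ k₂ α ⁻¹' D) ∧
          ∀ G : SixFunctions 𝕜, G.IsSolutionOn D → G.HasIntegralsOn k₁ k₂ k₃ D →
            Set.EqOn (G.painleveVar k₁ k₂ α β) y (rescaledVar k₁ k₂ α ⁻¹' D) →
            G.AgreeOn F D)) ∧
    -- (5) Every solution of every member of the Painlevé IV family arises in this way.
    (∀ (b c : 𝕜) (y : 𝕜 → 𝕜) (Ω : Set 𝕜), IsOpen Ω → IsConnected Ω →
      IsPainleveIVSolutionOn b c y Ω → ∀ k₁ k₂ α β : 𝕜, k₁ ≠ 0 → IsScaling k₁ α β →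
      ∃ (D : Set 𝕜) (F : SixFunctions 𝕜) (k₃ : 𝕜) (S : BiFlatData 𝕜 (Fin 3 → 𝕜)),
        IsOpen D ∧ rescaledVar k₁ k₂ α ⁻¹' D = Ω ∧ (k₃ - 1) * β / α = b ∧
        F.IsSolutionOn D ∧ F.HasIntegralsOn k₁ k₂ k₃ D ∧
        Set.EqOn (F.painleveVar k₁ k₂ α β) y Ω ∧
        IsRegularBiFlatOneBlockOn S (modelRegion D) ∧
        HasNormalFormOn S (OpenPartialHomeomorph.refl (Fin 3 → 𝕜)) (modelRegion D) F D) := by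
  refine ⟨?_, ?_, ?_, fun k₁ _ => exists_isScaling k₁, ?_, ?_⟩
  · intro M _ _ _ s S hs h p hp
    obtain ⟨ψ, hψ, hpψ, hψs, D, F, hD, hDc, hF, hN⟩ := h.exists_hasNormalFormOn hs hp
    obtain ⟨k₁, k₂, k₃, hk⟩ := hF.exists_hasIntegralsOn hD hDc
    refine ⟨ψ, hψ, hpψ, hψs, D, F, hD, hDc, hF, hN, k₁, k₂, k₃, hk, fun hk₁ => ?_⟩
    obtain ⟨α, β, hαβ⟩ := exists_isScaling k₁
    obtain ⟨c, hc⟩ := hF.isPainleveIVSolutionOn hD hDc hk hk₁ hαβ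
    exact ⟨α, β, c, hαβ, hc⟩
  · exact fun D F hD hF =>
      ⟨F.model, hF.isRegularBiFlatOneBlockOn_model hD, SixFunctions.hasNormalFormOn_model F D⟩
  · exact fun D F hD hDc hF => hF.exists_hasIntegralsOn hD hDc
  · exact fun k₁ k₂ k₃ α β hk₁ hαβ D hD hDc =>
      ⟨fun F hF hk => hF.isPainleveIVSolutionOn hD hDc hk hk₁ hαβ,
        fun c y hy => hy.exists_isSolutionOn hD hk₁ hαβ⟩
  · intro b c y Ω hΩ _ hy k₁ k₂ α β hk₁ hαβ
    obtain ⟨hα, hβ⟩ := hαβ.ne_zero hk₁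
    -- The map is the inverse of `rescaledVar`, so D is the image of Ω in the variable z.
    set D : Set 𝕜 := (fun z => α * (z + k₂ / k₁)) ⁻¹' Ω with hD_def
    have hD : IsOpen D := hΩ.preimage (by fun_prop)
    have hDΩ : rescaledVar k₁ k₂ α ⁻¹' D = Ω := by
      ext t
      have : α * (t / α - k₂ / k₁ + k₂ / k₁) = t := by
        rw [sub_add_cancel, mul_div_cancel₀ t hα]
      simp only [hD_def, Set.mem_preimage, rescaledVar, this]
    -- The third integral is chosen as 1 + b α / β, the value of k₃ at which (k₃ - 1) β / α equals
    -- b.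
    have hb : (1 + b * α / β - 1) * β / α = b := by
      rw [add_sub_cancel_left, div_mul_cancel₀ _ hβ, mul_div_cancel_right₀ _ hα]
    obtain ⟨F, hF, hk, hFy, -⟩ := IsPainleveIVSolutionOn.exists_isSolutionOn
      (k₂ := k₂) (k₃ := 1 + b * α / β) (c := c) (y := y) hD hk₁ hαβ (by rwa [hb, hDΩ])
    exact ⟨D, F, 1 + b * α / β, F.model, hD, hDΩ, hb, hF, hk, hDΩ ▸ hFy,
      hF.isRegularBiFlatOneBlockOn_model hD, SixFunctions.hasNormalFormOn_model F D⟩
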